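/- Let $d,n\in\mathbb N$, let $A_1,\dots,A_d$ be $n\times n$ matrices whose entries are real polynomials in $n$ variables, and assume that $A_j(\boldsymbol u)$ is symmetric for all $j$ and all $\boldsymbol u\in\mathbb R^n$. Let $s>d/2+1$ and $M>0$. **Notation.** For a real-valued $f\in L^2((2\pi\mathbb T)^d)^n$ and real $r\ge 0$, put $\widehat f_{\boldsymbol k}=(2\pi)^{-d}\int_{[0,2\pi]^d}f(x)e^{-i\boldsymbol k\cdot x}\,dx$ and $|f|_{H^r}^2=\sum_{\boldsymbol k\in\mathbb Z^d}(1+|\boldsymbol k|^2)^{r}|\widehat f_{\boldsymbol k}|^2$; $H^r$ is the space of those $f$ with $|f|_{H^r}<\infty$. For $N\in\mathbb N$, let $P_Nf=\sum_{\boldsymbol k\in\{-N,\dots,N\}^d}\widehat f_{\boldsymbol k}e^{i\boldsymbol k\cdot x}$. For $\boldsymbol U^0\in H^s$ consider the problems $$\partial_t \boldsymbol U+\sum_{j=1}^d A_j(\boldsymbol U)\partial_{x_j}\boldsymbol U=0,\qquad \boldsymbol U|_{t=0}=\boldsymbol U^0,\tag{1}$$ $$\partial_t \boldsymbol U_N+P_N\Big(\sum_{j=1}^d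 A_j(\boldsymbol U_N)\partial_{x_j}\boldsymbol U_N\Big)=0,\qquad \boldsymbol U_N|_{t=0}=P_N\boldsymbol U^0.\tag{2}$$ Solutions are classical solutions, continuous with values in $H^s$, on an open time interval containing $0$. A solution is maximal if it has no extension to a strictly larger open interval; maximal solutions $\boldsymbol U$ of (1) and $\boldsymbol U_N$ of (2) are denoted $\boldsymbol U\in C(I;H^s)$ and $\boldsymbol U_N\in C(I_N;H^s)$. The matrices $A_j$ are fixed, and constants may depend on them. Call $T>0$ *admissible* if there are constants $c,c'>0$ such that, for every $\boldsymbol U^0\in H^s$ with $|\boldsymbol U^0|_{H^s}\le M$ and every $N\in\mathbb N$, problems (1) and (2) each have a unique maximal solution, $[0,T/|\boldsymbol U^0|_{H^s}]\subset I\cap I_N$, and, for $0\le t\le T/|\boldsymbol U^0|_{H^s}$, $|\boldsymbol U(t)|_{H^s}\le|\boldsymbol U^0|_{H^s}e^{c|\boldsymbol U^0|_{H^s}t}\le 2|\boldsymbol U^0|_{H^s}$ and $|\boldsymbol U_N(t)|_{H^s}\le|\boldsymbol U^0|_{H^s}e^{c'|\boldsymbol U^0|_{H^s}t}\le 2|\boldsymbol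 U^0|_{H^s}$. (If $|\boldsymbol U^0|_{H^s}=0$, read $[0,T/|\boldsymbol U^0|_{H^s}]$ as $[0,\infty)$.) **Proposition.** 1. There is an admissible $T>0$ (depending only on $s$ and $M$). 2. For every admissible $T$ there is $C>0$, depending only on $s$, $M$ and $T$, such that for all $\boldsymbol U^0\in H^s$ with $|\boldsymbol U^0|_{H^s}\le M$, all $N\ge1$, all $0\le t\le T/|\boldsymbol U^0|_{H^s}$ and all $0\le r\le s$, $$|(\boldsymbol U-\boldsymbol U_N)(t,\cdot)|_{H^r}\le C\,|\boldsymbol U^0|_{H^s}\,N^{r-s}.$$ 3. For all $L,B\in\mathbb R$ there are $N_0\ge1$ and $C^*>0$, depending only on $s$, $L$ and $B$, with the following property. Let $\boldsymbol U^0\in H^s$, let $I^*\subset I$ be compact, let $J$ be the smallest interval containing $I^*\cup\{0\}$ (so $J=I^*$ if $I^*$ is a compact interval containing $0$), and let $M^*=\sup_{t\in J}|\boldsymbol U(t,\cdot)|_{H^s}$. If $J$ has length at most $L$ and $M^*\le B$, then for all $N\ge N_0$ one has $I_N\supset I^*$ and, for all $0\le r\le s$, $$\sup_{t\in I^*}|(\boldsymbol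 U-\boldsymbol U_N)(t,\cdot)|_{H^r}\le C^*\,M^*\,N^{r-s}.$$ -/

import Mathlib

open scoped Topology

namespace FourierGalerkin

noncomputable section

/-- Functions `ℝ^d → ℝ^n`; those of interest are `2π`-periodic in every variable. -/
abbrev Func (d n : ℕ) : Type := (Fin d → ℝ) → (Fin n → ℝ)

/-- `f` is `2π`-periodic in each coordinate, that is, a function on the torus `(2π𝕋)^d`. -/
def IsPeriodic {d n : ℕ} (f : Func d n) : Prop :=
  ∀ (j : Fin d) (x : Fin d → ℝ), f (x + Pi.single j (2 * Real.pi)) = f x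

/-- The periodicity cell `[0, 2π]^d`. -/
def cell (d : ℕ) : Set (Fin d → ℝ) := Set.Icc 0 (fun _ => 2 * Real.pi)

/-- The character `x ↦ exp (i k ⋅ x)`. -/
def character {d : ℕ} (k : Fin d → ℤ) (x : Fin d → ℝ) : ℂ :=
  Complex.exp (Complex.I * ((∑ j, (k j : ℝ) * x j : ℝ) : ℂ))

/-- The `i`-th component of the `k`-th Fourier coefficient,
`(2π)^{-d} ∫_{[0,2π]^d} f_i(x) exp (- i k ⋅ x) dx`. -/
def coeff {d n : ℕ} (f : Func d n) (k : Fin d → ℤ) (i : Fin n) : ℂ :=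
  (((2 * Real.pi) ^ d)⁻¹ : ℝ) * ∫ x in cell d, (f x i : ℂ) * character (-k) x

/-- The `k`-th term `⟨k⟩^{2s} |f̂_k|²` of the squared `H^s` norm, `⟨k⟩² = 1 + |k|²`. -/
def hsTerm {d n : ℕ} (s : ℝ) (f : Func d n) (k : Fin d → ℤ) : ℝ :=
  (1 + ∑ j, (k j : ℝ) ^ 2) ^ s * ∑ i, ‖coeff f k i‖ ^ 2

/-- Membership in `H^s((2π𝕋)^d)^n`: periodic, (locally) square integrable, and with finite
`H^s` norm. Elements are functions rather than classes modulo equality almost everywhere. -/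
def MemHs {d n : ℕ} (s : ℝ) (f : Func d n) : Prop :=
  IsPeriodic f ∧ MeasureTheory.MemLp f 2 (MeasureTheory.volume.restrict (cell d)) ∧
    Summable (hsTerm s f)

/-- The `H^s` norm `(∑_k ⟨k⟩^{2s} |f̂_k|²)^{1/2}` (meaningful when `MemHs s f`). -/
def hsNorm {d n : ℕ} (s : ℝ) (f : Func d n) : ℝ :=
  Real.sqrt (∑' k, hsTerm s f k)

/-- The sharp low-pass filter `P_N`: the Fourier multiplier with symbol the indicator function of
`{-N, …, N}^d`. The sum is real when `f` is integrable on the cell, as `f` is real-valued; the real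
part only serves to land in `ℝ`. -/
def sharpFilter {d n : ℕ} (N : ℕ) (f : Func d n) : Func d n := fun x i =>
  (∑ k ∈ Fintype.piFinset (fun _ : Fin d => Finset.Icc (-(N : ℤ)) (N : ℤ)),
    coeff f k i * character k x).re

/-- The coefficient matrices of a first-order system with polynomial nonlinearities: `A j` is the
matrix of polynomials in the `n` unknowns that multiplies `∂_{x_j}`. -/
abbrev Coefficients (d n : ℕ) : Type :=
  Fin d → Matrix (Fin n) (Fin n) (MvPolynomial (Fin n) ℝ)

/-- The real matrix `A_j(u)`. -/
def Coefficients.at {d n : ℕ} (A : Coefficients d n) (j : Fin d) (u : Fin n → ℝ) :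
    Matrix (Fin n) (Fin n) ℝ :=
  (A j).map (MvPolynomial.eval u)

/-- The function `∑_j A_j(v) ∂_{x_j} v`. -/
def transport {d n : ℕ} (A : Coefficients d n) (v : Func d n) : Func d n := fun x =>
  ∑ j, (A.at j (v x)).mulVec (fderiv ℝ v x (Pi.single j 1))

/-- `U ∈ C(I; H^s)` is a classical solution, on the open interval `I ∋ 0`, of
`∂_t U + P (∑_j A_j(U) ∂_{x_j} U) = 0`, `U(0) = P U⁰`.
Here `P = id` gives the hyperbolic system and `P = P_N` its Fourier-Galerkin semi-discretization.
The values of `U` outside `I` play no role. -/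
structure IsClassicalSolution {d n : ℕ} (P : Func d n → Func d n) (A : Coefficients d n) (s : ℝ)
    (U₀ : Func d n) (I : Set ℝ) (U : ℝ → Func d n) : Prop where
  isOpen : IsOpen I
  ordConnected : I.OrdConnected
  zero_mem : (0 : ℝ) ∈ I
  memHs : ∀ t ∈ I, MemHs s (U t)
  continuous_hs : ∀ t₀ ∈ I, Filter.Tendsto (fun t => hsNorm s (U t - U t₀)) (𝓝[I] t₀) (𝓝 0)
  contDiff : ∀ t ∈ I, ContDiff ℝ 1 (U t)
  equation : ∀ t ∈ I, ∀ x, HasDerivAt (fun τ => U τ x) (-(P (transport A (U t)) x)) t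
  initial : U 0 =ᵐ[MeasureTheory.volume] P U₀

/-- A classical solution that has no extension to a strictly larger open interval. -/
def IsMaximalSolution {d n : ℕ} (P : Func d n → Func d n) (A : Coefficients d n) (s : ℝ)
    (U₀ : Func d n) (I : Set ℝ) (U : ℝ → Func d n) : Prop :=
  IsClassicalSolution P A s U₀ I U ∧
    ∀ (J : Set ℝ) (V : ℝ → Func d n), IsClassicalSolution P A s U₀ J V → I ⊆ J →
      Set.EqOn V U I → J ⊆ I

/-- There is exactly one maximal solution (as a function on its interval). -/
def HasUniqueMaximalSolution {d n : ℕ} (P : Func d n → Func d n) (A : Coefficients d n) (s : ℝ)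
    (U₀ : Func d n) : Prop :=
  (∃ (I : Set ℝ) (U : ℝ → Func d n), IsMaximalSolution P A s U₀ I U) ∧
    ∀ (I I' : Set ℝ) (U U' : ℝ → Func d n), IsMaximalSolution P A s U₀ I U →
      IsMaximalSolution P A s U₀ I' U' → I = I' ∧ Set.EqOn U U' I

/-- `T > 0` is a time scale of uniform well-posedness on the ball of radius `M` of `H^s`, for all
filters `P` of the family `F`: there is `C > 0` such that, for every `P` in `F` and all data `U⁰`
with `|U⁰|_{H^s} ≤ M`, there is a unique maximal solution, it exists on
`[0, T / |U⁰|_{H^s}]` (on `[0, ∞)` when `|U⁰|_{H^s} = 0`), and it satisfies there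
`|U(t)|_{H^s} ≤ |U⁰|_{H^s} exp (C |U⁰|_{H^s} t) ≤ 2 |U⁰|_{H^s}`. -/
def IsUniformTime {d n : ℕ} (F : Set (Func d n → Func d n)) (A : Coefficients d n)
    (s M T : ℝ) : Prop :=
  0 < T ∧ ∃ C : ℝ, 0 < C ∧ ∀ P ∈ F, ∀ U₀ : Func d n, MemHs s U₀ → hsNorm s U₀ ≤ M →
    HasUniqueMaximalSolution P A s U₀ ∧
    ∀ (I : Set ℝ) (U : ℝ → Func d n), IsMaximalSolution P A s U₀ I U →
      ∀ t : ℝ, 0 ≤ t → t * hsNorm s U₀ ≤ T →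
        t ∈ I ∧
        hsNorm s (U t) ≤ hsNorm s U₀ * Real.exp (C * hsNorm s U₀ * t) ∧
        hsNorm s U₀ * Real.exp (C * hsNorm s U₀ * t) ≤ 2 * hsNorm s U₀

end

end FourierGalerkin

/-!
Everything is done on Fourier coefficients. For an exponent `s > d/2 + 1` every function in `H^s`
has a Fourier series whose coefficients `c_k` satisfy `∑ ⟨k⟩ |c_k| < ∞` (the Wiener norm `W1`), so
that products are convolutions (`Reg`, `coefficient_bounds`), the operator `U ↦ ∑_j A_j(U) ∂_j U`
is given by an explicit kernel (`Reg.vc_transport`), and a classical solution of either problem is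
the same thing as a family of coefficients solving an infinite system of ordinary differential
equations together with continuity in `H^s` (`Flow`). The projected and the unprojected problem
are treated at once: in `Flow A S s J U` the set `S` of active frequencies is the whole lattice or
a box.

*Energy.* The symmetry of the `A_j` makes the kernel of `∑_j A_j(V) ∂_j` skew-symmetric up to a
term without loss of derivative. With the weight `⟨k⟩^s` this yields, for finite sums,
`|d/dt |U_N|²_{H^s}| ≤ C W1(U_N) |U_N|²_{H^s}` with `C` independent of `N` (`energy_Hs_le`,
`galerkin_rate`). Since `W1 ≤ C |⬝|_{H^s}`, the Galerkin approximations, which exist locally by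
the Picard-Lindelöf theorem in a finite-dimensional space, obey the required exponential bound on
a time interval of length proportional to `1 / |U⁰|` (`exists_galerkin_bound`).

*Comparison.* The sharp projection `P_N` does not commute with the operator to the right order,
hence `P_N U - U_N` is not the right quantity to estimate. One uses instead `Z = χ_N U - U_N`,
where `χ_N` is a Lipschitz cutoff supported in the box `{-N, …, N}^d`. Its commutator with
`A_j(U) ∂_j` is of order `N^{-s}` in `L²` (`N2_commutator_le`), and `P_N` is only tested against
`Z`, which it leaves invariant, so that it disappears from the energy identity. This gives
`|U - U_N|_{L²} ≤ C |U⁰| N^{-s}` as long as `|U|_{H^s}` and `W1(U_N)` are bounded (`compare_rate`,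
`exists_compare_bound`), and interpolation with the bounds in `H^s` gives the rate `N^{r-s}` in
`H^r`.

*Consequences.* Comparing `U_N` with `U_{N'}` for `N ≤ N'` shows that the Galerkin approximations
converge, which gives existence (`exists_modeFlow_univ`); two solutions with the same data are
limits of the same approximations, which gives uniqueness (`modeFlow_unique`); restarting the
solution at any time shows that its norm is continuous, whence continuity in `H^s`
(`ModeFlow.tendsto_Hs_sub`). For long times, `W1(U_N)` is at most `W1(U)` plus a negative power of
`N` as long as the comparison applies; a continuity argument then shows that `U_N` cannot stop
before `U` when `N` is large (`exists_approx`).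
-/

namespace FourierGalerkin

open scoped ENNReal NNReal
open MeasureTheory

noncomputable section

/-! ### Frequencies and Fourier weights -/

section Weights

variable {d : ℕ}

/-- The Japanese bracket `⟨k⟩ = (1 + |k|²)^{1/2}` of a frequency. -/
def jb (k : Fin d → ℤ) : ℝ := Real.sqrt (1 + ∑ j, (k j : ℝ) ^ 2)

lemma jb_sq (k : Fin d → ℤ) : jb k ^ 2 = 1 + ∑ j, (k j : ℝ) ^ 2 :=
  Real.sq_sqrt (by positivity)

lemma one_le_jb (k : Fin d → ℤ) : 1 ≤ jb k := by
  rw [jb, Real.one_le_sqrt]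
  have : 0 ≤ ∑ j, (k j : ℝ) ^ 2 := by positivity
  linarith

lemma jb_pos (k : Fin d → ℤ) : 0 < jb k := zero_lt_one.trans_le (one_le_jb k)

lemma jb_nonneg (k : Fin d → ℤ) : 0 ≤ jb k := (jb_pos k).le

@[simp] lemma jb_neg (k : Fin d → ℤ) : jb (-k) = jb k := by simp [jb]

lemma jb_sub_comm (k l : Fin d → ℤ) : jb (k - l) = jb (l - k) := by
  rw [← jb_neg, neg_sub]

lemma abs_coord_le_jb (k : Fin d → ℤ) (j : Fin d) : |(k j : ℝ)| ≤ jb k := by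
  rw [jb]
  apply Real.abs_le_sqrt
  have := Finset.single_le_sum (f := fun j => (k j : ℝ) ^ 2) (fun i _ => by positivity)
    (Finset.mem_univ j)
  linarith

lemma jb_add_le (k l : Fin d → ℤ) : jb (k + l) ≤ jb k + jb l := by
  rw [jb]
  refine Real.sqrt_le_iff.2 ⟨add_nonneg (jb_nonneg k) (jb_nonneg l), ?_⟩
  have h1 : (∑ j, (k j : ℝ) * l j) ≤ jb k * jb l := by
    refine (Real.sum_mul_le_sqrt_mul_sqrt _ _ _).trans ?_
    unfold jb
    gcongr <;> linarith
  have h2 : ∑ j, (((k + l) j : ℤ) : ℝ) ^ 2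
      = ∑ j, (k j : ℝ) ^ 2 + 2 * ∑ j, (k j : ℝ) * l j + ∑ j, (l j : ℝ) ^ 2 := by
    rw [Finset.mul_sum, ← Finset.sum_add_distrib, ← Finset.sum_add_distrib]
    refine Finset.sum_congr rfl fun j _ => ?_
    push_cast [Pi.add_apply]
    ring
  rw [h2]
  nlinarith [jb_sq k, jb_sq l]

lemma jb_le_sub_add (k l : Fin d → ℤ) : jb k ≤ jb (k - l) + jb l := by
  simpa using jb_add_le (k - l) l

lemma abs_jb_sub_le (k l : Fin d → ℤ) : |jb k - jb l| ≤ jb (k - l) := by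
  rw [abs_le]
  have h1 := jb_le_sub_add k l
  have h2 := jb_le_sub_add l k
  rw [jb_sub_comm] at h2
  constructor <;> linarith

lemma one_le_jb_rpow {r : ℝ} (hr : 0 ≤ r) (k : Fin d → ℤ) : 1 ≤ jb k ^ r :=
  Real.one_le_rpow (one_le_jb k) hr

lemma jb_rpow_pos (r : ℝ) (k : Fin d → ℤ) : 0 < jb k ^ r := Real.rpow_pos_of_pos (jb_pos k) r

lemma weight_eq (s : ℝ) (k : Fin d → ℤ) : (1 + ∑ j, (k j : ℝ) ^ 2) ^ s = (jb k ^ s) ^ 2 := by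
  rw [← jb_sq, ← Real.rpow_natCast, ← Real.rpow_natCast, ← Real.rpow_mul (jb_nonneg k),
    ← Real.rpow_mul (jb_nonneg k), mul_comm]

/-- Tangent line inequality for `x ↦ x ^ s`. -/
lemma rpow_sub_rpow_le {a b s : ℝ} (ha : 0 < a) (hb : 0 < b) (hs : 1 ≤ s) :
    a ^ s - b ^ s ≤ s * a ^ (s - 1) * (a - b) := by
  have h := one_add_mul_self_le_rpow_one_add (s := b / a - 1) (by
    have : 0 < b / a := by positivity
    linarith) hs
  rw [add_sub_cancel, Real.div_rpow hb.le ha.le, le_div_iff₀ (by positivity)] at h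
  have h3 : a ^ s = a ^ (s - 1) * a := by
    rw [← Real.rpow_add_one ha.ne']; ring_nf
  have h4 : (1 + s * (b / a - 1)) * a ^ s = a ^ s - s * a ^ (s - 1) * (a - b) := by
    rw [h3]; field_simp; ring
  linarith

lemma add_rpow_le_two_rpow {a b r : ℝ} (ha : 0 ≤ a) (hb : 0 ≤ b) (hr : 0 ≤ r) :
    (a + b) ^ r ≤ 2 ^ r * (a ^ r + b ^ r) := by
  have h1 : (a + b) ^ r ≤ (2 * max a b) ^ r := by
    apply Real.rpow_le_rpow (by positivity) _ hr
    have := le_max_left a b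
    have := le_max_right a b
    linarith
  rw [Real.mul_rpow (by norm_num) (le_max_of_le_left ha)] at h1
  refine h1.trans ?_
  gcongr
  rcases max_choice a b with h | h <;> rw [h]
  · linarith [Real.rpow_nonneg hb r]
  · linarith [Real.rpow_nonneg ha r]

lemma jb_rpow_le {r : ℝ} (hr : 0 ≤ r) (k l : Fin d → ℤ) :
    jb k ^ r ≤ 2 ^ r * (jb (k - l) ^ r + jb l ^ r) :=
  (Real.rpow_le_rpow (jb_nonneg k) (jb_le_sub_add k l) hr).trans
    (add_rpow_le_two_rpow (jb_nonneg _) (jb_nonneg _) hr)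

lemma jb_le_two_mul (k l : Fin d → ℤ) : jb k ≤ 2 * (jb (k - l) * jb l) := by
  have h1 := one_le_jb (k - l)
  have h2 := one_le_jb l
  nlinarith [jb_le_sub_add k l]

/-- The difference of two Sobolev weights gains one derivative. -/
lemma abs_weight_sub_mul_le {s : ℝ} (hs : 1 ≤ s) (k l : Fin d → ℤ) :
    |jb k ^ s - jb l ^ s| * jb l
      ≤ s * 2 ^ s * (jb (k - l) * jb l ^ s + jb (k - l) ^ s * jb l) := by
  set a := jb k
  set b := jb l
  set c := jb (k - l)
  have ha : 0 < a := jb_pos k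
  have hb : 0 < b := jb_pos l
  have hc : 0 < c := jb_pos _
  have hab : |a - b| ≤ c := abs_jb_sub_le k l
  have habc : a ≤ c + b := jb_le_sub_add k l
  have key : |a ^ s - b ^ s| ≤ s * (c + b) ^ (s - 1) * c := by
    have hs0 : 0 ≤ s := by linarith
    have h1 : s * a ^ (s - 1) * (a - b) ≤ s * (c + b) ^ (s - 1) * c := by
      refine mul_le_mul_of_nonneg_left ((le_abs_self _).trans hab) (by positivity) |>.trans ?_
      gcongr
    have h2 : s * b ^ (s - 1) * (b - a) ≤ s * (c + b) ^ (s - 1) * c := by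
      refine mul_le_mul_of_nonneg_left ((neg_le_abs _).trans hab |>.trans' (by linarith))
        (by positivity) |>.trans ?_
      gcongr
      · linarith
    rw [abs_le]
    constructor
    · linarith [rpow_sub_rpow_le hb ha hs]
    · linarith [rpow_sub_rpow_le ha hb hs]
  have h3 : (c + b) ^ (s - 1) ≤ 2 ^ s * (c ^ (s - 1) + b ^ (s - 1)) := by
    refine (add_rpow_le_two_rpow hc.le hb.le (by linarith)).trans ?_
    gcongr
    · norm_num
    · linarith
  have hcs : c ^ s = c ^ (s - 1) * c := by rw [← Real.rpow_add_one hc.ne']; ring_nf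
  have hbs : b ^ s = b ^ (s - 1) * b := by rw [← Real.rpow_add_one hb.ne']; ring_nf
  calc |a ^ s - b ^ s| * b ≤ s * (2 ^ s * (c ^ (s - 1) + b ^ (s - 1))) * c * b := by
        refine mul_le_mul_of_nonneg_right (key.trans ?_) hb.le
        gcongr
    _ = s * 2 ^ s * (c * b ^ s + c ^ s * b) := by rw [hcs, hbs]; ring

/-- The symbol of the symmetrized commutator of `⟨∇⟩^s` with a transport operator. Like the
difference of the two weights, it has no loss of derivative: one factor `⟨k - l⟩` falls on the
coefficient instead of on the unknown. -/
lemma abs_energy_kernel_le {s : ℝ} (hs : 1 ≤ s) (k l : Fin d → ℤ) (j : Fin d) :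
    |jb k ^ s * l j - jb l ^ s * (((k j : ℝ) + l j) / 2)|
      ≤ (s * 2 ^ s + 1) * (jb (k - l) * jb l ^ s + jb (k - l) ^ s * jb l) := by
  have h1 := abs_weight_sub_mul_le hs k l
  have h2 : |((k j : ℝ) - l j)| ≤ jb (k - l) := by simpa using abs_coord_le_jb (k - l) j
  have h3 := abs_coord_le_jb l j
  have hb := jb_rpow_pos s l
  have hc := jb_rpow_pos s (k - l)
  have e : jb k ^ s * l j - jb l ^ s * (((k j : ℝ) + l j) / 2)
      = (jb k ^ s - jb l ^ s) * l j - jb l ^ s * (((k j : ℝ) - l j) / 2) := by ring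
  rw [e]
  calc _ ≤ |(jb k ^ s - jb l ^ s) * l j| + |jb l ^ s * (((k j : ℝ) - l j) / 2)| := abs_sub _ _
    _ ≤ |jb k ^ s - jb l ^ s| * jb l + jb l ^ s * jb (k - l) := by
        rw [abs_mul, abs_mul, abs_of_pos hb, abs_div, abs_two]
        gcongr
        linarith [jb_nonneg (k - l)]
    _ ≤ _ := by
        nlinarith [jb_nonneg l, mul_nonneg hc.le (jb_nonneg l)]

/-- The Fourier symbol of a Lipschitz low-pass filter, equal to `1` for `⟨k⟩ ≤ N/2` and to `0` for
`⟨k⟩ ≥ N`. -/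
def cutoff (N : ℕ) (k : Fin d → ℤ) : ℝ := min 1 (max 0 (2 - 2 * (jb k / N)))

lemma cutoff_nonneg (N : ℕ) (k : Fin d → ℤ) : 0 ≤ cutoff N k :=
  le_min zero_le_one (le_max_left _ _)

lemma cutoff_le_one (N : ℕ) (k : Fin d → ℤ) : cutoff N k ≤ 1 := min_le_left _ _

lemma cutoff_eq_zero {N : ℕ} (hN : 1 ≤ N) {k : Fin d → ℤ} (hk : (N : ℝ) ≤ jb k) :
    cutoff N k = 0 := by
  have hN' : (0 : ℝ) < N := by exact_mod_cast hN
  have : 1 ≤ jb k / N := by rwa [one_le_div hN']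
  rw [cutoff, max_eq_left (by linarith)]
  simp

lemma cutoff_eq_one {N : ℕ} (hN : 1 ≤ N) {k : Fin d → ℤ} (hk : jb k ≤ N / 2) :
    cutoff N k = 1 := by
  have hN' : (0 : ℝ) < N := by exact_mod_cast hN
  have : jb k / N ≤ 1 / 2 := by rw [div_le_iff₀ hN']; linarith
  rw [cutoff, min_eq_left]
  exact le_max_of_le_right (by linarith)

lemma abs_cutoff_sub_le (N : ℕ) (k l : Fin d → ℤ) :
    |cutoff N k - cutoff N l| ≤ 2 * jb (k - l) / N := by
  have h : |min 1 (max 0 (2 - 2 * (jb k / N))) - min 1 (max 0 (2 - 2 * (jb l / N)))|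
      ≤ |(2 - 2 * (jb k / N)) - (2 - 2 * (jb l / N))| := by
    refine (abs_min_sub_min_le_max _ _ _ _).trans ?_
    rw [sub_self, abs_zero, max_eq_right (abs_nonneg _)]
    refine (abs_max_sub_max_le_max _ _ _ _).trans ?_
    rw [sub_self, abs_zero, max_eq_right (abs_nonneg _)]
  refine h.trans ?_
  have e : (2 - 2 * (jb k / N)) - (2 - 2 * (jb l / N)) = -(2 * ((jb k - jb l) / N)) := by ring
  rw [e, abs_neg, abs_mul, abs_two, abs_div, Nat.abs_cast, mul_div_assoc]
  gcongr
  exact abs_jb_sub_le k l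

lemma abs_cutoff_sub_le_one (N : ℕ) (k l : Fin d → ℤ) : |cutoff N k - cutoff N l| ≤ 1 := by
  rw [abs_le]
  constructor <;> linarith [cutoff_nonneg N k, cutoff_le_one N k, cutoff_nonneg N l,
    cutoff_le_one N l]

lemma one_le_of_div_le {N : ℕ} (hN : 1 ≤ N) {s x : ℝ} (hs : 0 ≤ s) (hx : (N : ℝ) / 4 ≤ x) :
    1 ≤ 4 ^ s * (N : ℝ) ^ (-s) * x ^ s := by
  have hN' : (0 : ℝ) < N := by exact_mod_cast hN
  have hx0 : 0 ≤ x := le_trans (by positivity) hx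
  have : 1 ≤ (4 * x / N) ^ s := by
    apply Real.one_le_rpow _ hs
    rw [one_le_div hN']
    linarith
  rw [Real.div_rpow (by positivity) hN'.le, Real.mul_rpow (by norm_num) hx0] at this
  rw [Real.rpow_neg hN'.le]
  calc (1 : ℝ) ≤ _ := this
    _ = _ := by field_simp

/-- Replacing the sharp filter by a Lipschitz one, the commutator of the filter with a transport
operator is of size `N^{-s}` in `L²`: no derivative is lost. -/
lemma abs_cutoff_kernel_le {N : ℕ} (hN : 1 ≤ N) {s : ℝ} (hs : 0 ≤ s) (k l : Fin d → ℤ) :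
    |cutoff N k - cutoff N l| * jb l
      ≤ 4 * 4 ^ s * (N : ℝ) ^ (-s) * (jb (k - l) * jb l ^ s + jb (k - l) ^ s * jb l) := by
  have hN' : (0 : ℝ) < N := by exact_mod_cast hN
  have h1 := abs_cutoff_sub_le_one N k l
  have h2 := abs_cutoff_sub_le N k l
  have hb := jb_pos l
  have hc := jb_pos (k - l)
  have hbs := jb_rpow_pos s l
  have hcs := jb_rpow_pos s (k - l)
  have hK : 0 ≤ 4 ^ s * (N : ℝ) ^ (-s) := by positivity
  -- a high frequency of the coefficient pays for everything: `⟨k - l⟩^s` is at least of order `N^s`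
  by_cases hc4 : (N : ℝ) / 4 ≤ jb (k - l)
  · have h3 := one_le_of_div_le hN hs hc4
    calc |cutoff N k - cutoff N l| * jb l ≤ 1 * jb l := by gcongr
      _ ≤ (4 ^ s * (N : ℝ) ^ (-s) * jb (k - l) ^ s) * jb l := by gcongr
      _ ≤ _ := by
        have : 0 ≤ 4 ^ s * (N : ℝ) ^ (-s) * (jb (k - l) ^ s * jb l) := by positivity
        have : 0 ≤ 4 ^ s * (N : ℝ) ^ (-s) * (jb (k - l) * jb l ^ s) := by positivity
        linarith
  push Not at hc4
  have hkl := abs_le.1 (abs_jb_sub_le k l)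
  have hpos : 0 ≤ 4 * 4 ^ s * (N : ℝ) ^ (-s) * (jb (k - l) * jb l ^ s + jb (k - l) ^ s * jb l) := by
    positivity
  -- for low frequencies of the coefficient, the filter has the same value, `1` or `0`, at `k` and
  -- at `l`, unless `⟨l⟩` is comparable to `N`, where the Lipschitz bound applies
  by_cases hb4 : (N : ℝ) / 4 ≤ jb l
  · by_cases hb2 : jb l ≤ 2 * N
    · have h3 := one_le_of_div_le hN hs hb4
      calc |cutoff N k - cutoff N l| * jb l ≤ (2 * jb (k - l) / N) * (2 * N) := by gcongr
        _ = 4 * jb (k - l) * 1 := by field_simp; ring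
        _ ≤ 4 * jb (k - l) * (4 ^ s * (N : ℝ) ^ (-s) * jb l ^ s) := by gcongr
        _ ≤ _ := by
          have : 0 ≤ 4 * 4 ^ s * (N : ℝ) ^ (-s) * (jb (k - l) ^ s * jb l) := by positivity
          linarith
    · push Not at hb2
      rw [cutoff_eq_zero hN (by linarith : (N : ℝ) ≤ jb k),
        cutoff_eq_zero hN (by linarith : (N : ℝ) ≤ jb l)]
      simpa using hpos
  · push Not at hb4
    rw [cutoff_eq_one hN (by linarith : jb k ≤ (N : ℝ) / 2),
      cutoff_eq_one hN (by linarith : jb l ≤ (N : ℝ) / 2)]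
    simpa using hpos

lemma one_sub_cutoff_le {N : ℕ} (hN : 1 ≤ N) {s : ℝ} (hs : 0 ≤ s) (k : Fin d → ℤ) :
    1 - cutoff N k ≤ 4 * 4 ^ s * (N : ℝ) ^ (-s) * jb k ^ s := by
  have hpos : 0 ≤ 4 ^ s * (N : ℝ) ^ (-s) * jb k ^ s :=
    mul_nonneg (by positivity) (jb_rpow_pos s k).le
  by_cases hk : (N : ℝ) / 4 ≤ jb k
  · have := one_le_of_div_le hN hs hk
    linarith [cutoff_nonneg N k]
  · push Not at hk
    have hN' : (0 : ℝ) < N := by exact_mod_cast hN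
    rw [cutoff_eq_one hN (by linarith)]
    linarith

lemma rpow_interp {x lam r s : ℝ} (hx : 0 < x) (hl : 0 < lam) (hr : 0 ≤ r) (hrs : r ≤ s) :
    x ^ r ≤ lam ^ r + lam ^ (r - s) * x ^ s := by
  rcases le_total x lam with h | h
  · have : x ^ r ≤ lam ^ r := Real.rpow_le_rpow hx.le h hr
    have : 0 ≤ lam ^ (r - s) * x ^ s := by positivity
    linarith
  · have h1 : x ^ (r - s) ≤ lam ^ (r - s) :=
      Real.rpow_le_rpow_of_nonpos hl h (by linarith)
    have h2 : x ^ r = x ^ (r - s) * x ^ s := by rw [← Real.rpow_add hx]; ring_nf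
    have : 0 ≤ lam ^ r := by positivity
    rw [h2]
    have : x ^ (r - s) * x ^ s ≤ lam ^ (r - s) * x ^ s := by gcongr
    linarith

/-- The box `{-N, …, N}^d` of frequencies kept by the sharp filter. -/
def box (d N : ℕ) : Finset (Fin d → ℤ) :=
  Fintype.piFinset (fun _ : Fin d => Finset.Icc (-(N : ℤ)) (N : ℤ))

lemma mem_box {N : ℕ} {k : Fin d → ℤ} : k ∈ box d N ↔ ∀ j, |k j| ≤ N := by
  simp [box, Fintype.mem_piFinset, abs_le]

lemma neg_mem_box {N : ℕ} {k : Fin d → ℤ} (hk : k ∈ box d N) : -k ∈ box d N := by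
  rw [mem_box] at *
  simpa using hk

lemma neg_mem_box_iff {N : ℕ} {k : Fin d → ℤ} : -k ∈ box d N ↔ k ∈ box d N :=
  ⟨fun h => by simpa using neg_mem_box h, neg_mem_box⟩

lemma mem_box_of_jb_le {N : ℕ} {k : Fin d → ℤ} (hk : jb k ≤ N) : k ∈ box d N := by
  rw [mem_box]
  intro j
  have := (abs_coord_le_jb k j).trans hk
  exact_mod_cast this

lemma box_mono {N N' : ℕ} (h : N ≤ N') : box d N ⊆ box d N' := by
  intro k hk
  rw [mem_box] at *
  intro j
  exact (hk j).trans (by exact_mod_cast h)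

lemma cutoff_eq_zero_of_notMem_box {N : ℕ} (hN : 1 ≤ N) {k : Fin d → ℤ} (hk : k ∉ box d N) :
    cutoff N k = 0 := by
  apply cutoff_eq_zero hN
  by_contra h
  exact hk (mem_box_of_jb_le (not_le.1 h).le)

end Weights

/-! ### Sequence norms -/

section SequenceNorms

variable {ι : Type*}

/-- The `ℓ²` norm of a sequence of extended nonnegative reals. -/
def N2 (x : ι → ℝ≥0∞) : ℝ≥0∞ := (∑' k, x k ^ 2) ^ (1 / 2 : ℝ)

lemma N2_sq (x : ι → ℝ≥0∞) : N2 x ^ 2 = ∑' k, x k ^ 2 := by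
  rw [N2, ← ENNReal.rpow_natCast, ← ENNReal.rpow_mul]
  norm_num

lemma N2_le_iff {x : ι → ℝ≥0∞} {a : ℝ≥0∞} : N2 x ≤ a ↔ ∑' k, x k ^ 2 ≤ a ^ 2 := by
  rw [← N2_sq]
  exact (ENNReal.pow_le_pow_left_iff (by norm_num)).symm

lemma N2_mono {x y : ι → ℝ≥0∞} (h : ∀ k, x k ≤ y k) : N2 x ≤ N2 y := by
  unfold N2
  gcongr with k
  exact h k

lemma N2_const_mul (c : ℝ≥0∞) (x : ι → ℝ≥0∞) : N2 (fun k => c * x k) = c * N2 x := by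
  unfold N2
  simp_rw [mul_pow]
  rw [ENNReal.tsum_mul_left, ENNReal.mul_rpow_of_nonneg _ _ (by norm_num), ← ENNReal.rpow_natCast,
    ← ENNReal.rpow_mul]
  norm_num

lemma N2_add_le (x y : ι → ℝ≥0∞) : N2 (fun k => x k + y k) ≤ N2 x + N2 y := by
  let _ : MeasurableSpace ι := ⊤
  have := ENNReal.lintegral_Lp_add_le (μ := Measure.count) (f := x) (g := y) (p := 2)
    measurable_from_top.aemeasurable measurable_from_top.aemeasurable (by norm_num)
  simpa [lintegral_count, N2] using this

@[simp] lemma N2_zero : N2 (fun _ : ι => (0 : ℝ≥0∞)) = 0 := by simp [N2]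

lemma N2_sum_le {α : Type*} (S : Finset α) (x : α → ι → ℝ≥0∞) :
    N2 (fun k => ∑ a ∈ S, x a k) ≤ ∑ a ∈ S, N2 (x a) := by
  classical
  induction S using Finset.induction_on with
  | empty => simp
  | insert a S ha ih =>
    simp_rw [Finset.sum_insert ha]
    exact (N2_add_le _ _).trans (by gcongr)

lemma tsum_mul_le_N2 (x y : ι → ℝ≥0∞) : ∑' k, x k * y k ≤ N2 x * N2 y := by
  let _ : MeasurableSpace ι := ⊤
  have := ENNReal.lintegral_mul_le_Lp_mul_Lq (μ := Measure.count) (f := x) (g := y)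
    Real.HolderConjugate.two_two
    measurable_from_top.aemeasurable measurable_from_top.aemeasurable
  simpa [lintegral_count, N2] using this

lemma le_N2 (x : ι → ℝ≥0∞) (k : ι) : x k ≤ N2 x := by
  have h : x k ^ 2 ≤ N2 x ^ 2 := by
    rw [N2_sq]
    exact ENNReal.le_tsum k
  exact (ENNReal.pow_le_pow_left_iff (by norm_num)).1 h

variable [AddCommGroup ι]

/-- Convolution of sequences of extended nonnegative reals. -/
def conv (x y : ι → ℝ≥0∞) (k : ι) : ℝ≥0∞ := ∑' l, x (k - l) * y l

lemma conv_comm (x y : ι → ℝ≥0∞) (k : ι) : conv x y k = conv y x k := by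
  unfold conv
  rw [← (Equiv.subLeft k).tsum_eq]
  simp [mul_comm]

lemma tsum_sub_right_eq (x : ι → ℝ≥0∞) (l : ι) : ∑' k, x (k - l) = ∑' k, x k :=
  (Equiv.subRight l).tsum_eq x

lemma tsum_conv (x y : ι → ℝ≥0∞) : ∑' k, conv x y k = (∑' k, x k) * ∑' k, y k := by
  unfold conv
  rw [ENNReal.tsum_comm]
  simp_rw [ENNReal.tsum_mul_right, tsum_sub_right_eq, ENNReal.tsum_mul_left]

/-- Young's inequality `ℓ¹ * ℓ² ⊆ ℓ²`. -/
lemma N2_conv_le (x y : ι → ℝ≥0∞) : N2 (conv x y) ≤ (∑' k, x k) * N2 y := by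
  rw [N2_le_iff, mul_pow, N2_sq]
  have h1 : ∀ k, conv x y k ^ 2 ≤ (∑' l, x l) * conv x (fun l => y l ^ 2) k := by
    intro k
    have e : ∀ a : ℝ≥0∞, a ^ (1 / 2 : ℝ) * a ^ (1 / 2 : ℝ) = a := by
      intro a
      rw [← ENNReal.rpow_add_of_nonneg _ _ (by norm_num) (by norm_num)]
      norm_num
    have h := tsum_mul_le_N2 (fun l => x (k - l) ^ (1 / 2 : ℝ))
      (fun l => x (k - l) ^ (1 / 2 : ℝ) * y l)
    simp_rw [← mul_assoc, e] at h
    calc conv x y k ^ 2 ≤ (N2 (fun l => x (k - l) ^ (1 / 2 : ℝ)) *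
          N2 (fun l => x (k - l) ^ (1 / 2 : ℝ) * y l)) ^ 2 := by gcongr; exact h
      _ = (∑' l, x (k - l)) * conv x (fun l => y l ^ 2) k := by
        rw [mul_pow, N2_sq, N2_sq, conv]
        simp_rw [mul_pow, sq (_ ^ (1 / 2 : ℝ)), e]
      _ = _ := by
        congr 1
        exact (Equiv.subLeft k).tsum_eq x
  calc ∑' k, conv x y k ^ 2 ≤ ∑' k, (∑' l, x l) * conv x (fun l => y l ^ 2) k :=
        ENNReal.tsum_le_tsum h1
    _ = _ := by rw [ENNReal.tsum_mul_left, tsum_conv, sq, mul_assoc]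

lemma N2_conv_le' (x y : ι → ℝ≥0∞) : N2 (conv x y) ≤ N2 x * ∑' k, y k := by
  have : conv x y = conv y x := funext (conv_comm x y)
  rw [this, mul_comm]
  exact N2_conv_le y x

end SequenceNorms

section WeightedNorms

variable {d : ℕ}

/-- The weight `⟨k⟩^r` as an extended nonnegative real. -/
def wt (r : ℝ) (k : Fin d → ℤ) : ℝ≥0∞ := ENNReal.ofReal (jb k ^ r)

lemma one_le_wt {r : ℝ} (hr : 0 ≤ r) (k : Fin d → ℤ) : 1 ≤ wt r k := by
  rw [wt, ENNReal.one_le_ofReal]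
  exact one_le_jb_rpow hr k

@[simp] lemma wt_zero (k : Fin d → ℤ) : wt 0 k = 1 := by simp [wt]

lemma wt_ne_top (r : ℝ) (k : Fin d → ℤ) : wt r k ≠ ∞ := ENNReal.ofReal_ne_top

lemma wt_mono {r s : ℝ} (h : r ≤ s) (k : Fin d → ℤ) : wt r k ≤ wt s k :=
  ENNReal.ofReal_le_ofReal (Real.rpow_le_rpow_of_exponent_le (one_le_jb k) h)

lemma wt_add (r s : ℝ) (k : Fin d → ℤ) : wt (r + s) k = wt r k * wt s k := by
  rw [wt, Real.rpow_add (jb_pos k), ENNReal.ofReal_mul (jb_rpow_pos r k).le, wt, wt]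

/-- The weighted `ℓ¹` norm `∑ ⟨k⟩ x_k`; on Fourier coefficients, it controls the uniform norms of a
function and of its gradient. -/
def n1 (x : (Fin d → ℤ) → ℝ≥0∞) : ℝ≥0∞ := ∑' k, wt 1 k * x k

/-- The weighted `ℓ²` norm `(∑ ⟨k⟩^{2s} x_k²)^{1/2}`. -/
def nH (s : ℝ) (x : (Fin d → ℤ) → ℝ≥0∞) : ℝ≥0∞ := N2 (fun k => wt s k * x k)

lemma n1_mono {x y : (Fin d → ℤ) → ℝ≥0∞} (h : ∀ k, x k ≤ y k) : n1 x ≤ n1 y := by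
  unfold n1
  gcongr with k
  exact h k

lemma nH_mono {s : ℝ} {x y : (Fin d → ℤ) → ℝ≥0∞} (h : ∀ k, x k ≤ y k) : nH s x ≤ nH s y :=
  N2_mono fun k => by gcongr; exact h k

lemma nH_mono_exp {r s : ℝ} (hrs : r ≤ s) (x : (Fin d → ℤ) → ℝ≥0∞) : nH r x ≤ nH s x :=
  N2_mono fun k => by gcongr; exact wt_mono hrs k

lemma n1_add (x y : (Fin d → ℤ) → ℝ≥0∞) : n1 (fun k => x k + y k) = n1 x + n1 y := by
  unfold n1
  simp_rw [mul_add]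
  exact ENNReal.tsum_add

lemma nH_add_le (s : ℝ) (x y : (Fin d → ℤ) → ℝ≥0∞) :
    nH s (fun k => x k + y k) ≤ nH s x + nH s y := by
  unfold nH
  simp_rw [mul_add]
  exact N2_add_le _ _

lemma n1_const_mul (c : ℝ≥0∞) (x : (Fin d → ℤ) → ℝ≥0∞) : n1 (fun k => c * x k) = c * n1 x := by
  unfold n1
  rw [← ENNReal.tsum_mul_left]
  exact tsum_congr fun k => by ring

lemma nH_const_mul (s : ℝ) (c : ℝ≥0∞) (x : (Fin d → ℤ) → ℝ≥0∞) :
    nH s (fun k => c * x k) = c * nH s x := by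
  unfold nH
  rw [← N2_const_mul]
  congr 1
  ext k
  ring

lemma n1_sum {α : Type*} (S : Finset α) (x : α → (Fin d → ℤ) → ℝ≥0∞) :
    n1 (fun k => ∑ a ∈ S, x a k) = ∑ a ∈ S, n1 (x a) := by
  unfold n1
  simp_rw [Finset.mul_sum]
  exact Summable.tsum_finsetSum fun _ _ => ENNReal.summable

lemma nH_sum_le (s : ℝ) {α : Type*} (S : Finset α) (x : α → (Fin d → ℤ) → ℝ≥0∞) :
    nH s (fun k => ∑ a ∈ S, x a k) ≤ ∑ a ∈ S, nH s (x a) := by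
  unfold nH
  simp_rw [Finset.mul_sum]
  exact N2_sum_le _ _

lemma tsum_le_n1 (x : (Fin d → ℤ) → ℝ≥0∞) : ∑' k, x k ≤ n1 x :=
  ENNReal.tsum_le_tsum fun k => le_mul_of_one_le_left zero_le (one_le_wt (by norm_num) k)

@[simp] lemma nH_zero_eq (x : (Fin d → ℤ) → ℝ≥0∞) : nH 0 x = N2 x := by
  simp [nH]

lemma n1_conv_le (x y : (Fin d → ℤ) → ℝ≥0∞) : n1 (conv x y) ≤ 2 * (n1 x * n1 y) := by
  have h : ∀ k, wt 1 k * conv x y k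
      ≤ 2 * conv (fun k => wt 1 k * x k) (fun k => wt 1 k * y k) k := by
    intro k
    unfold conv
    rw [← ENNReal.tsum_mul_left, ← ENNReal.tsum_mul_left]
    refine ENNReal.tsum_le_tsum fun l => ?_
    have : wt 1 k ≤ 2 * (wt 1 (k - l) * wt 1 l) := by
      unfold wt
      rw [← ENNReal.ofReal_mul (jb_rpow_pos _ _).le, ← ENNReal.ofReal_ofNat,
        ← ENNReal.ofReal_mul (by norm_num)]
      apply ENNReal.ofReal_le_ofReal
      simpa using jb_le_two_mul k l
    calc wt 1 k * (x (k - l) * y l) ≤ 2 * (wt 1 (k - l) * wt 1 l) * (x (k - l) * y l) := by gcongr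
      _ = _ := by ring
  calc n1 (conv x y) ≤ ∑' k, 2 * conv (fun k => wt 1 k * x k) (fun k => wt 1 k * y k) k :=
        ENNReal.tsum_le_tsum h
    _ = _ := by rw [ENNReal.tsum_mul_left, tsum_conv, n1, n1]

/-- Sequences dominated by a convolution with the commutator kernel are in `ℓ²`. -/
lemma N2_kernel_le (s : ℝ) (x y : (Fin d → ℤ) → ℝ≥0∞) :
    N2 (fun k => ∑' l, (wt 1 (k - l) * wt s l + wt s (k - l) * wt 1 l) * (x (k - l) * y l))
      ≤ n1 x * nH s y + nH s x * n1 y := by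
  have e : (fun k => ∑' l, (wt 1 (k - l) * wt s l + wt s (k - l) * wt 1 l) * (x (k - l) * y l))
      = fun k => conv (fun k => wt 1 k * x k) (fun k => wt s k * y k) k
        + conv (fun k => wt s k * x k) (fun k => wt 1 k * y k) k := by
    ext k
    unfold conv
    rw [← ENNReal.tsum_add]
    exact tsum_congr fun l => by ring
  rw [e]
  exact (N2_add_le _ _).trans (add_le_add (N2_conv_le _ _) (N2_conv_le' _ _))

/-- Tame product estimate. -/
lemma nH_conv_le {s : ℝ} (hs : 0 ≤ s) (x y : (Fin d → ℤ) → ℝ≥0∞) :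
    nH s (conv x y) ≤ ENNReal.ofReal (2 ^ s) * (nH s x * (∑' k, y k) + (∑' k, x k) * nH s y) := by
  have h : ∀ k, wt s k * conv x y k
      ≤ ENNReal.ofReal (2 ^ s) * (conv (fun k => wt s k * x k) y k
        + conv x (fun k => wt s k * y k) k) := by
    intro k
    unfold conv
    rw [← ENNReal.tsum_mul_left, ← ENNReal.tsum_add, ← ENNReal.tsum_mul_left]
    refine ENNReal.tsum_le_tsum fun l => ?_
    have : wt s k ≤ ENNReal.ofReal (2 ^ s) * (wt s (k - l) + wt s l) := by
      unfold wt
      rw [← ENNReal.ofReal_add (jb_rpow_pos _ _).le (jb_rpow_pos _ _).le,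
        ← ENNReal.ofReal_mul (by positivity)]
      exact ENNReal.ofReal_le_ofReal (jb_rpow_le hs k l)
    calc wt s k * (x (k - l) * y l)
        ≤ ENNReal.ofReal (2 ^ s) * (wt s (k - l) + wt s l) * (x (k - l) * y l) := by gcongr
      _ = _ := by ring
  refine (N2_mono h).trans ?_
  rw [N2_const_mul]
  gcongr
  exact (N2_add_le _ _).trans (add_le_add (N2_conv_le' _ _) (N2_conv_le _ _))

lemma nH_interp {lam r s : ℝ} (hl : 0 < lam) (hr : 0 ≤ r) (hrs : r ≤ s)
    (x : (Fin d → ℤ) → ℝ≥0∞) :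
    nH r x ≤ ENNReal.ofReal (lam ^ r) * nH 0 x + ENNReal.ofReal (lam ^ (r - s)) * nH s x := by
  rw [← nH_const_mul, ← nH_const_mul]
  refine le_trans ?_ (N2_add_le _ _)
  refine N2_mono fun k => ?_
  have : wt r k ≤ ENNReal.ofReal (lam ^ r) + ENNReal.ofReal (lam ^ (r - s)) * wt s k := by
    unfold wt
    rw [← ENNReal.ofReal_mul (by positivity), ← ENNReal.ofReal_add (by positivity)
      (mul_nonneg (by positivity) (jb_rpow_pos _ _).le)]
    exact ENNReal.ofReal_le_ofReal (rpow_interp (jb_pos k) hl hr hrs)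
  calc wt r k * x k ≤ (ENNReal.ofReal (lam ^ r) + ENNReal.ofReal (lam ^ (r - s)) * wt s k) * x k :=
        by gcongr
    _ = _ := by rw [wt_zero]; ring

lemma summable_jb_rpow {r : ℝ} (hr : (d : ℝ) < r) :
    Summable (fun k : Fin d → ℤ => jb k ^ (-r)) := by
  let L := Submodule.span ℤ (Set.range (Pi.basisFun ℝ (Fin d)))
  let e : (Fin d → ℤ) → L := fun k => ⟨fun j => (k j : ℝ), by
    have h := Submodule.sum_mem L (t := Finset.univ)
      (f := fun j => k j • (Pi.basisFun ℝ (Fin d)) j) fun j _ =>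
        L.smul_mem _ (Submodule.subset_span ⟨j, rfl⟩)
    have e : (fun j => (k j : ℝ)) = ∑ j, k j • (Pi.basisFun ℝ (Fin d)) j := by
      ext j
      simp [Finset.sum_apply, Pi.single_apply]
    rw [e]
    exact h⟩
  have he : Function.Injective e := by
    intro k l h
    ext j
    have : (k j : ℝ) = l j := congrFun (congrArg Subtype.val h) j
    exact_mod_cast this
  have hrank : Module.finrank ℤ L = d := by
    rw [ZLattice.rank ℝ L]
    simp
  have h1 := (ZLattice.summable_norm_rpow L (-r) (by rw [hrank]; linarith)).comp_injective he
  have h2 : Summable (fun k : Fin d → ℤ => if k = 0 then (1 : ℝ) else 0) :=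
    (hasSum_ite_eq 0 1).summable
  refine Summable.of_nonneg_of_le (fun k => (jb_rpow_pos _ k).le) (fun k => ?_) (h1.add h2)
  have hd : (0 : ℝ) ≤ d := by positivity
  by_cases hk : k = 0
  · rw [if_pos hk]
    have : jb k ^ (-r) ≤ 1 := Real.rpow_le_one_of_one_le_of_nonpos (one_le_jb k) (by linarith)
    have : 0 ≤ ‖e k‖ ^ (-r) := by positivity
    simp only [Function.comp]
    linarith
  · rw [if_neg hk, add_zero]
    have hpos : 0 < ‖e k‖ := by
      rw [norm_pos_iff]
      intro h
      exact hk (he (h.trans (by ext j; simp [e])))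
    apply Real.rpow_le_rpow_of_nonpos hpos _ (by linarith)
    refine (pi_norm_le_iff_of_nonneg (jb_nonneg k)).2 fun j => ?_
    exact abs_coord_le_jb k j

lemma tsum_le_nH {r : ℝ} (hr : (d : ℝ) / 2 < r) :
    ∃ C : ℝ≥0, ∀ x : (Fin d → ℤ) → ℝ≥0∞, ∑' k, x k ≤ C * nH r x := by
  have h := summable_jb_rpow (d := d) (r := 2 * r) (by linarith)
  have hfin : N2 (fun k : Fin d → ℤ => wt (-r) k) ≠ ∞ := by
    have e : ∀ k : Fin d → ℤ, wt (-r) k ^ 2 = ENNReal.ofReal (jb k ^ (-(2 * r))) := by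
      intro k
      rw [wt, ← ENNReal.ofReal_pow (jb_rpow_pos _ _).le, ← Real.rpow_natCast,
        ← Real.rpow_mul (jb_nonneg k)]
      congr 2
      push_cast
      ring
    unfold N2
    simp_rw [e]
    exact ENNReal.rpow_ne_top_of_nonneg (by norm_num) h.tsum_ofReal_ne_top
  refine ⟨(N2 (fun k : Fin d → ℤ => wt (-r) k)).toNNReal, fun x => ?_⟩
  rw [ENNReal.coe_toNNReal hfin]
  refine le_trans (le_of_eq ?_) (tsum_mul_le_N2 _ _)
  refine tsum_congr fun k => ?_
  rw [← mul_assoc, ← wt_add]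
  simp

/-- Sobolev embedding: the `H^s` norm controls the weighted `ℓ¹` norm when `s > d/2 + 1`. -/
lemma n1_le_nH {s : ℝ} (hs : (d : ℝ) / 2 + 1 < s) :
    ∃ C : ℝ≥0, ∀ x : (Fin d → ℤ) → ℝ≥0∞, n1 x ≤ C * nH s x := by
  obtain ⟨C, hC⟩ := tsum_le_nH (d := d) (r := s - 1) (by linarith)
  refine ⟨C, fun x => (hC _).trans (le_of_eq ?_)⟩
  unfold nH
  congr 2
  ext k
  rw [← mul_assoc, ← wt_add]
  ring_nf

end WeightedNorms

/-! ### Fourier coefficients -/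

section Fourier

variable {d : ℕ}

/-- The `k`-th Fourier coefficient of a scalar function on the torus. -/
def fc (f : (Fin d → ℝ) → ℂ) (k : Fin d → ℤ) : ℂ :=
  (((2 * Real.pi) ^ d)⁻¹ : ℝ) * ∫ x in cell d, f x * character (-k) x

lemma character_add (k l : Fin d → ℤ) (x : Fin d → ℝ) :
    character (k + l) x = character k x * character l x := by
  unfold character
  rw [← Complex.exp_add, ← mul_add, ← Complex.ofReal_add, ← Finset.sum_add_distrib]
  congr 4
  ext j
  push_cast [Pi.add_apply]
  ring

@[simp] lemma character_zero (x : Fin d → ℝ) : character (0 : Fin d → ℤ) x = 1 := by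
  simp [character]

@[simp] lemma norm_character (k : Fin d → ℤ) (x : Fin d → ℝ) : ‖character k x‖ = 1 := by
  rw [character, mul_comm]
  exact Complex.norm_exp_ofReal_mul_I _

lemma conj_character (k : Fin d → ℤ) (x : Fin d → ℝ) :
    (starRingEnd ℂ) (character k x) = character (-k) x := by
  unfold character
  rw [← Complex.exp_conj, map_mul, Complex.conj_I, Complex.conj_ofReal]
  simp

@[fun_prop] lemma continuous_character (k : Fin d → ℤ) : Continuous (character k) := by
  unfold character
  fun_prop

lemma character_add_period (k : Fin d → ℤ) (j : Fin d) (x : Fin d → ℝ) :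
    character k (x + Pi.single j (2 * Real.pi)) = character k x := by
  unfold character
  have : ∑ i, (k i : ℝ) * (x + Pi.single j (2 * Real.pi) : Fin d → ℝ) i
      = ∑ i, (k i : ℝ) * x i + k j * (2 * Real.pi) := by
    simp [mul_add, Finset.sum_add_distrib, Pi.single_apply]
  rw [this, Complex.ofReal_add, mul_add, Complex.exp_add]
  have h : Complex.I * ((k j * (2 * Real.pi) : ℝ) : ℂ) = k j * (2 * Real.pi * Complex.I) := by
    push_cast
    ring
  rw [h, Complex.exp_int_mul_two_pi_mul_I, mul_one]

lemma cell_eq_pi : cell d = Set.univ.pi (fun _ => Set.Icc 0 (2 * Real.pi)) := by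
  ext x
  simp [cell, Pi.le_def]

lemma isCompact_cell : IsCompact (cell d) := by
  rw [cell_eq_pi]
  exact isCompact_univ_pi fun _ => isCompact_Icc

lemma measurableSet_cell : MeasurableSet (cell d) := isCompact_cell.isClosed.measurableSet

lemma volume_cell : volume (cell d) = ENNReal.ofReal ((2 * Real.pi) ^ d) := by
  rw [cell_eq_pi, volume_pi_pi]
  simp [Real.volume_Icc, ENNReal.ofReal_pow Real.two_pi_pos.le]

instance : IsFiniteMeasure (volume.restrict (cell d)) :=
  ⟨by rw [Measure.restrict_apply_univ, volume_cell]; exact ENNReal.ofReal_lt_top⟩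

lemma integral_character (k : Fin d → ℤ) :
    ∫ x in cell d, character k x = if k = 0 then ((2 * Real.pi) ^ d : ℂ) else 0 := by
  have h1 : ∀ x : Fin d → ℝ, character k x = ∏ j, Complex.exp (Complex.I * k j * x j) := by
    intro x
    rw [← Complex.exp_sum, character]
    congr 1
    push_cast
    rw [Finset.mul_sum]
    exact Finset.sum_congr rfl fun j _ => by ring
  simp_rw [h1]
  rw [cell_eq_pi, volume_pi, Measure.restrict_pi_pi,
    integral_fintype_prod_eq_prod (𝕜 := ℂ) (fun j (y : ℝ) => Complex.exp (Complex.I * k j * y))]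
  have h2 : ∀ m : ℤ, ∫ y in Set.Icc 0 (2 * Real.pi), Complex.exp (Complex.I * m * (y : ℂ))
      = if m = 0 then (2 * Real.pi : ℂ) else 0 := by
    intro m
    rw [integral_Icc_eq_integral_Ioc, ← intervalIntegral.integral_of_le Real.two_pi_pos.le]
    split_ifs with hm
    · simp [hm]
    · rw [integral_exp_mul_complex (by simp [hm])]
      have : Complex.I * m * ((2 * Real.pi : ℝ) : ℂ) = m * (2 * Real.pi * Complex.I) := by
        push_cast; ring
      rw [this, Complex.exp_int_mul_two_pi_mul_I]
      simp
  simp_rw [h2]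
  split_ifs with hk
  · simp [hk]
  · obtain ⟨j, hj⟩ := Function.ne_iff.1 hk
    exact Finset.prod_eq_zero (Finset.mem_univ j) (if_neg hj)

lemma fc_character (k l : Fin d → ℤ) : fc (character k) l = if k = l then 1 else 0 := by
  unfold fc
  simp_rw [← character_add]
  rw [integral_character]
  have : k + -l = 0 ↔ k = l := by rw [add_neg_eq_zero]
  simp only [this]
  split_ifs
  · have : (Real.pi : ℂ) ≠ 0 := by exact_mod_cast Real.pi_ne_zero
    push_cast
    field_simp
  · simp

/-- A function given by an absolutely convergent trigonometric series has the expected Fourier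
coefficients. -/
lemma fc_tsum {c : (Fin d → ℤ) → ℂ} (hc : Summable fun k => ‖c k‖) :
    fc (fun x => ∑' k, c k * character k x) = c := by
  ext l
  have h1 : ∀ k, Integrable (fun x => c k * character k x * character (-l) x)
      (volume.restrict (cell d)) := fun k =>
    (Continuous.continuousOn (by fun_prop)).integrableOn_compact isCompact_cell
  have h2 := hasSum_integral_of_summable_integral_norm h1 (by
    simpa using hc.mul_left _)
  have h3 : ∀ x, ∑' k, c k * character k x * character (-l) x
      = (∑' k, c k * character k x) * character (-l) x := fun x => tsum_mul_right
  simp_rw [h3] at h2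
  unfold fc
  rw [← h2.tsum_eq, ← tsum_mul_left]
  have h4 : ∀ k, (((2 * Real.pi) ^ d)⁻¹ : ℝ) * ∫ x in cell d, c k * character k x * character (-l) x
      = if k = l then c k else 0 := by
    intro k
    simp_rw [mul_assoc]
    rw [integral_const_mul, mul_left_comm]
    have := fc_character k l
    unfold fc at this
    rw [this]
    split_ifs <;> simp
  simp_rw [h4]
  rw [tsum_ite_eq]

section Torus

local instance : MeasureSpace UnitAddCircle := ⟨AddCircle.haarAddCircle⟩

/-- The half-open unit cube. -/
def unitCube (d : ℕ) : Set (Fin d → ℝ) :=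
  {x | ∀ i, x i ∈ Set.Ioc ((0 : Fin d → ℝ) i) ((0 : Fin d → ℝ) i + 1)}

/-- The section of the quotient map from `ℝ^d` to the unit torus with values in `(0, 2π]^d`, after
rescaling the torus by `2π`. -/
def torusLift (θ : UnitAddTorus (Fin d)) : Fin d → ℝ :=
  (2 * Real.pi) • (UnitAddTorus.measurableEquivPiIoc (0 : Fin d → ℝ) θ : Fin d → ℝ)

lemma measurableSet_unitCube : MeasurableSet (unitCube d) :=
  MeasurableSet.univ_pi' fun _ => measurableSet_Ioc

lemma measurableEmbedding_torusLift : MeasurableEmbedding (torusLift (d := d)) := by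
  have h1 : MeasurableEmbedding (fun x : Fin d → ℝ => (2 * Real.pi) • x) :=
    (Homeomorph.smulOfNeZero (2 * Real.pi) Real.two_pi_pos.ne').measurableEmbedding
  exact h1.comp ((MeasurableEmbedding.subtype_coe measurableSet_unitCube).comp
    (UnitAddTorus.measurableEquivPiIoc (0 : Fin d → ℝ)).measurableEmbedding)

/-- Lebesgue measure on the cell is, up to normalization, the image of Haar measure on the torus, so
that Mathlib's theory of Fourier series on the torus applies. -/
lemma map_torusLift : (volume : Measure (UnitAddTorus (Fin d))).map torusLift
    = ENNReal.ofReal (((2 * Real.pi) ^ d)⁻¹) • volume.restrict (cell d) := by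
  have hm : Measurable (fun x : Fin d → ℝ => (2 * Real.pi) • x) := measurable_const_smul _
  have h0 : MeasurableEmbedding (fun x : Fin d → ℝ => (2 * Real.pi) • x) :=
    (Homeomorph.smulOfNeZero (2 * Real.pi) Real.two_pi_pos.ne').measurableEmbedding
  have h1 : (volume : Measure (UnitAddTorus (Fin d))).map torusLift
      = ((volume.restrict (unitCube d)).map (fun x : Fin d → ℝ => (2 * Real.pi) • x)) := by
    have e : (torusLift (d := d)) = (fun x : Fin d → ℝ => (2 * Real.pi) • x) ∘
      (Subtype.val ∘ UnitAddTorus.measurableEquivPiIoc (0 : Fin d → ℝ)) := rfl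
    rw [e, ← Measure.map_map hm (measurable_subtype_coe.comp (MeasurableEquiv.measurable _)),
      ← Measure.map_map measurable_subtype_coe (MeasurableEquiv.measurable _),
      (UnitAddTorus.measurePreserving_equivPiIoc (0 : Fin d → ℝ)).map_eq]
    exact congrArg _ (map_comap_subtype_coe measurableSet_unitCube volume)
  have h2 : unitCube d = (fun x : Fin d → ℝ => (2 * Real.pi) • x) ⁻¹'
      (Set.univ.pi fun _ => Set.Ioc 0 (2 * Real.pi)) := by
    ext x
    simp only [unitCube, Set.mem_ofPred_eq, Set.mem_preimage, Set.mem_univ_pi, Set.mem_Ioc,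
      Pi.smul_apply, smul_eq_mul, Pi.zero_apply, zero_add]
    refine forall_congr' fun i => ?_
    have := Real.two_pi_pos
    constructor
    · rintro ⟨h, h'⟩
      exact ⟨by positivity, by nlinarith⟩
    · rintro ⟨h, h'⟩
      exact ⟨pos_of_mul_pos_right h this.le |> fun h => h, by nlinarith⟩
  rw [h1, h2, ← h0.restrict_map, Measure.map_addHaar_smul volume Real.two_pi_pos.ne',
    Measure.restrict_smul]
  congr 1
  · simp [abs_of_pos Real.pi_pos]
  · rw [cell_eq_pi, volume_pi, Measure.restrict_pi_pi, Measure.restrict_pi_pi]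
    congr 1
    ext1 j
    exact Measure.restrict_congr_set Ioc_ae_eq_Icc

lemma mFourier_eq_character (k : Fin d → ℤ) (θ : UnitAddTorus (Fin d)) :
    UnitAddTorus.mFourier k θ = character k (torusLift θ) := by
  have hθ : ∀ i,
      θ i = ((UnitAddTorus.measurableEquivPiIoc (0 : Fin d → ℝ) θ).1 i : UnitAddCircle) :=
    fun i => (congrFun ((UnitAddTorus.measurableEquivPiIoc (0 : Fin d → ℝ)).symm_apply_apply θ)
      i).symm
  have h : UnitAddTorus.mFourier k θ = ∏ i, fourier (k i) (θ i) := rfl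
  rw [h, character]
  push_cast
  rw [Finset.mul_sum, Complex.exp_sum]
  refine Finset.prod_congr rfl fun i _ => ?_
  rw [hθ i, fourier_coe_apply]
  congr 1
  simp only [torusLift, Pi.smul_apply, smul_eq_mul]
  push_cast
  ring

/-- Square integrable functions are determined by their Fourier coefficients. -/
lemma ae_cell_eq_zero_of_fc {f : (Fin d → ℝ) → ℂ} (hf : MemLp f 2 (volume.restrict (cell d)))
    (h : ∀ k, fc f k = 0) : f =ᵐ[volume.restrict (cell d)] 0 := by
  have hemb := measurableEmbedding_torusLift (d := d)
  have hpos : (0 : ℝ) < ((2 * Real.pi) ^ d)⁻¹ := by positivity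
  have hF : MemLp (f ∘ torusLift) 2 (volume : Measure (UnitAddTorus (Fin d))) := by
    rw [← hemb.memLp_map_measure_iff, map_torusLift]
    exact hf.smul_measure ENNReal.ofReal_ne_top
  have hcoef : ∀ k, UnitAddTorus.mFourierCoeff (f ∘ torusLift) k = 0 := by
    intro k
    have e : UnitAddTorus.mFourierCoeff (f ∘ torusLift) k
        = ∫ θ : UnitAddTorus (Fin d), (fun x => f x * character (-k) x) (torusLift θ) := by
      unfold UnitAddTorus.mFourierCoeff
      refine integral_congr_ae (Filter.Eventually.of_forall fun θ => ?_)
      simp only [mFourier_eq_character, smul_eq_mul, Function.comp]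
      ring
    rw [e, ← hemb.integral_map (fun x => f x * character (-k) x), map_torusLift,
      integral_smul_measure,
      ENNReal.toReal_ofReal hpos.le, ← h k, fc, Complex.real_smul]
  have hzero : hF.toLp = 0 := by
    apply UnitAddTorus.mFourierBasis.repr.injective
    rw [map_zero]
    ext k
    rw [UnitAddTorus.mFourierBasis_repr]
    refine Eq.trans ?_ (hcoef k)
    unfold UnitAddTorus.mFourierCoeff
    refine integral_congr_ae ?_
    filter_upwards [hF.coeFn_toLp] with θ hθ
    rw [hθ]
  have h3 : f ∘ torusLift =ᵐ[volume] 0 := by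
    filter_upwards [hF.coeFn_toLp, Lp.coeFn_zero ℂ 2 (volume : Measure (UnitAddTorus (Fin d)))]
      with θ h1 h2
    rw [← h1, hzero, h2]
  have h4 : ∀ᵐ x ∂((volume : Measure (UnitAddTorus (Fin d))).map torusLift), f x = 0 :=
    hemb.ae_map_iff.2 h3
  rw [map_torusLift] at h4
  have := (Measure.ae_ennreal_smul_measure_iff (by simpa using hpos)).1 h4
  exact this

end Torus

/-- `f` is `2π`-periodic in each variable. -/
def Per {β : Type*} (f : (Fin d → ℝ) → β) : Prop :=
  ∀ (j : Fin d) (x : Fin d → ℝ), f (x + Pi.single j (2 * Real.pi)) = f x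

lemma Per.add_int {β : Type*} {f : (Fin d → ℝ) → β} (hf : Per f) (m : Fin d → ℤ)
    (x : Fin d → ℝ) : f (x + fun j => m j * (2 * Real.pi)) = f x := by
  classical
  have h1 : ∀ (j : Fin d) (m : ℤ) (x : Fin d → ℝ),
      f (x + Pi.single j (m * (2 * Real.pi))) = f x := by
    intro j m
    induction m using Int.induction_on with
    | zero => intro x; simp
    | succ m ih =>
      intro x
      have e : x + Pi.single j ((((m : ℤ) + 1 : ℤ) : ℝ) * (2 * Real.pi))
          = (x + Pi.single j (((m : ℤ) : ℝ) * (2 * Real.pi))) + Pi.single j (2 * Real.pi) := by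
        rw [add_assoc, ← Pi.single_add]
        push_cast
        ring_nf
      rw [e, hf, ih]
    | pred m ih =>
      intro x
      rw [← ih x]
      have e : x + Pi.single j (((-(m : ℤ) : ℤ) : ℝ) * (2 * Real.pi))
          = (x + Pi.single j ((((-(m : ℤ)) - 1 : ℤ) : ℝ) * (2 * Real.pi)))
            + Pi.single j (2 * Real.pi) := by
        rw [add_assoc, ← Pi.single_add]
        push_cast
        ring_nf
      rw [e, hf]
  have h2 : ∀ (S : Finset (Fin d)) (x : Fin d → ℝ),
      f (x + ∑ j ∈ S, Pi.single j (m j * (2 * Real.pi))) = f x := by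
    intro S
    induction S using Finset.induction_on with
    | empty => intro x; simp
    | insert a S ha ih =>
      intro x
      rw [Finset.sum_insert ha, ← add_assoc, ih, h1]
  have h3 : (fun j => (m j : ℝ) * (2 * Real.pi))
      = ∑ j, Pi.single j ((m j : ℝ) * (2 * Real.pi)) :=
    (Finset.univ_sum_single _).symm
  rw [h3, h2]

lemma ae_of_ae_cell {f : (Fin d → ℝ) → ℂ} (hf : Per f)
    (h : f =ᵐ[volume.restrict (cell d)] 0) : f =ᵐ[volume] 0 := by
  have h1 : volume {x | x ∈ cell d ∧ f x ≠ 0} = 0 := by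
    have := (ae_restrict_iff' measurableSet_cell).1 h
    rw [Filter.Eventually, mem_ae_iff] at this
    convert this using 2
    ext x
    simp
  have h2 : {x | f x ≠ 0} ⊆ ⋃ m : Fin d → ℤ,
      (fun x => x + fun j => (m j : ℝ) * (2 * Real.pi)) ⁻¹' {x | x ∈ cell d ∧ f x ≠ 0} := by
    intro x hx
    refine Set.mem_iUnion.2 ⟨fun j => -⌊x j / (2 * Real.pi)⌋, ?_, ?_⟩
    · have hp := Real.two_pi_pos
      rw [cell_eq_pi]
      intro j _
      have h3 := Int.floor_le (x j / (2 * Real.pi))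
      have h4 := Int.lt_floor_add_one (x j / (2 * Real.pi))
      rw [le_div_iff₀ hp] at h3
      rw [div_lt_iff₀ hp] at h4
      simp only [Pi.add_apply, Set.mem_Icc]
      push_cast
      constructor <;> linarith
    · rw [hf.add_int]
      exact hx
  rw [Filter.EventuallyEq, Filter.Eventually, mem_ae_iff]
  refine measure_mono_null h2 (measure_iUnion_null fun m => ?_)
  rw [measure_preimage_add_right]
  exact h1

lemma ae_eq_zero_of_fc {f : (Fin d → ℝ) → ℂ} (hf : MemLp f 2 (volume.restrict (cell d)))
    (hper : Per f) (h : ∀ k, fc f k = 0) : f =ᵐ[volume] 0 :=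
  ae_of_ae_cell hper (ae_cell_eq_zero_of_fc hf h)

lemma integrable_mul_character {f : (Fin d → ℝ) → ℂ}
    (hf : IntegrableOn f (cell d)) (k : Fin d → ℤ) :
    IntegrableOn (fun x => f x * character k x) (cell d) := by
  refine Integrable.mul_bdd (c := 1) hf (continuous_character k).aestronglyMeasurable ?_
  exact Filter.Eventually.of_forall fun x => (norm_character k x).le

lemma fc_add {f g : (Fin d → ℝ) → ℂ} (hf : IntegrableOn f (cell d)) (hg : IntegrableOn g (cell d))
    (k : Fin d → ℤ) : fc (fun x => f x + g x) k = fc f k + fc g k := by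
  unfold fc
  simp_rw [add_mul]
  rw [integral_add (integrable_mul_character hf _) (integrable_mul_character hg _), mul_add]

lemma fc_sub {f g : (Fin d → ℝ) → ℂ} (hf : IntegrableOn f (cell d)) (hg : IntegrableOn g (cell d))
    (k : Fin d → ℤ) : fc (fun x => f x - g x) k = fc f k - fc g k := by
  unfold fc
  simp_rw [sub_mul]
  rw [integral_sub (integrable_mul_character hf _) (integrable_mul_character hg _), mul_sub]

lemma fc_const_mul (a : ℂ) (f : (Fin d → ℝ) → ℂ) (k : Fin d → ℤ) :
    fc (fun x => a * f x) k = a * fc f k := by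
  unfold fc
  simp_rw [mul_assoc]
  rw [integral_const_mul]
  ring

lemma fc_congr_ae {f g : (Fin d → ℝ) → ℂ} (h : f =ᵐ[volume] g) (k : Fin d → ℤ) :
    fc f k = fc g k := by
  unfold fc
  congr 1
  refine integral_congr_ae (ae_restrict_of_ae ?_)
  filter_upwards [h] with x hx
  rw [hx]

lemma fc_ofReal_neg (f : (Fin d → ℝ) → ℝ) (k : Fin d → ℤ) :
    fc (fun x => (f x : ℂ)) (-k) = (starRingEnd ℂ) (fc (fun x => (f x : ℂ)) k) := by
  unfold fc
  rw [map_mul, Complex.conj_ofReal, ← integral_conj]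
  congr 1
  refine integral_congr_ae (Filter.Eventually.of_forall fun x => ?_)
  simp only [map_mul, Complex.conj_ofReal, conj_character]

end Fourier

/-! ### Functions with absolutely convergent Fourier series -/

section Wiener

variable {d : ℕ}

/-- Functions that are the sum of their absolutely convergent Fourier series. -/
structure IsWiener (f : (Fin d → ℝ) → ℂ) : Prop where
  summable : Summable fun k => ‖fc f k‖
  eq_tsum : ∀ x, f x = ∑' k, fc f k * character k x

/-- The sequence of absolute values of the Fourier coefficients. -/
def ec (f : (Fin d → ℝ) → ℂ) (k : Fin d → ℤ) : ℝ≥0∞ := ‖fc f k‖ₑ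

lemma fc_of_series {f : (Fin d → ℝ) → ℂ} {c : (Fin d → ℤ) → ℂ} (hc : Summable fun k => ‖c k‖)
    (hf : ∀ x, f x = ∑' k, c k * character k x) : fc f = c := by
  rw [funext hf]
  exact fc_tsum hc

lemma IsWiener.of_series {f : (Fin d → ℝ) → ℂ} {c : (Fin d → ℤ) → ℂ}
    (hc : Summable fun k => ‖c k‖) (hf : ∀ x, f x = ∑' k, c k * character k x) : IsWiener f := by
  have h := fc_of_series hc hf
  exact ⟨by rwa [h], by rwa [h]⟩

lemma summable_mul_character {c : (Fin d → ℤ) → ℂ} (hc : Summable fun k => ‖c k‖)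
    (x : Fin d → ℝ) : Summable fun k => c k * character k x :=
  Summable.of_norm (by simpa using hc)

lemma summable_norm_of_tsum_enorm {ι : Type*} {E : Type*} [SeminormedAddCommGroup E] {c : ι → E}
    (h : ∑' k, ‖c k‖ₑ ≠ ∞) : Summable fun k => ‖c k‖ := by
  have := ENNReal.summable_toReal h
  simpa using this

lemma tsum_enorm_ne_top {ι : Type*} {E : Type*} [SeminormedAddCommGroup E] {c : ι → E}
    (h : Summable fun k => ‖c k‖) : ∑' k, ‖c k‖ₑ ≠ ∞ := by
  have := h.tsum_ofReal_ne_top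
  simpa [ofReal_norm] using this

lemma IsWiener.tsum_ec_ne_top {f : (Fin d → ℝ) → ℂ} (hf : IsWiener f) : ∑' k, ec f k ≠ ∞ :=
  tsum_enorm_ne_top hf.summable

lemma IsWiener.continuous {f : (Fin d → ℝ) → ℂ} (hf : IsWiener f) : Continuous f := by
  rw [funext hf.eq_tsum]
  refine continuous_tsum (fun k => by fun_prop) hf.summable fun k x => ?_
  simp

lemma IsWiener.per {f : (Fin d → ℝ) → ℂ} (hf : IsWiener f) : Per f := by
  intro j x
  rw [hf.eq_tsum, hf.eq_tsum]
  simp_rw [character_add_period]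

lemma IsWiener.norm_le {f : (Fin d → ℝ) → ℂ} (hf : IsWiener f) (x : Fin d → ℝ) :
    ‖f x‖ₑ ≤ ∑' k, ec f k := by
  have h : ‖f x‖ ≤ ∑' k, ‖fc f k‖ := by
    rw [hf.eq_tsum]
    refine tsum_of_norm_bounded hf.summable.hasSum fun k => ?_
    simp
  have h2 : ∑' k, ec f k = ENNReal.ofReal (∑' k, ‖fc f k‖) := by
    rw [ENNReal.ofReal_tsum_of_nonneg (fun _ => norm_nonneg _) hf.summable]
    simp [ec, ofReal_norm]
  rw [h2, ← ofReal_norm]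
  exact ENNReal.ofReal_le_ofReal h

lemma _root_.Continuous.integrableOn_cell {E : Type*} [NormedAddCommGroup E]
    {f : (Fin d → ℝ) → E} (hf : Continuous f) :
    IntegrableOn f (cell d) := hf.continuousOn.integrableOn_compact isCompact_cell

lemma _root_.Continuous.memLp_cell {E : Type*} [NormedAddCommGroup E]
    {f : (Fin d → ℝ) → E} (hf : Continuous f) :
    MemLp f 2 (volume.restrict (cell d)) := by
  obtain ⟨C, hC⟩ := isCompact_cell.exists_bound_of_continuousOn (f := f) hf.continuousOn
  refine MemLp.of_bound (hf.continuousOn.aestronglyMeasurable_of_isCompact isCompact_cell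
    measurableSet_cell) C ?_
  exact (ae_restrict_iff' measurableSet_cell).2 (Filter.Eventually.of_forall hC)

/-- A continuous function with summable Fourier coefficients is the sum of its Fourier series. -/
lemma IsWiener.of_continuous {f : (Fin d → ℝ) → ℂ} (hf : Continuous f) (hper : Per f)
    (hs : Summable fun k => ‖fc f k‖) : IsWiener f := by
  refine ⟨hs, ?_⟩
  set g : (Fin d → ℝ) → ℂ := fun x => ∑' k, fc f k * character k x with hg
  have hgW : IsWiener g := IsWiener.of_series hs fun x => rfl
  have hfg : fc g = fc f := fc_of_series hs fun x => rfl
  have h0 : (fun x => f x - g x) =ᵐ[volume] 0 := by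
    refine ae_eq_zero_of_fc (hf.sub hgW.continuous).memLp_cell ?_ ?_
    · intro j x
      simp only
      rw [hper, hgW.per]
    · intro k
      rw [fc_sub hf.integrableOn_cell hgW.continuous.integrableOn_cell, hfg, sub_self]
  have h1 : f =ᵐ[volume] g := by
    filter_upwards [h0] with x hx
    exact sub_eq_zero.1 hx
  have h2 := (Continuous.ae_eq_iff_eq volume hf hgW.continuous).1 h1
  intro x
  exact congrFun h2 x

lemma IsWiener.add {f g : (Fin d → ℝ) → ℂ} (hf : IsWiener f) (hg : IsWiener g) :
    IsWiener (fun x => f x + g x) := by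
  refine IsWiener.of_series (c := fun k => fc f k + fc g k) ?_ ?_
  · exact Summable.of_nonneg_of_le (fun _ => norm_nonneg _) (fun k => norm_add_le _ _)
      (hf.summable.add hg.summable)
  · intro x
    simp_rw [add_mul]
    rw [(summable_mul_character hf.summable x).tsum_add (summable_mul_character hg.summable x),
      ← hf.eq_tsum, ← hg.eq_tsum]

lemma IsWiener.const_mul {f : (Fin d → ℝ) → ℂ} (hf : IsWiener f) (a : ℂ) :
    IsWiener (fun x => a * f x) := by
  refine IsWiener.of_series (c := fun k => a * fc f k) ?_ ?_
  · simpa using hf.summable.mul_left ‖a‖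
  · intro x
    simp_rw [mul_assoc]
    rw [tsum_mul_left, ← hf.eq_tsum]

lemma IsWiener.sub {f g : (Fin d → ℝ) → ℂ} (hf : IsWiener f) (hg : IsWiener g) :
    IsWiener (fun x => f x - g x) := by
  simpa [sub_eq_add_neg] using hf.add (hg.const_mul (-1))

lemma isWiener_const_and_fc (a : ℂ) : IsWiener (fun _ : Fin d → ℝ => a) ∧
    fc (fun _ : Fin d → ℝ => a) = fun k => if k = 0 then a else 0 := by
  have h1 : Summable fun k : Fin d → ℤ => ‖if k = 0 then a else 0‖ := by
    refine summable_of_ne_finset_zero (s := {0}) fun k hk => ?_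
    simp at hk
    simp [hk]
  have h2 : ∀ x : Fin d → ℝ, a = ∑' k : Fin d → ℤ, (if k = 0 then a else 0) * character k x := by
    intro x
    rw [tsum_eq_single 0 fun k hk => by simp [hk]]
    simp
  exact ⟨IsWiener.of_series h1 h2, fc_of_series h1 h2⟩

lemma isWiener_const (a : ℂ) : IsWiener (fun _ : Fin d → ℝ => a) := (isWiener_const_and_fc a).1

lemma fc_const (a : ℂ) (k : Fin d → ℤ) : fc (fun _ : Fin d → ℝ => a) k = if k = 0 then a else 0 :=
  congrFun (isWiener_const_and_fc a).2 k

lemma IsWiener.fc_add {f g : (Fin d → ℝ) → ℂ} (hf : IsWiener f) (hg : IsWiener g)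
    (k : Fin d → ℤ) : fc (fun x => f x + g x) k = fc f k + fc g k :=
  FourierGalerkin.fc_add hf.continuous.integrableOn_cell hg.continuous.integrableOn_cell k

lemma IsWiener.fc_sub {f g : (Fin d → ℝ) → ℂ} (hf : IsWiener f) (hg : IsWiener g)
    (k : Fin d → ℤ) : fc (fun x => f x - g x) k = fc f k - fc g k :=
  FourierGalerkin.fc_sub hf.continuous.integrableOn_cell hg.continuous.integrableOn_cell k

lemma IsWiener.sum_and_fc {α : Type*} (S : Finset α) {f : α → (Fin d → ℝ) → ℂ}
    (hf : ∀ a ∈ S, IsWiener (f a)) : IsWiener (fun x => ∑ a ∈ S, f a x) ∧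
      ∀ k, fc (fun x => ∑ a ∈ S, f a x) k = ∑ a ∈ S, fc (f a) k := by
  classical
  induction S using Finset.induction_on with
  | empty => simpa using ⟨isWiener_const 0, fun k => by simpa using fc_const 0 k⟩
  | insert a S ha ih =>
    obtain ⟨h1, h2⟩ := ih fun b hb => hf b (Finset.mem_insert_of_mem hb)
    have h3 := hf a (Finset.mem_insert_self a S)
    simp_rw [Finset.sum_insert ha]
    exact ⟨h3.add h1, fun k => by rw [h3.fc_add h1, h2]⟩

lemma IsWiener.sum {α : Type*} (S : Finset α) {f : α → (Fin d → ℝ) → ℂ}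
    (hf : ∀ a ∈ S, IsWiener (f a)) : IsWiener (fun x => ∑ a ∈ S, f a x) :=
  (IsWiener.sum_and_fc S hf).1

lemma IsWiener.fc_sum {α : Type*} (S : Finset α) {f : α → (Fin d → ℝ) → ℂ}
    (hf : ∀ a ∈ S, IsWiener (f a)) (k : Fin d → ℤ) :
    fc (fun x => ∑ a ∈ S, f a x) k = ∑ a ∈ S, fc (f a) k :=
  (IsWiener.sum_and_fc S hf).2 k

lemma summable_conv_prod {a b : (Fin d → ℤ) → ℂ} (ha : Summable fun k => ‖a k‖)
    (hb : Summable fun k => ‖b k‖) :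
    Summable fun p : (Fin d → ℤ) × (Fin d → ℤ) => ‖a (p.1 - p.2) * b p.2‖ := by
  let e : (Fin d → ℤ) × (Fin d → ℤ) ≃ (Fin d → ℤ) × (Fin d → ℤ) :=
    { toFun := fun p => (p.1 - p.2, p.2)
      invFun := fun p => (p.1 + p.2, p.2)
      left_inv := fun p => by simp
      right_inv := fun p => by simp }
  have h := (e.summable_iff).2 (ha.mul_norm hb)
  exact h

lemma summable_conv {a b : (Fin d → ℤ) → ℂ} (ha : Summable fun k => ‖a k‖)
    (hb : Summable fun k => ‖b k‖) (k : Fin d → ℤ) : Summable fun l => ‖a (k - l) * b l‖ :=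
  (summable_conv_prod ha hb).prod_factor k

lemma summable_norm_conv {a b : (Fin d → ℤ) → ℂ} (ha : Summable fun k => ‖a k‖)
    (hb : Summable fun k => ‖b k‖) : Summable fun k => ‖∑' l, a (k - l) * b l‖ := by
  refine Summable.of_nonneg_of_le (fun _ => norm_nonneg _)
    (fun k => norm_tsum_le_tsum_norm (summable_conv ha hb k)) ?_
  exact (summable_conv_prod ha hb).prod

lemma tsum_conv_character {a b : (Fin d → ℤ) → ℂ} (ha : Summable fun k => ‖a k‖)
    (hb : Summable fun k => ‖b k‖) (x : Fin d → ℝ) :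
    (∑' k, a k * character k x) * (∑' k, b k * character k x)
      = ∑' k, (∑' l, a (k - l) * b l) * character k x := by
  have h1 : ∀ k, (∑' l, a (k - l) * b l) * character k x
      = ∑' l, (a (k - l) * character (k - l) x) * (b l * character l x) := by
    intro k
    rw [← tsum_mul_right]
    refine tsum_congr fun l => ?_
    have : character k x = character (k - l) x * character l x := by
      rw [← character_add, sub_add_cancel]
    rw [this]
    ring
  simp_rw [h1]
  have h2 : Summable (Function.uncurry fun k l : Fin d → ℤ =>
      (a (k - l) * character (k - l) x) * (b l * character l x)) := by
    refine Summable.of_norm ?_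
    refine (summable_conv_prod ha hb).congr fun p => ?_
    simp [Function.uncurry]
  rw [← h2.tsum_comm]
  have h3 : ∀ l, ∑' k, (a (k - l) * character (k - l) x) * (b l * character l x)
      = (∑' k, a k * character k x) * (b l * character l x) := by
    intro l
    rw [tsum_mul_right]
    congr 1
    exact (Equiv.subRight l).tsum_eq (fun k => a k * character k x)
  simp_rw [h3]
  rw [tsum_mul_left]

lemma IsWiener.mul_and_fc {f g : (Fin d → ℝ) → ℂ} (hf : IsWiener f) (hg : IsWiener g) :
    IsWiener (fun x => f x * g x) ∧
      ∀ k, fc (fun x => f x * g x) k = ∑' l, fc f (k - l) * fc g l := by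
  have h1 := summable_norm_conv hf.summable hg.summable
  have h2 : ∀ x, f x * g x = ∑' k, (∑' l, fc f (k - l) * fc g l) * character k x := by
    intro x
    rw [← tsum_conv_character hf.summable hg.summable, ← hf.eq_tsum, ← hg.eq_tsum]
  exact ⟨IsWiener.of_series h1 h2, congrFun (fc_of_series h1 h2)⟩

lemma IsWiener.mul {f g : (Fin d → ℝ) → ℂ} (hf : IsWiener f) (hg : IsWiener g) :
    IsWiener (fun x => f x * g x) := (hf.mul_and_fc hg).1

lemma IsWiener.fc_mul {f g : (Fin d → ℝ) → ℂ} (hf : IsWiener f) (hg : IsWiener g)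
    (k : Fin d → ℤ) : fc (fun x => f x * g x) k = ∑' l, fc f (k - l) * fc g l :=
  (hf.mul_and_fc hg).2 k

lemma enorm_tsum_le {ι E : Type*} [SeminormedAddCommGroup E] {c : ι → E}
    (h : Summable fun k => ‖c k‖) : ‖∑' k, c k‖ₑ ≤ ∑' k, ‖c k‖ₑ := by
  have h2 : ∑' k, ‖c k‖ₑ = ENNReal.ofReal (∑' k, ‖c k‖) := by
    rw [ENNReal.ofReal_tsum_of_nonneg (fun _ => norm_nonneg _) h]
    simp [ofReal_norm]
  rw [h2, ← ofReal_norm]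
  exact ENNReal.ofReal_le_ofReal (norm_tsum_le_tsum_norm h)

lemma ec_mul_le {f g : (Fin d → ℝ) → ℂ} (hf : IsWiener f) (hg : IsWiener g) (k : Fin d → ℤ) :
    ec (fun x => f x * g x) k ≤ conv (ec f) (ec g) k := by
  unfold ec
  rw [hf.fc_mul hg]
  refine (enorm_tsum_le (summable_conv hf.summable hg.summable k)).trans (le_of_eq ?_)
  exact tsum_congr fun l => enorm_mul _ _

lemma ec_add_le {f g : (Fin d → ℝ) → ℂ} (hf : IsWiener f) (hg : IsWiener g) (k : Fin d → ℤ) :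
    ec (fun x => f x + g x) k ≤ ec f k + ec g k := by
  unfold ec
  rw [hf.fc_add hg]
  exact enorm_add_le _ _

lemma ec_const_mul (a : ℂ) (f : (Fin d → ℝ) → ℂ) (k : Fin d → ℤ) :
    ec (fun x => a * f x) k = ‖a‖ₑ * ec f k := by
  unfold ec
  rw [fc_const_mul, enorm_mul]

/-- The derivative of the phase `k ⋅ x`, multiplied by `i`. -/
def phaseDeriv (k : Fin d → ℤ) : (Fin d → ℝ) →L[ℝ] ℂ :=
  ∑ j, (Complex.I * (k j : ℂ)) • Complex.ofRealCLM.comp (ContinuousLinearMap.proj (R := ℝ) j)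

lemma phaseDeriv_apply (k : Fin d → ℤ) (y : Fin d → ℝ) :
    phaseDeriv k y = Complex.I * ((∑ j, (k j : ℝ) * y j : ℝ) : ℂ) := by
  simp only [phaseDeriv, sum_apply, smul_apply,
    ContinuousLinearMap.comp_apply, ContinuousLinearMap.proj_apply, Complex.ofRealCLM_apply,
    smul_eq_mul]
  push_cast
  rw [Finset.mul_sum]
  exact Finset.sum_congr rfl fun j _ => by ring

lemma norm_phaseDeriv_le (k : Fin d → ℤ) : ‖phaseDeriv k‖ ≤ d * jb k := by
  refine ContinuousLinearMap.opNorm_le_bound _ (by have := jb_nonneg k; positivity) fun y => ?_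
  rw [phaseDeriv_apply, norm_mul, Complex.norm_I, one_mul, Complex.norm_real]
  refine (norm_sum_le _ _).trans ?_
  have : ∀ j ∈ Finset.univ, ‖(k j : ℝ) * y j‖ ≤ jb k * ‖y‖ := by
    intro j _
    rw [norm_mul]
    exact mul_le_mul (abs_coord_le_jb k j) (norm_le_pi_norm y j) (norm_nonneg _) (jb_nonneg k)
  refine (Finset.sum_le_sum this).trans (le_of_eq ?_)
  simp
  ring

lemma hasFDerivAt_character (k : Fin d → ℤ) (x : Fin d → ℝ) :
    HasFDerivAt (character k) (character k x • phaseDeriv k) x := by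
  have h1 : HasFDerivAt (fun y => phaseDeriv k y) (phaseDeriv k) x := (phaseDeriv k).hasFDerivAt
  have h2 := h1.cexp
  have e : (fun y => Complex.exp (phaseDeriv k y)) = character k := by
    ext y
    rw [phaseDeriv_apply, character]
  have e' : Complex.exp (phaseDeriv k x) = character k x := congrFun e x
  rw [e, e'] at h2
  exact h2

section Deriv

variable {f : (Fin d → ℝ) → ℂ}

lemma hasFDerivAt_of_summable (hf : IsWiener f) (h1 : Summable fun k => jb k * ‖fc f k‖)
    (x : Fin d → ℝ) :
    HasFDerivAt f (∑' k, fc f k • (character k x • phaseDeriv k)) x := by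
  have h2 : Summable fun k => (d : ℝ) * (jb k * ‖fc f k‖) := h1.mul_left _
  have := hasFDerivAt_tsum (𝕜 := ℝ) h2 (f := fun k x => fc f k * character k x)
    (f' := fun k x => fc f k • (character k x • phaseDeriv k))
    (fun k x => (hasFDerivAt_character k x).const_mul (fc f k)) (fun k x => ?_)
    (summable_mul_character hf.summable x) x
  · rwa [← funext hf.eq_tsum] at this
  · rw [norm_smul, norm_smul, norm_character, one_mul]
    have := mul_le_mul_of_nonneg_left (norm_phaseDeriv_le k) (norm_nonneg (fc f k))
    linarith

lemma summable_fderiv_series (h1 : Summable fun k => jb k * ‖fc f k‖)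
    (x : Fin d → ℝ) : Summable fun k => fc f k • (character k x • phaseDeriv k) := by
  refine Summable.of_norm_bounded (h1.mul_left (d : ℝ)) fun k => ?_
  rw [norm_smul, norm_smul, norm_character, one_mul]
  have := mul_le_mul_of_nonneg_left (norm_phaseDeriv_le k) (norm_nonneg (fc f k))
  linarith

lemma contDiff_of_summable (hf : IsWiener f) (h1 : Summable fun k => jb k * ‖fc f k‖) :
    ContDiff ℝ 1 f := by
  rw [contDiff_one_iff_fderiv]
  refine ⟨fun x => (hasFDerivAt_of_summable hf h1 x).differentiableAt, ?_⟩
  have e : fderiv ℝ f = fun x => ∑' k, fc f k • (character k x • phaseDeriv k) := by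
    ext1 x
    exact (hasFDerivAt_of_summable hf h1 x).fderiv
  rw [e]
  refine continuous_tsum (u := fun k => (d : ℝ) * (jb k * ‖fc f k‖)) (fun k => ?_) (h1.mul_left _)
    fun k x => ?_
  · fun_prop
  · rw [norm_smul, norm_smul, norm_character, one_mul]
    have := mul_le_mul_of_nonneg_left (norm_phaseDeriv_le k) (norm_nonneg (fc f k))
    linarith

lemma fderiv_series (hf : IsWiener f) (h1 : Summable fun k => jb k * ‖fc f k‖) (j : Fin d)
    (x : Fin d → ℝ) : fderiv ℝ f x (Pi.single j 1)
      = ∑' k, (Complex.I * (k j : ℂ) * fc f k) * character k x := by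
  rw [(hasFDerivAt_of_summable hf h1 x).fderiv]
  have h := (ContinuousLinearMap.apply ℝ ℂ (Pi.single j (1 : ℝ) : Fin d → ℝ)).map_tsum
    (summable_fderiv_series h1 x)
  simp only [ContinuousLinearMap.apply_apply] at h
  rw [h]
  refine tsum_congr fun k => ?_
  simp only [smul_apply, phaseDeriv_apply, smul_eq_mul]
  have : ∑ i, (k i : ℝ) * (Pi.single j 1 : Fin d → ℝ) i = k j := by
    simp [Pi.single_apply]
  rw [this]
  push_cast
  ring

lemma summable_deriv (h1 : Summable fun k => jb k * ‖fc f k‖) (j : Fin d) :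
    Summable fun k => ‖Complex.I * (k j : ℂ) * fc f k‖ := by
  refine Summable.of_nonneg_of_le (fun _ => norm_nonneg _) (fun k => ?_) h1
  rw [norm_mul, norm_mul, Complex.norm_I, one_mul]
  gcongr
  simpa using abs_coord_le_jb k j

lemma isWiener_fderiv (hf : IsWiener f) (h1 : Summable fun k => jb k * ‖fc f k‖) (j : Fin d) :
    IsWiener (fun x => fderiv ℝ f x (Pi.single j 1)) :=
  IsWiener.of_series (summable_deriv h1 j) (fderiv_series hf h1 j)

lemma fc_fderiv (hf : IsWiener f) (h1 : Summable fun k => jb k * ‖fc f k‖) (j : Fin d)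
    (k : Fin d → ℤ) :
    fc (fun x => fderiv ℝ f x (Pi.single j 1)) k = Complex.I * (k j : ℂ) * fc f k :=
  congrFun (fc_of_series (summable_deriv h1 j) (fderiv_series hf h1 j)) k

end Deriv

lemma summable_jb_of_n1 {E : Type*} [SeminormedAddCommGroup E] {c : (Fin d → ℤ) → E}
    (h : n1 (fun k => ‖c k‖ₑ) ≠ ∞) : Summable fun k => jb k * ‖c k‖ := by
  have := ENNReal.summable_toReal h
  refine this.congr fun k => ?_
  simp [wt, ENNReal.toReal_ofReal (jb_nonneg k)]

end Wiener

/-! ### Vector-valued functions and polynomial nonlinearities -/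

section Vector

variable {d n : ℕ}

/-- The `i`-th component of `U`, as a complex-valued function. -/
def cx (U : Func d n) (i : Fin n) : (Fin d → ℝ) → ℂ := fun x => (U x i : ℂ)

/-- The `k`-th Fourier coefficient of `U`, as a vector of the Hermitian space `ℂ^n`. -/
def vc (U : Func d n) (k : Fin d → ℤ) : EuclideanSpace ℂ (Fin n) := WithLp.toLp 2 (coeff U k)

@[simp] lemma vc_apply (U : Func d n) (k : Fin d → ℤ) (i : Fin n) : vc U k i = coeff U k i := rfl

lemma vc_apply_eq_fc (U : Func d n) (k : Fin d → ℤ) (i : Fin n) : vc U k i = fc (cx U i) k := rfl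

/-- The sequence of norms of the Fourier coefficients of `U`. -/
def ev (U : Func d n) (k : Fin d → ℤ) : ℝ≥0∞ := ‖vc U k‖ₑ

/-- The weighted Wiener norm `∑ ⟨k⟩ |Û_k|`. -/
def W1 (U : Func d n) : ℝ≥0∞ := n1 (ev U)

/-- The `H^s` norm as an extended nonnegative real. -/
def Hs (s : ℝ) (U : Func d n) : ℝ≥0∞ := nH s (ev U)

lemma enorm_apply_le (v : EuclideanSpace ℂ (Fin n)) (i : Fin n) : ‖v i‖ₑ ≤ ‖v‖ₑ := by
  rw [← ofReal_norm, ← ofReal_norm]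
  exact ENNReal.ofReal_le_ofReal (PiLp.norm_apply_le v i)

lemma norm_le_sum (v : EuclideanSpace ℂ (Fin n)) : ‖v‖ ≤ ∑ i, ‖v i‖ := by
  rw [EuclideanSpace.norm_eq, Real.sqrt_le_left (by positivity)]
  exact Finset.sum_sq_le_sq_sum_of_nonneg fun i _ => norm_nonneg _

lemma ec_cx_le (U : Func d n) (i : Fin n) (k : Fin d → ℤ) : ec (cx U i) k ≤ ev U k :=
  enorm_apply_le (vc U k) i

lemma hsTerm_eq (s : ℝ) (U : Func d n) (k : Fin d → ℤ) :
    hsTerm s U k = (jb k ^ s * ‖vc U k‖) ^ 2 := by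
  rw [hsTerm, weight_eq, mul_pow, EuclideanSpace.norm_sq_eq]
  rfl

lemma hsTerm_nonneg (s : ℝ) (U : Func d n) (k : Fin d → ℤ) : 0 ≤ hsTerm s U k := by
  rw [hsTerm_eq]
  positivity

lemma ofReal_hsTerm (s : ℝ) (U : Func d n) (k : Fin d → ℤ) :
    ENNReal.ofReal (hsTerm s U k) = (wt s k * ev U k) ^ 2 := by
  rw [hsTerm_eq, wt, ev, ← ofReal_norm, ← ENNReal.ofReal_mul (jb_rpow_pos _ _).le,
    ENNReal.ofReal_pow (mul_nonneg (jb_rpow_pos _ _).le (norm_nonneg _))]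

lemma Hs_sq (s : ℝ) (U : Func d n) : Hs s U ^ 2 = ∑' k, ENNReal.ofReal (hsTerm s U k) := by
  rw [Hs, nH, N2_sq]
  exact tsum_congr fun k => (ofReal_hsTerm s U k).symm

lemma Hs_ne_top_iff {s : ℝ} {U : Func d n} : Hs s U ≠ ∞ ↔ Summable (hsTerm s U) := by
  have h : Hs s U ≠ ∞ ↔ Hs s U ^ 2 ≠ ∞ := by simp [ENNReal.pow_eq_top_iff]
  rw [h, Hs_sq]
  constructor
  · intro h
    refine (ENNReal.summable_toReal h).congr fun k => ?_
    exact ENNReal.toReal_ofReal (hsTerm_nonneg s U k)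
  · intro h
    exact h.tsum_ofReal_ne_top

lemma Hs_eq_ofReal {s : ℝ} {U : Func d n} (h : Summable (hsTerm s U)) :
    Hs s U = ENNReal.ofReal (hsNorm s U) := by
  have h2 : Hs s U ^ 2 = ENNReal.ofReal (hsNorm s U) ^ 2 := by
    rw [Hs_sq, ← ENNReal.ofReal_tsum_of_nonneg (hsTerm_nonneg s U) h,
      ← ENNReal.ofReal_pow (show 0 ≤ hsNorm s U from Real.sqrt_nonneg _), hsNorm,
      Real.sq_sqrt (tsum_nonneg (hsTerm_nonneg s U))]
  exact le_antisymm ((ENNReal.pow_le_pow_left_iff two_ne_zero).1 h2.le)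
    ((ENNReal.pow_le_pow_left_iff two_ne_zero).1 h2.ge)

lemma hsNorm_nonneg (s : ℝ) (U : Func d n) : 0 ≤ hsNorm s U := Real.sqrt_nonneg _

lemma MemHs.Hs_eq {s : ℝ} {U : Func d n} (h : MemHs s U) :
    Hs s U = ENNReal.ofReal (hsNorm s U) := Hs_eq_ofReal h.2.2

lemma MemHs.Hs_ne_top {s : ℝ} {U : Func d n} (h : MemHs s U) : Hs s U ≠ ∞ :=
  Hs_ne_top_iff.2 h.2.2

/-- A finite bound on the extended norm gives a bound on the real-valued norm. -/
lemma hsNorm_le_of_Hs_le {s a : ℝ} {U : Func d n} (ha : 0 ≤ a) (h : Hs s U ≤ ENNReal.ofReal a) :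
    hsNorm s U ≤ a := by
  have h1 : Summable (hsTerm s U) := Hs_ne_top_iff.1 (ne_top_of_le_ne_top ENNReal.ofReal_ne_top h)
  rw [Hs_eq_ofReal h1] at h
  exact (ENNReal.ofReal_le_ofReal_iff ha).1 h

/-- Functions whose Fourier series converges absolutely, together with its formal gradient. -/
structure Reg (U : Func d n) : Prop where
  wiener : ∀ i, IsWiener (cx U i)
  W1_ne_top : W1 U ≠ ∞

lemma Reg.summable_jb {U : Func d n} (h : Reg U) : Summable fun k => jb k * ‖vc U k‖ :=
  summable_jb_of_n1 h.W1_ne_top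

lemma Reg.summable_jb_comp {U : Func d n} (h : Reg U) (i : Fin n) :
    Summable fun k => jb k * ‖fc (cx U i) k‖ := by
  refine Summable.of_nonneg_of_le (fun k => mul_nonneg (jb_nonneg k) (norm_nonneg _)) (fun k => ?_)
    h.summable_jb
  gcongr
  · exact jb_nonneg k
  · exact PiLp.norm_apply_le (vc U k) i

lemma Reg.of_continuous {U : Func d n} (hc : Continuous U) (hp : IsPeriodic U) (h : W1 U ≠ ∞) :
    Reg U := by
  have h1 : Summable fun k => jb k * ‖vc U k‖ := summable_jb_of_n1 h
  refine ⟨fun i => IsWiener.of_continuous ?_ ?_ ?_, h⟩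
  · exact Complex.continuous_ofReal.comp ((continuous_apply i).comp hc)
  · intro j x
    simp only [cx]
    rw [hp]
  · refine Summable.of_nonneg_of_le (fun k => norm_nonneg _) (fun k => ?_) h1
    have h2 : ‖fc (cx U i) k‖ ≤ ‖vc U k‖ := PiLp.norm_apply_le (vc U k) i
    nlinarith [one_le_jb k, norm_nonneg (vc U k)]

lemma Reg.contDiff_comp {U : Func d n} (h : Reg U) (i : Fin n) : ContDiff ℝ 1 (fun x => U x i) := by
  have h1 : ContDiff ℝ 1 (cx U i) := contDiff_of_summable (h.wiener i) (h.summable_jb_comp i)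
  have h2 : ContDiff ℝ 1 (fun x => Complex.reCLM (cx U i x)) := Complex.reCLM.contDiff.comp h1
  simpa [cx] using h2

lemma Reg.contDiff {U : Func d n} (h : Reg U) : ContDiff ℝ 1 U :=
  contDiff_pi.2 h.contDiff_comp

lemma Reg.continuous {U : Func d n} (h : Reg U) : Continuous U := h.contDiff.continuous

lemma Reg.periodic {U : Func d n} (h : Reg U) : IsPeriodic U := by
  intro j x
  ext i
  exact Complex.ofReal_injective ((h.wiener i).per j x)

lemma Reg.memHs {s : ℝ} {U : Func d n} (h : Reg U) (hs : Hs s U ≠ ∞) : MemHs s U :=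
  ⟨h.periodic, h.continuous.memLp_cell, Hs_ne_top_iff.1 hs⟩

lemma Reg.fderiv_comp {U : Func d n} (h : Reg U) (i : Fin n) (x v : Fin d → ℝ) :
    (((fderiv ℝ U x v) i : ℝ) : ℂ) = fderiv ℝ (cx U i) x v := by
  have h1 : HasFDerivAt U (fderiv ℝ U x) x :=
    (h.contDiff.differentiable (by norm_num) x).hasFDerivAt
  have h2 : HasFDerivAt (fun y => U y i)
      ((ContinuousLinearMap.proj (R := ℝ) i).comp (fderiv ℝ U x)) x :=
    (ContinuousLinearMap.proj (R := ℝ) (φ := fun _ : Fin n => ℝ) i).hasFDerivAt.comp x h1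
  have h3 : HasFDerivAt (cx U i) (Complex.ofRealCLM.comp
      ((ContinuousLinearMap.proj (R := ℝ) i).comp (fderiv ℝ U x))) x :=
    Complex.ofRealCLM.hasFDerivAt.comp x h2
  rw [h3.fderiv]
  rfl

lemma Reg.integrableOn {U : Func d n} (h : Reg U) (i : Fin n) : IntegrableOn (cx U i) (cell d) :=
  (h.wiener i).continuous.integrableOn_cell

lemma MemHs.integrableOn {s : ℝ} {U : Func d n} (h : MemHs s U) (i : Fin n) :
    IntegrableOn (cx U i) (cell d) := by
  have h1 : MemLp (fun x => U x i) 2 (volume.restrict (cell d)) := h.2.1.eval i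
  exact (h1.integrable (by norm_num)).ofReal

lemma vc_sub_of_integrableOn {U V : Func d n} (hU : ∀ i, IntegrableOn (cx U i) (cell d))
    (hV : ∀ i, IntegrableOn (cx V i) (cell d)) (k : Fin d → ℤ) :
    vc (U - V) k = vc U k - vc V k := by
  ext i
  have : cx (U - V) i = fun x => cx U i x - cx V i x := by
    ext x
    simp [cx]
  rw [vc_apply_eq_fc, this, fc_sub (hU i) (hV i)]
  rfl

lemma Reg.vc_sub {U V : Func d n} (hU : Reg U) (hV : Reg V) (k : Fin d → ℤ) :
    vc (U - V) k = vc U k - vc V k := vc_sub_of_integrableOn hU.integrableOn hV.integrableOn k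

lemma cx_eq_conj (U : Func d n) (k : Fin d → ℤ) (i : Fin n) :
    coeff U (-k) i = (starRingEnd ℂ) (coeff U k i) :=
  fc_ofReal_neg (fun x => U x i) k

end Vector

section Polynomial

variable {d n : ℕ}

/-- The function `x ↦ p(U(x))`. -/
def pe (p : MvPolynomial (Fin n) ℝ) (U : Func d n) : (Fin d → ℝ) → ℂ :=
  fun x => ((MvPolynomial.eval (U x) p : ℝ) : ℂ)

/-- The function `x ↦ p(U(x)) - p(0)`. -/
def pe0 (p : MvPolynomial (Fin n) ℝ) (U : Func d n) : (Fin d → ℝ) → ℂ :=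
  fun x => pe p U x - ((MvPolynomial.eval 0 p : ℝ) : ℂ)

lemma Reg.isWiener_pe {U : Func d n} (hU : Reg U) (p : MvPolynomial (Fin n) ℝ) :
    IsWiener (pe p U) := by
  induction p using MvPolynomial.induction_on with
  | C a =>
    have : pe (MvPolynomial.C a) U = fun _ => (a : ℂ) := by ext x; simp [pe]
    rw [this]
    exact isWiener_const _
  | add p q hp hq =>
    have : pe (p + q) U = fun x => pe p U x + pe q U x := by ext x; simp [pe]
    rw [this]
    exact hp.add hq
  | mul_X p i hp =>
    have : pe (p * MvPolynomial.X i) U = fun x => pe p U x * cx U i x := by ext x; simp [pe, cx]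
    rw [this]
    exact hp.mul (hU.wiener i)

lemma Reg.isWiener_pe0 {U : Func d n} (hU : Reg U) (p : MvPolynomial (Fin n) ℝ) :
    IsWiener (pe0 p U) := (hU.isWiener_pe p).sub (isWiener_const _)

lemma Reg.fc_pe {U : Func d n} (hU : Reg U) (p : MvPolynomial (Fin n) ℝ) {k : Fin d → ℤ}
    (hk : k ≠ 0) : fc (pe p U) k = fc (pe0 p U) k := by
  unfold pe0
  rw [(hU.isWiener_pe p).fc_sub (isWiener_const _), fc_const, if_neg hk, sub_zero]

lemma Reg.tsum_ec_pe_le {U : Func d n} (hU : Reg U) (p : MvPolynomial (Fin n) ℝ) :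
    ∑' k, ec (pe p U) k ≤ n1 (ec (pe0 p U)) + ‖((MvPolynomial.eval 0 p : ℝ) : ℂ)‖ₑ := by
  set a : ℂ := ((MvPolynomial.eval 0 p : ℝ) : ℂ)
  have h1 : ∀ k, ec (pe p U) k ≤ ec (pe0 p U) k + if k = 0 then ‖a‖ₑ else 0 := by
    intro k
    have : pe p U = fun x => pe0 p U x + a := by
      ext x
      simp [pe0, a]
    rw [this]
    refine (ec_add_le (hU.isWiener_pe0 p) (isWiener_const a) k).trans (le_of_eq ?_)
    congr 1
    unfold ec
    rw [fc_const]
    split_ifs <;> simp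
  calc ∑' k, ec (pe p U) k ≤ ∑' k, (ec (pe0 p U) k + if k = 0 then ‖a‖ₑ else 0) :=
        ENNReal.tsum_le_tsum h1
    _ = ∑' k, ec (pe0 p U) k + ‖a‖ₑ := by rw [ENNReal.tsum_add, tsum_ite_eq]
    _ ≤ _ := by gcongr; exact tsum_le_n1 _

lemma pe0_mul_X (p : MvPolynomial (Fin n) ℝ) (i : Fin n) (U : Func d n) :
    pe0 (p * MvPolynomial.X i) U
      = fun x => pe0 p U x * cx U i x + ((MvPolynomial.eval 0 p : ℝ) : ℂ) * cx U i x := by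
  ext x
  simp [pe0, pe, cx]
  ring

lemma pe0_add (p q : MvPolynomial (Fin n) ℝ) (U : Func d n) :
    pe0 (p + q) U = fun x => pe0 p U x + pe0 q U x := by
  ext x
  simp [pe0, pe]
  ring

lemma ec_zero (k : Fin d → ℤ) : ec (fun _ : Fin d → ℝ => (0 : ℂ)) k = 0 := by
  unfold ec
  rw [fc_const]
  simp

lemma pe0_C (a : ℝ) (U : Func d n) : pe0 (MvPolynomial.C a) U = fun _ => 0 := by
  ext x
  simp [pe0, pe]

/-- Tame estimates for polynomial nonlinearities. -/
lemma pe0_bounds (p : MvPolynomial (Fin n) ℝ) {s : ℝ} (hs : 0 ≤ s) (R : ℝ≥0) :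
    ∃ C : ℝ≥0, ∀ U : Func d n, Reg U → W1 U ≤ R →
      n1 (ec (pe0 p U)) ≤ C * W1 U ∧ nH s (ec (pe0 p U)) ≤ C * Hs s U := by
  induction p using MvPolynomial.induction_on with
  | C a =>
    refine ⟨0, fun U hU hR => ?_⟩
    rw [pe0_C]
    have : ec (fun _ : Fin d → ℝ => (0 : ℂ)) = fun _ => 0 := funext ec_zero
    rw [this]
    simp [n1, nH]
  | add p q hp hq =>
    obtain ⟨C₁, h₁⟩ := hp
    obtain ⟨C₂, h₂⟩ := hq
    refine ⟨C₁ + C₂, fun U hU hR => ?_⟩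
    rw [pe0_add]
    have h := ec_add_le (hU.isWiener_pe0 p) (hU.isWiener_pe0 q)
    push_cast
    rw [add_mul, add_mul]
    constructor
    · refine (n1_mono h).trans ?_
      rw [n1_add]
      exact add_le_add (h₁ U hU hR).1 (h₂ U hU hR).1
    · exact (nH_mono h).trans ((nH_add_le _ _ _).trans
        (add_le_add (h₁ U hU hR).2 (h₂ U hU hR).2))
  | mul_X p i hp =>
    obtain ⟨C, hC⟩ := hp
    set a : ℂ := ((MvPolynomial.eval 0 p : ℝ) : ℂ) with ha
    refine ⟨2 * C * R + ‖a‖₊ + ((2 : ℝ) ^ s).toNNReal * (2 * C * R), fun U hU hR => ?_⟩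
    obtain ⟨h1, h2⟩ := hC U hU hR
    rw [pe0_mul_X]
    have hW := hU.isWiener_pe0 p
    have hu := hU.wiener i
    have h : ∀ k, ec (fun x => pe0 p U x * cx U i x + a * cx U i x) k
        ≤ conv (ec (pe0 p U)) (ev U) k + ‖a‖ₑ * ev U k := by
      intro k
      refine (ec_add_le (hW.mul hu) (hu.const_mul a) k).trans (add_le_add ?_ ?_)
      · refine (ec_mul_le hW hu k).trans ?_
        unfold conv
        gcongr with l
        exact ec_cx_le U i l
      · rw [ec_const_mul]
        gcongr
        exact ec_cx_le U i k
    have hcast : ((2 * C * R + ‖a‖₊ + ((2 : ℝ) ^ s).toNNReal * (2 * C * R) : ℝ≥0) : ℝ≥0∞)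
        = 2 * C * R + ‖a‖ₑ + ENNReal.ofReal (2 ^ s) * (2 * C * R) := by
      push_cast
      rfl
    rw [hcast]
    have hev : ∑' k, ev U k ≤ R := (tsum_le_n1 _).trans hR
    constructor
    · refine (n1_mono h).trans ?_
      rw [n1_add, n1_const_mul]
      calc n1 (conv (ec (pe0 p U)) (ev U)) + ‖a‖ₑ * n1 (ev U)
          ≤ 2 * (C * R * W1 U) + ‖a‖ₑ * W1 U := by
            gcongr
            · refine (n1_conv_le _ _).trans ?_
              gcongr
              · exact h1.trans (by gcongr)
              · exact le_rfl
            · exact le_rfl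
        _ = (2 * C * R + ‖a‖ₑ) * W1 U := by ring
        _ ≤ _ := mul_le_mul' le_self_add le_rfl
    · refine (nH_mono h).trans ((nH_add_le _ _ _).trans ?_)
      rw [nH_const_mul]
      have h3 : nH s (conv (ec (pe0 p U)) (ev U))
          ≤ ENNReal.ofReal (2 ^ s) * (2 * C * R) * Hs s U := by
        refine (nH_conv_le hs _ _).trans ?_
        rw [mul_assoc]
        gcongr
        calc nH s (ec (pe0 p U)) * ∑' k, ev U k + (∑' k, ec (pe0 p U) k) * nH s (ev U)
            ≤ C * Hs s U * R + C * R * Hs s U := by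
              gcongr
              · exact (tsum_le_n1 _).trans (h1.trans (by gcongr))
              · exact le_rfl
          _ = 2 * C * R * Hs s U := by ring
      calc _ ≤ ENNReal.ofReal (2 ^ s) * (2 * C * R) * Hs s U + ‖a‖ₑ * Hs s U :=
            add_le_add h3 le_rfl
        _ = (‖a‖ₑ + ENNReal.ofReal (2 ^ s) * (2 * C * R)) * Hs s U := by ring
        _ ≤ _ := by
          rw [add_assoc]
          exact mul_le_mul' le_add_self le_rfl

/-- Polynomial nonlinearities are Lipschitz for the `L²` norm on bounded sets of the Wiener
algebra. -/
lemma pe_lipschitz (p : MvPolynomial (Fin n) ℝ) (R : ℝ≥0) :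
    ∃ C : ℝ≥0, ∀ U V : Func d n, Reg U → Reg V → W1 U ≤ R → W1 V ≤ R →
      N2 (fun k => ‖fc (pe p U) k - fc (pe p V) k‖ₑ) ≤ C * N2 (fun k => ‖vc U k - vc V k‖ₑ) := by
  induction p using MvPolynomial.induction_on with
  | C a =>
    refine ⟨0, fun U V hU hV hRU hRV => ?_⟩
    have : ∀ U : Func d n, pe (MvPolynomial.C a) U = fun _ => (a : ℂ) := by
      intro U
      ext x
      simp [pe]
    simp [this]
  | add p q hp hq =>
    obtain ⟨C₁, h₁⟩ := hp
    obtain ⟨C₂, h₂⟩ := hq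
    refine ⟨C₁ + C₂, fun U V hU hV hRU hRV => ?_⟩
    have e : ∀ (W : Func d n), Reg W → ∀ k,
        fc (pe (p + q) W) k = fc (pe p W) k + fc (pe q W) k := by
      intro W hW k
      have : pe (p + q) W = fun x => pe p W x + pe q W x := by ext x; simp [pe]
      rw [this, (hW.isWiener_pe p).fc_add (hW.isWiener_pe q)]
    push_cast
    rw [add_mul]
    refine (N2_mono fun k => ?_).trans ((N2_add_le _ _).trans
      (add_le_add (h₁ U V hU hV hRU hRV) (h₂ U V hU hV hRU hRV)))
    rw [e U hU, e V hV, add_sub_add_comm]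
    exact enorm_add_le _ _
  | mul_X p i hp =>
    obtain ⟨C, hC⟩ := hp
    obtain ⟨C', hC'⟩ := pe0_bounds (d := d) p le_rfl R
    set a : ℂ := ((MvPolynomial.eval 0 p : ℝ) : ℂ) with ha
    refine ⟨C * R + (C' * R + ‖a‖₊), fun U V hU hV hRU hRV => ?_⟩
    have e : ∀ (W : Func d n), pe (p * MvPolynomial.X i) W = fun x => pe p W x * cx W i x := by
      intro W
      ext x
      simp [pe, cx]
    have hpU := hU.isWiener_pe p
    have hpV := hV.isWiener_pe p
    have h1 : ∀ k, fc (pe (p * MvPolynomial.X i) U) k - fc (pe (p * MvPolynomial.X i) V) k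
        = fc (fun x => (pe p U x - pe p V x) * cx U i x) k
          + fc (fun x => pe p V x * (cx U i x - cx V i x)) k := by
      intro k
      rw [e U, e V, ← (hpU.mul (hU.wiener i)).fc_sub (hpV.mul (hV.wiener i)),
        ← ((hpU.sub hpV).mul (hU.wiener i)).fc_add (hpV.mul ((hU.wiener i).sub (hV.wiener i)))]
      congr 1
      ext x
      ring
    have h2 : ∀ k, ‖fc (pe (p * MvPolynomial.X i) U) k - fc (pe (p * MvPolynomial.X i) V) k‖ₑ
        ≤ conv (fun k => ‖fc (pe p U) k - fc (pe p V) k‖ₑ) (ev U) k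
          + conv (ec (pe p V)) (fun k => ‖vc U k - vc V k‖ₑ) k := by
      intro k
      rw [h1]
      refine (enorm_add_le _ _).trans (add_le_add ?_ ?_)
      · refine (ec_mul_le (hpU.sub hpV) (hU.wiener i) k).trans ?_
        unfold conv
        gcongr with l l
        · unfold ec
          rw [hpU.fc_sub hpV]
        · exact ec_cx_le U i l
      · refine (ec_mul_le hpV ((hU.wiener i).sub (hV.wiener i)) k).trans ?_
        unfold conv
        gcongr with l
        unfold ec
        rw [(hU.wiener i).fc_sub (hV.wiener i)]
        exact enorm_apply_le (vc U l - vc V l) i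
    refine (N2_mono h2).trans ((N2_add_le _ _).trans ?_)
    have hcast : ((C * R + (C' * R + ‖a‖₊) : ℝ≥0) : ℝ≥0∞) = C * R + (C' * R + ‖a‖ₑ) := by
      push_cast
      rfl
    rw [hcast, add_mul]
    gcongr
    · refine (N2_conv_le' _ _).trans ?_
      calc _ ≤ (C * N2 (fun k => ‖vc U k - vc V k‖ₑ)) * R :=
            mul_le_mul' (hC U V hU hV hRU hRV) ((tsum_le_n1 _).trans hRU)
        _ = _ := by ring
    · refine (N2_conv_le _ _).trans ?_
      gcongr
      refine (hV.tsum_ec_pe_le p).trans ?_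
      gcongr
      exact (hC' V hV hRV).1.trans (by gcongr)

end Polynomial

/-! ### Energy estimates for transport operators on the Fourier side -/

section Abstract

variable {d : ℕ} {E : Type*} [NormedAddCommGroup E] [InnerProductSpace ℂ E]

local notation "⟪" x ", " y "⟫" => inner ℂ x y

/-- The kernel of the transport operator `u ↦ ∑_j b_j ∂_j u` in Fourier variables. -/
def tker (b : Fin d → (Fin d → ℤ) → E →L[ℂ] E) (u : (Fin d → ℤ) → E) (k l : Fin d → ℤ) : E :=
  ∑ j, (Complex.I * (l j : ℂ)) • b j (k - l) (u l)

/-- The transport operator `u ↦ ∑_j b_j ∂_j u` in Fourier variables. -/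
def top (b : Fin d → (Fin d → ℤ) → E →L[ℂ] E) (u : (Fin d → ℤ) → E) (k : Fin d → ℤ) : E :=
  ∑' l, tker b u k l

/-- Symmetry of the coefficients, in Fourier variables: for real symmetric matrices `b_j(x)`, the
adjoint of the Fourier coefficient of index `m` is the one of index `-m`. -/
def SymmKernel (b : Fin d → (Fin d → ℤ) → E →L[ℂ] E) : Prop :=
  ∀ j m x y, ⟪x, b j m y⟫ = ⟪b j (-m) x, y⟫

lemma inner_tker (b : Fin d → (Fin d → ℤ) → E →L[ℂ] E) (u : (Fin d → ℤ) → E) (x : E)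
    (k l : Fin d → ℤ) :
    ⟪x, tker b u k l⟫ = ∑ j, Complex.I * (l j : ℂ) * ⟪x, b j (k - l) (u l)⟫ := by
  unfold tker
  rw [inner_sum]
  exact Finset.sum_congr rfl fun j _ => inner_smul_right _ _ _

/-- With weights that are symmetric in `k` and `l`, exchanging `k` and `l` shows that the double sum
is the opposite of its conjugate. -/
lemma re_symm_sum_eq_zero {b : Fin d → (Fin d → ℤ) → E →L[ℂ] E} (hb : SymmKernel b)
    (S : Finset (Fin d → ℤ)) (w : (Fin d → ℤ) → ℝ) (z : (Fin d → ℤ) → E) (j : Fin d) :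
    (∑ k ∈ S, ∑ l ∈ S, ((w k * (w l * (((k j : ℝ) + l j) / 2)) : ℝ) : ℂ) *
      (Complex.I * ⟪z k, b j (k - l) (z l)⟫)).re = 0 := by
  set Q := ∑ k ∈ S, ∑ l ∈ S, ((w k * (w l * (((k j : ℝ) + l j) / 2)) : ℝ) : ℂ) *
      (Complex.I * ⟪z k, b j (k - l) (z l)⟫) with hQ
  have h : (starRingEnd ℂ) Q = -Q := by
    rw [hQ, map_sum, ← Finset.sum_neg_distrib]
    simp_rw [map_sum]
    rw [Finset.sum_comm]
    refine Finset.sum_congr rfl fun k _ => ?_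
    rw [← Finset.sum_neg_distrib]
    refine Finset.sum_congr rfl fun l _ => ?_
    rw [map_mul, map_mul, Complex.conj_ofReal, Complex.conj_I, inner_conj_symm, hb j (k - l),
      neg_sub]
    push_cast
    ring
  have h2 := congrArg Complex.re h
  rw [Complex.conj_re, Complex.neg_re] at h2
  linarith

/-- Symmetrization of the energy: by `re_symm_sum_eq_zero` the factor `w_k l_j` can be replaced by
`w_k l_j - w_l (k_j + l_j) / 2`, which vanishes for `k = l`. -/
lemma energy_identity_le {b : Fin d → (Fin d → ℤ) → E →L[ℂ] E} (hb : SymmKernel b)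
    (S : Finset (Fin d → ℤ)) (w : (Fin d → ℤ) → ℝ) (hw : ∀ k, 0 ≤ w k) (z : (Fin d → ℤ) → E) :
    |∑ k ∈ S, w k ^ 2 * (⟪z k, ∑ l ∈ S, tker b z k l⟫).re|
      ≤ ∑ k ∈ S, w k * ‖z k‖ * ∑ l ∈ S, ∑ j,
        |w k * l j - w l * (((k j : ℝ) + l j) / 2)| * (‖b j (k - l)‖ * ‖z l‖) := by
  have e : (∑ k ∈ S, w k ^ 2 * (⟪z k, ∑ l ∈ S, tker b z k l⟫).re)
      = ∑ k ∈ S, ∑ l ∈ S, ∑ j, ((w k * (w k * l j - w l * (((k j : ℝ) + l j) / 2)) : ℝ) *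
        (Complex.I * ⟪z k, b j (k - l) (z l)⟫).re) := by
    have h0 : ∑ j, (∑ k ∈ S, ∑ l ∈ S, ((w k * (w l * (((k j : ℝ) + l j) / 2)) : ℝ) : ℂ) *
      (Complex.I * ⟪z k, b j (k - l) (z l)⟫)).re = 0 :=
      Finset.sum_eq_zero fun j _ => re_symm_sum_eq_zero hb S w z j
    have h1 : ∑ k ∈ S, ∑ l ∈ S, ∑ j, ((w k * (w l * (((k j : ℝ) + l j) / 2)) : ℝ) *
      (Complex.I * ⟪z k, b j (k - l) (z l)⟫).re) = 0 := by
      rw [← h0]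
      simp_rw [Complex.re_sum, Complex.re_ofReal_mul]
      rw [Finset.sum_comm (s := Finset.univ)]
      refine Finset.sum_congr rfl fun k _ => ?_
      rw [Finset.sum_comm (s := Finset.univ)]
    rw [← sub_zero (∑ k ∈ S, w k ^ 2 * _), ← h1, ← Finset.sum_sub_distrib]
    refine Finset.sum_congr rfl fun k _ => ?_
    rw [inner_sum, Complex.re_sum, Finset.mul_sum, ← Finset.sum_sub_distrib]
    refine Finset.sum_congr rfl fun l _ => ?_
    rw [inner_tker, Complex.re_sum, Finset.mul_sum, ← Finset.sum_sub_distrib]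
    refine Finset.sum_congr rfl fun j _ => ?_
    have : Complex.I * (l j : ℂ) * ⟪z k, b j (k - l) (z l)⟫
        = ((l j : ℝ) : ℂ) * (Complex.I * ⟪z k, b j (k - l) (z l)⟫) := by push_cast; ring
    rw [this, Complex.re_ofReal_mul]
    ring
  rw [e]
  refine (Finset.abs_sum_le_sum_abs _ _).trans (Finset.sum_le_sum fun k _ => ?_)
  rw [Finset.mul_sum]
  refine (Finset.abs_sum_le_sum_abs _ _).trans (Finset.sum_le_sum fun l _ => ?_)
  rw [Finset.mul_sum]
  refine (Finset.abs_sum_le_sum_abs _ _).trans (Finset.sum_le_sum fun j _ => ?_)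
  rw [abs_mul, abs_mul, abs_of_nonneg (hw k)]
  have h1 : |(Complex.I * ⟪z k, b j (k - l) (z l)⟫).re| ≤ ‖z k‖ * (‖b j (k - l)‖ * ‖z l‖) := by
    refine (Complex.abs_re_le_norm _).trans ?_
    rw [norm_mul, Complex.norm_I, one_mul]
    refine (norm_inner_le_norm _ _).trans ?_
    gcongr
    exact ContinuousLinearMap.le_opNorm _ _
  calc _ ≤ w k * |w k * l j - w l * (((k j : ℝ) + l j) / 2)| *
        (‖z k‖ * (‖b j (k - l)‖ * ‖z l‖)) := by
        gcongr
        exact mul_nonneg (hw k) (abs_nonneg _)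
    _ = _ := by ring

/-- The energy is bounded by a double sum against any majorant of the symmetrized kernel. -/
lemma energy_le_tsum {b : Fin d → (Fin d → ℤ) → E →L[ℂ] E} (hb : SymmKernel b)
    {β : (Fin d → ℤ) → ℝ≥0∞} (hβ : ∀ j m, m ≠ 0 → ‖b j m‖ₑ ≤ β m)
    (S : Finset (Fin d → ℤ)) (w : (Fin d → ℤ) → ℝ) (hw : ∀ k, 0 ≤ w k)
    (K : (Fin d → ℤ) → (Fin d → ℤ) → ℝ≥0∞)
    (hK : ∀ k l j, ENNReal.ofReal |w k * l j - w l * (((k j : ℝ) + l j) / 2)| ≤ K k l)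
    (z : (Fin d → ℤ) → E) :
    ENNReal.ofReal |∑ k ∈ S, w k ^ 2 * (⟪z k, ∑ l ∈ S, tker b z k l⟫).re|
      ≤ ∑' k, (ENNReal.ofReal (w k) * ‖z k‖ₑ) * (d * ∑' l, K k l * (β (k - l) * ‖z l‖ₑ)) := by
  have hpos : ∀ k, 0 ≤ w k * ‖z k‖ := fun k => mul_nonneg (hw k) (norm_nonneg _)
  refine (ENNReal.ofReal_le_ofReal (energy_identity_le hb S w hw z)).trans ?_
  rw [ENNReal.ofReal_sum_of_nonneg fun k _ => mul_nonneg (hpos k) (by positivity)]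
  refine (Finset.sum_le_sum fun k _ => ?_).trans (ENNReal.sum_le_tsum S)
  rw [ENNReal.ofReal_mul (hpos k), ENNReal.ofReal_mul (hw k), ofReal_norm]
  gcongr
  rw [ENNReal.ofReal_sum_of_nonneg fun l _ => by positivity, ← ENNReal.tsum_mul_left]
  refine (Finset.sum_le_sum fun l _ => ?_).trans (ENNReal.sum_le_tsum S)
  rw [ENNReal.ofReal_sum_of_nonneg fun j _ => by positivity]
  calc _ ≤ ∑ _j : Fin d, K k l * (β (k - l) * ‖z l‖ₑ) := by
        refine Finset.sum_le_sum fun j _ => ?_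
        rw [ENNReal.ofReal_mul (abs_nonneg _), ENNReal.ofReal_mul (norm_nonneg _), ofReal_norm,
          ofReal_norm]
        by_cases hkl : k = l
        · subst hkl
          have : w k * (k j : ℝ) - w k * (((k j : ℝ) + k j) / 2) = 0 := by ring
          rw [this]
          simp
        · gcongr
          · exact hK k l j
          · exact hβ j _ (sub_ne_zero.2 hkl)
    _ = _ := by simp

/-- Tame energy estimate in `H^s`. -/
lemma energy_Hs_le {b : Fin d → (Fin d → ℤ) → E →L[ℂ] E} (hb : SymmKernel b)
    {β : (Fin d → ℤ) → ℝ≥0∞} (hβ : ∀ j m, m ≠ 0 → ‖b j m‖ₑ ≤ β m) {s : ℝ} (hs : 1 ≤ s)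
    (S : Finset (Fin d → ℤ)) (z : (Fin d → ℤ) → E) :
    ENNReal.ofReal |∑ k ∈ S, (jb k ^ s) ^ 2 * (⟪z k, ∑ l ∈ S, tker b z k l⟫).re|
      ≤ d * ENNReal.ofReal (s * 2 ^ s + 1) * (nH s (fun k => ‖z k‖ₑ) *
        (n1 β * nH s (fun k => ‖z k‖ₑ) + nH s β * n1 (fun k => ‖z k‖ₑ))) := by
  have h := energy_le_tsum hb hβ S (fun k => jb k ^ s) (fun k => (jb_rpow_pos s k).le)
    (fun k l => ENNReal.ofReal (s * 2 ^ s + 1) * (wt 1 (k - l) * wt s l + wt s (k - l) * wt 1 l))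
    (fun k l j => by
      unfold wt
      rw [← ENNReal.ofReal_mul (jb_rpow_pos _ _).le, ← ENNReal.ofReal_mul (jb_rpow_pos _ _).le,
        ← ENNReal.ofReal_add (mul_pos (jb_rpow_pos _ _) (jb_rpow_pos _ _)).le
          (mul_pos (jb_rpow_pos _ _) (jb_rpow_pos _ _)).le,
        ← ENNReal.ofReal_mul (by positivity)]
      refine ENNReal.ofReal_le_ofReal ?_
      simpa using abs_energy_kernel_le hs k l j) z
  refine h.trans ?_
  have e : ∀ k : Fin d → ℤ, (d : ℝ≥0∞) * ∑' l, ENNReal.ofReal (s * 2 ^ s + 1) *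
      (wt 1 (k - l) * wt s l + wt s (k - l) * wt 1 l) * (β (k - l) * ‖z l‖ₑ)
      = (d * ENNReal.ofReal (s * 2 ^ s + 1)) * ∑' l,
        (wt 1 (k - l) * wt s l + wt s (k - l) * wt 1 l) * (β (k - l) * ‖z l‖ₑ) := by
    intro k
    simp_rw [mul_assoc]
    rw [ENNReal.tsum_mul_left]
  simp_rw [e]
  refine (tsum_mul_le_N2 _ _).trans ?_
  rw [N2_const_mul]
  calc _ ≤ nH s (fun k => ‖z k‖ₑ) * (d * ENNReal.ofReal (s * 2 ^ s + 1) *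
        (n1 β * nH s (fun k => ‖z k‖ₑ) + nH s β * n1 (fun k => ‖z k‖ₑ))) := by
        gcongr
        · exact le_rfl
        · exact N2_kernel_le s β (fun k => ‖z k‖ₑ)
    _ = _ := by ring

/-- Energy estimate in `L²`. -/
lemma energy_L2_le {b : Fin d → (Fin d → ℤ) → E →L[ℂ] E} (hb : SymmKernel b)
    {β : (Fin d → ℤ) → ℝ≥0∞} (hβ : ∀ j m, m ≠ 0 → ‖b j m‖ₑ ≤ β m)
    (S : Finset (Fin d → ℤ)) (z : (Fin d → ℤ) → E) :
    ENNReal.ofReal |∑ k ∈ S, (⟪z k, ∑ l ∈ S, tker b z k l⟫).re|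
      ≤ d * (n1 β * N2 (fun k => ‖z k‖ₑ) ^ 2) := by
  have h := energy_le_tsum hb hβ S (fun _ => 1) (fun _ => zero_le_one)
    (fun k l => wt 1 (k - l))
    (fun k l j => by
      refine ENNReal.ofReal_le_ofReal ?_
      have := abs_coord_le_jb (k - l) j
      rw [Real.rpow_one]
      have e : (1 : ℝ) * l j - 1 * (((k j : ℝ) + l j) / 2) = -((((k - l) j : ℤ) : ℝ) / 2) := by
        push_cast [Pi.sub_apply]
        ring
      rw [e, abs_neg, abs_div, abs_two]
      linarith [abs_nonneg (((k - l) j : ℤ) : ℝ)]) z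
  simp only [one_pow, one_mul, ENNReal.ofReal_one] at h
  refine h.trans ((tsum_mul_le_N2 _ _).trans ?_)
  rw [N2_const_mul]
  have e : (fun k : Fin d → ℤ => ∑' l, wt 1 (k - l) * (β (k - l) * ‖z l‖ₑ))
      = conv (fun m => wt 1 m * β m) (fun k => ‖z k‖ₑ) := by
    ext k
    exact tsum_congr fun l => by ring
  rw [e]
  calc _ ≤ N2 (fun k => ‖z k‖ₑ) * (d * (n1 β * N2 (fun k => ‖z k‖ₑ))) := by
        gcongr
        exact N2_conv_le _ _
    _ = _ := by ring

lemma enorm_tker_le {b : Fin d → (Fin d → ℤ) → E →L[ℂ] E}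
    {β : (Fin d → ℤ) → ℝ≥0∞} (hβ : ∀ j m, ‖b j m‖ₑ ≤ β m) (u : (Fin d → ℤ) → E)
    (k l : Fin d → ℤ) : ‖tker b u k l‖ₑ ≤ d * (β (k - l) * (wt 1 l * ‖u l‖ₑ)) := by
  unfold tker
  refine (enorm_sum_le _ _).trans ?_
  calc _ ≤ ∑ _j : Fin d, β (k - l) * (wt 1 l * ‖u l‖ₑ) := by
        refine Finset.sum_le_sum fun j _ => ?_
        rw [enorm_smul]
        have h1 : ‖Complex.I * (l j : ℂ)‖ₑ ≤ wt 1 l := by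
          rw [← ofReal_norm, wt, norm_mul, Complex.norm_I, one_mul, Real.rpow_one]
          exact ENNReal.ofReal_le_ofReal (by simpa using abs_coord_le_jb l j)
        have h2 : ‖b j (k - l) (u l)‖ₑ ≤ β (k - l) * ‖u l‖ₑ := by
          refine le_trans ?_ (mul_le_mul' (hβ j (k - l)) le_rfl)
          exact ContinuousLinearMap.le_opENorm _ _
        calc _ ≤ wt 1 l * (β (k - l) * ‖u l‖ₑ) := mul_le_mul' h1 h2
          _ = _ := by ring
    _ = _ := by simp

lemma tsum_tker_le {b : Fin d → (Fin d → ℤ) → E →L[ℂ] E}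
    {β : (Fin d → ℤ) → ℝ≥0∞} (hβ : ∀ j m, ‖b j m‖ₑ ≤ β m) (u : (Fin d → ℤ) → E)
    (k : Fin d → ℤ) :
    ∑' l, ‖tker b u k l‖ₑ ≤ d * conv β (fun l => wt 1 l * ‖u l‖ₑ) k := by
  unfold conv
  rw [← ENNReal.tsum_mul_left]
  exact ENNReal.tsum_le_tsum fun l => enorm_tker_le hβ u k l

lemma summable_tker [CompleteSpace E] {b : Fin d → (Fin d → ℤ) → E →L[ℂ] E}
    {β : (Fin d → ℤ) → ℝ≥0∞} (hβ : ∀ j m, ‖b j m‖ₑ ≤ β m) (hβ' : ∑' m, β m ≠ ∞)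
    {u : (Fin d → ℤ) → E} (hu : n1 (fun k => ‖u k‖ₑ) ≠ ∞) (k : Fin d → ℤ) :
    Summable fun l => tker b u k l := by
  refine Summable.of_norm (summable_norm_of_tsum_enorm ?_)
  refine ne_top_of_le_ne_top ?_ (tsum_tker_le hβ u k)
  refine ENNReal.mul_ne_top (by simp) ?_
  have h : ∑' k, conv β (fun l => wt 1 l * ‖u l‖ₑ) k ≠ ∞ := by
    rw [tsum_conv]
    exact ENNReal.mul_ne_top hβ' hu
  exact ENNReal.ne_top_of_tsum_ne_top h k

lemma enorm_tsum_le_tsum_enorm {ι E : Type*} [SeminormedAddCommGroup E] {c : ι → E} :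
    ‖∑' k, c k‖ₑ ≤ ∑' k, ‖c k‖ₑ := by
  by_cases h : ∑' k, ‖c k‖ₑ = ∞
  · rw [h]; exact le_top
  · exact enorm_tsum_le (summable_norm_of_tsum_enorm h)

lemma enorm_top_le {b : Fin d → (Fin d → ℤ) → E →L[ℂ] E}
    {β : (Fin d → ℤ) → ℝ≥0∞} (hβ : ∀ j m, ‖b j m‖ₑ ≤ β m) (u : (Fin d → ℤ) → E)
    (k : Fin d → ℤ) :
    ‖top b u k‖ₑ ≤ d * conv β (fun l => wt 1 l * ‖u l‖ₑ) k :=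
  enorm_tsum_le_tsum_enorm.trans (tsum_tker_le hβ u k)

lemma N2_top_le {b : Fin d → (Fin d → ℤ) → E →L[ℂ] E}
    {β : (Fin d → ℤ) → ℝ≥0∞} (hβ : ∀ j m, ‖b j m‖ₑ ≤ β m) (u : (Fin d → ℤ) → E) :
    N2 (fun k => ‖top b u k‖ₑ) ≤ d * (N2 β * n1 (fun k => ‖u k‖ₑ)) := by
  refine (N2_mono fun k => enorm_top_le hβ u k).trans ?_
  rw [N2_const_mul]
  gcongr
  exact N2_conv_le' _ _

/-- The commutator of a transport operator with a Fourier multiplier whose symbol `χ` has the kernel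
bound of a Lipschitz filter: `L²` estimate with gain `ε`. -/
lemma N2_commutator_le [CompleteSpace E] {b : Fin d → (Fin d → ℤ) → E →L[ℂ] E}
    {β₀ β : (Fin d → ℤ) → ℝ≥0∞} (hβ₀ : ∀ j m, ‖b j m‖ₑ ≤ β₀ m) (hβ₀' : ∑' m, β₀ m ≠ ∞)
    (hβ : ∀ j m, m ≠ 0 → ‖b j m‖ₑ ≤ β m)
    {u : (Fin d → ℤ) → E} (hu : n1 (fun k => ‖u k‖ₑ) ≠ ∞) {χ : (Fin d → ℤ) → ℝ}
    (hχ1 : ∀ k, |χ k| ≤ 1)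
    {s ε : ℝ} (hε : 0 ≤ ε) (S : Finset (Fin d → ℤ))
    (hχ : ∀ k ∈ S, ∀ l, u l ≠ 0 → |χ k - χ l| * jb l
      ≤ ε * (jb (k - l) * jb l ^ s + jb (k - l) ^ s * jb l)) :
    N2 (fun k => if k ∈ S then ‖top b (fun l => (χ l : ℂ) • u l) k - (χ k : ℂ) • top b u k‖ₑ else 0)
      ≤ d * ENNReal.ofReal ε *
        (n1 β * nH s (fun k => ‖u k‖ₑ) + nH s β * n1 (fun k => ‖u k‖ₑ)) := by
  have hu' : n1 (fun k => ‖(χ k : ℂ) • u k‖ₑ) ≠ ∞ := by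
    refine ne_top_of_le_ne_top hu (n1_mono fun k => ?_)
    rw [enorm_smul]
    refine mul_le_of_le_one_left zero_le ?_
    rw [← ofReal_norm, Complex.norm_real]
    exact ENNReal.ofReal_le_one.2 (hχ1 k)
  have h1 : ∀ k, (if k ∈ S then
      ‖top b (fun l => (χ l : ℂ) • u l) k - (χ k : ℂ) • top b u k‖ₑ else 0)
      ≤ (d * ENNReal.ofReal ε) * ∑' l, (wt 1 (k - l) * wt s l + wt s (k - l) * wt 1 l) *
        (β (k - l) * ‖u l‖ₑ) := by
    intro k
    split_ifs with hk
    swap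
    · exact zero_le
    have e : top b (fun l => (χ l : ℂ) • u l) k - (χ k : ℂ) • top b u k
        = ∑' l, ((χ l - χ k : ℝ) : ℂ) • tker b u k l := by
      unfold top
      rw [← (summable_tker hβ₀ hβ₀' hu k).tsum_const_smul,
        ← (summable_tker hβ₀ hβ₀' hu' k).tsum_sub ((summable_tker hβ₀ hβ₀' hu k).const_smul _)]
      refine tsum_congr fun l => ?_
      have : tker b (fun l => (χ l : ℂ) • u l) k l = (χ l : ℂ) • tker b u k l := by
        unfold tker
        rw [Finset.smul_sum]
        refine Finset.sum_congr rfl fun j _ => ?_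
        rw [map_smul, smul_comm]
      rw [this, ← sub_smul]
      push_cast
      rfl
    rw [e, ← ENNReal.tsum_mul_left]
    refine enorm_tsum_le_tsum_enorm.trans (ENNReal.tsum_le_tsum fun l => ?_)
    rw [enorm_smul]
    by_cases hul : u l = 0
    · simp [tker, hul]
    by_cases hkl : k = l
    · simp [hkl]
    have h2 : ‖tker b u k l‖ₑ ≤ d * (β (k - l) * (wt 1 l * ‖u l‖ₑ)) := by
      classical
      -- only the operators `b j (k - l)` with `k ≠ l` enter
      have := enorm_tker_le (b := fun j m => if m = 0 then 0 else b j m) (β := β)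
        (fun j m => by
          split_ifs with h
          · simp
          · exact hβ j m h) u k l
      have e2 : tker (fun j m => if m = 0 then 0 else b j m) u k l = tker b u k l := by
        unfold tker
        refine Finset.sum_congr rfl fun j _ => ?_
        simp only [if_neg (sub_ne_zero.2 hkl)]
      rwa [e2] at this
    have h3 : ‖((χ l - χ k : ℝ) : ℂ)‖ₑ * wt 1 l
        ≤ ENNReal.ofReal ε * (wt 1 (k - l) * wt s l + wt s (k - l) * wt 1 l) := by
      unfold wt
      rw [← ofReal_norm, Complex.norm_real, ← ENNReal.ofReal_mul (norm_nonneg _),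
        ← ENNReal.ofReal_mul (jb_rpow_pos _ _).le, ← ENNReal.ofReal_mul (jb_rpow_pos _ _).le,
        ← ENNReal.ofReal_add (mul_pos (jb_rpow_pos _ _) (jb_rpow_pos _ _)).le
          (mul_pos (jb_rpow_pos _ _) (jb_rpow_pos _ _)).le,
        ← ENNReal.ofReal_mul hε]
      refine ENNReal.ofReal_le_ofReal ?_
      have := hχ k hk l hul
      rw [abs_sub_comm] at this
      simpa using this
    calc _ ≤ ‖((χ l - χ k : ℝ) : ℂ)‖ₑ * (d * (β (k - l) * (wt 1 l * ‖u l‖ₑ))) := by gcongr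
      _ = (‖((χ l - χ k : ℝ) : ℂ)‖ₑ * wt 1 l) * (d * (β (k - l) * ‖u l‖ₑ)) := by ring
      _ ≤ (ENNReal.ofReal ε * (wt 1 (k - l) * wt s l + wt s (k - l) * wt 1 l)) *
          (d * (β (k - l) * ‖u l‖ₑ)) := by gcongr
      _ = _ := by ring
  refine (N2_mono h1).trans ?_
  rw [N2_const_mul]
  gcongr
  exact N2_kernel_le s β (fun k => ‖u k‖ₑ)

end Abstract

/-! ### The quasilinear operator and the filters in Fourier variables -/

section Transport

variable {d n : ℕ}

local notation "⟪" x ", " y "⟫" => inner ℂ x y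

/-- The `m`-th Fourier coefficient of the matrix-valued function `x ↦ A_j(U(x))`, as an operator. -/
def bop (A : Coefficients d n) (U : Func d n) (j : Fin d) (m : Fin d → ℤ) :
    EuclideanSpace ℂ (Fin n) →L[ℂ] EuclideanSpace ℂ (Fin n) :=
  Matrix.toEuclideanCLM (n := Fin n) (𝕜 := ℂ) (Matrix.of fun i i' => fc (pe (A j i i') U) m)

lemma toEuclideanCLM_coord (M : Matrix (Fin n) (Fin n) ℂ) (v : EuclideanSpace ℂ (Fin n))
    (i : Fin n) : (Matrix.toEuclideanCLM (n := Fin n) (𝕜 := ℂ) M v) i = ∑ i', M i i' * v i' := by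
  rfl

lemma bop_apply (A : Coefficients d n) (U : Func d n) (j : Fin d) (m : Fin d → ℤ)
    (v : EuclideanSpace ℂ (Fin n)) (i : Fin n) :
    bop A U j m v i = ∑ i', fc (pe (A j i i') U) m * v i' :=
  toEuclideanCLM_coord _ _ _

lemma enorm_toEuclideanCLM_le (M : Matrix (Fin n) (Fin n) ℂ) :
    ‖Matrix.toEuclideanCLM (n := Fin n) (𝕜 := ℂ) M‖ₑ ≤ ∑ p : Fin n × Fin n, ‖M p.1 p.2‖ₑ := by
  have h : ‖Matrix.toEuclideanCLM (n := Fin n) (𝕜 := ℂ) M‖ ≤ ∑ p : Fin n × Fin n, ‖M p.1 p.2‖ := by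
    refine ContinuousLinearMap.opNorm_le_bound _ (by positivity) fun v => ?_
    refine (norm_le_sum _).trans ?_
    rw [Fintype.sum_prod_type, Finset.sum_mul]
    refine Finset.sum_le_sum fun i _ => ?_
    rw [toEuclideanCLM_coord, Finset.sum_mul]
    refine (norm_sum_le _ _).trans (Finset.sum_le_sum fun i' _ => ?_)
    rw [norm_mul]
    gcongr
    exact PiLp.norm_apply_le v i'
  simp_rw [← ofReal_norm]
  rw [← ENNReal.ofReal_sum_of_nonneg fun _ _ => norm_nonneg _]
  exact ENNReal.ofReal_le_ofReal h

/-- A majorant of the Fourier coefficients of all the entries of the `A_j(U)`. -/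
def bsum (A : Coefficients d n) (U : Func d n) (m : Fin d → ℤ) : ℝ≥0∞ :=
  ∑ p : Fin d × Fin n × Fin n, ec (pe (A p.1 p.2.1 p.2.2) U) m

/-- A majorant of the Fourier coefficients of all the entries of the `A_j(U) - A_j(0)`. -/
def bsum0 (A : Coefficients d n) (U : Func d n) (m : Fin d → ℤ) : ℝ≥0∞ :=
  ∑ p : Fin d × Fin n × Fin n, ec (pe0 (A p.1 p.2.1 p.2.2) U) m

/-- A majorant of the Fourier coefficients of all the entries of the `A_j(U) - A_j(V)`. -/
def bdiff (A : Coefficients d n) (U V : Func d n) (m : Fin d → ℤ) : ℝ≥0∞ :=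
  ∑ p : Fin d × Fin n × Fin n,
    ‖fc (pe (A p.1 p.2.1 p.2.2) U) m - fc (pe (A p.1 p.2.1 p.2.2) V) m‖ₑ

lemma sum_slice_le (F : Fin d × Fin n × Fin n → ℝ≥0∞) (j : Fin d) :
    ∑ p : Fin n × Fin n, F (j, p) ≤ ∑ p, F p := by
  rw [Fintype.sum_prod_type (f := F)]
  exact Finset.single_le_sum (f := fun j => ∑ p, F (j, p)) (fun _ _ => zero_le) (Finset.mem_univ j)

lemma enorm_bop_le (A : Coefficients d n) (U : Func d n) (j : Fin d) (m : Fin d → ℤ) :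
    ‖bop A U j m‖ₑ ≤ bsum A U m :=
  (enorm_toEuclideanCLM_le _).trans
    (sum_slice_le (fun p => ec (pe (A p.1 p.2.1 p.2.2) U) m) j)

lemma Reg.bsum_eq {U : Func d n} (hU : Reg U) (A : Coefficients d n) {m : Fin d → ℤ}
    (hm : m ≠ 0) : bsum A U m = bsum0 A U m := by
  unfold bsum bsum0 ec
  exact Finset.sum_congr rfl fun p _ => by rw [hU.fc_pe _ hm]

lemma Reg.enorm_bop_le {U : Func d n} (hU : Reg U) (A : Coefficients d n) (j : Fin d)
    (m : Fin d → ℤ) (hm : m ≠ 0) : ‖bop A U j m‖ₑ ≤ bsum0 A U m := by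
  rw [← hU.bsum_eq A hm]
  exact FourierGalerkin.enorm_bop_le A U j m

lemma enorm_bop_sub_le (A : Coefficients d n) (U V : Func d n) (j : Fin d) (m : Fin d → ℤ) :
    ‖bop A U j m - bop A V j m‖ₑ ≤ bdiff A U V m := by
  unfold bop
  rw [← map_sub]
  exact (enorm_toEuclideanCLM_le _).trans (sum_slice_le
    (fun p => ‖fc (pe (A p.1 p.2.1 p.2.2) U) m - fc (pe (A p.1 p.2.1 p.2.2) V) m‖ₑ) j)

lemma Reg.tsum_bsum_ne_top {U : Func d n} (hU : Reg U) (A : Coefficients d n) :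
    ∑' m, bsum A U m ≠ ∞ := by
  unfold bsum
  rw [Summable.tsum_finsetSum fun _ _ => ENNReal.summable]
  exact (ENNReal.sum_lt_top.2 fun p _ => (hU.isWiener_pe _).tsum_ec_ne_top.lt_top).ne

lemma symmKernel_bop (A : Coefficients d n)
    (hA : ∀ (j : Fin d) (u : Fin n → ℝ), (A.at j u).IsHermitian) (U : Func d n) :
    SymmKernel (bop A U) := by
  intro j m x y
  have hs : ∀ i i', pe (A j i i') U = pe (A j i' i) U := by
    intro i i'
    ext z
    have := (hA j (U z)).apply i i'
    simp only [Coefficients.at, Matrix.map_apply, star_trivial] at this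
    simp only [pe, this]
  have hc : ∀ i i', fc (pe (A j i i') U) m = (starRingEnd ℂ) (fc (pe (A j i i') U) (-m)) := by
    intro i i'
    have := fc_ofReal_neg (fun z => MvPolynomial.eval (U z) (A j i i')) (-m)
    rw [neg_neg] at this
    exact this
  simp only [PiLp.inner_apply, bop_apply, RCLike.inner_apply, map_sum, map_mul]
  simp_rw [Finset.sum_mul, Finset.mul_sum]
  rw [Finset.sum_comm]
  refine Finset.sum_congr rfl fun i _ => Finset.sum_congr rfl fun i' _ => ?_
  rw [hc i' i, hs i' i]
  ring

/-- Bounds for the coefficients of the system: tame estimates and Lipschitz dependence. -/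
lemma coefficient_bounds (A : Coefficients d n) {s : ℝ} (hs : 0 ≤ s) (R : ℝ≥0) :
    ∃ C : ℝ≥0, (∀ U : Func d n, Reg U → W1 U ≤ R →
        n1 (bsum0 A U) ≤ C * W1 U ∧ nH s (bsum0 A U) ≤ C * Hs s U) ∧
      ∀ U V : Func d n, Reg U → Reg V → W1 U ≤ R → W1 V ≤ R →
        N2 (bdiff A U V) ≤ C * N2 (fun k => ‖vc U k - vc V k‖ₑ) := by
  choose C₁ h₁ using fun p : Fin d × Fin n × Fin n =>
    pe0_bounds (d := d) (A p.1 p.2.1 p.2.2) hs R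
  choose C₂ h₂ using fun p : Fin d × Fin n × Fin n => pe_lipschitz (d := d) (A p.1 p.2.1 p.2.2) R
  refine ⟨∑ p, C₁ p + ∑ p, C₂ p, fun U hU hR => ⟨?_, ?_⟩, fun U V hU hV hRU hRV => ?_⟩
  · unfold bsum0
    rw [n1_sum]
    calc _ ≤ ∑ p, (C₁ p : ℝ≥0∞) * W1 U := Finset.sum_le_sum fun p _ => (h₁ p U hU hR).1
      _ = (∑ p, (C₁ p : ℝ≥0∞)) * W1 U := by rw [Finset.sum_mul]
      _ ≤ _ := by
        push_cast
        exact mul_le_mul' le_self_add le_rfl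
  · unfold bsum0
    refine (nH_sum_le _ _ _).trans ?_
    calc _ ≤ ∑ p, (C₁ p : ℝ≥0∞) * Hs s U := Finset.sum_le_sum fun p _ => (h₁ p U hU hR).2
      _ = (∑ p, (C₁ p : ℝ≥0∞)) * Hs s U := by rw [Finset.sum_mul]
      _ ≤ _ := by
        push_cast
        exact mul_le_mul' le_self_add le_rfl
  · unfold bdiff
    refine (N2_sum_le _ _).trans ?_
    calc _ ≤ ∑ p, (C₂ p : ℝ≥0∞) * N2 (fun k => ‖vc U k - vc V k‖ₑ) :=
          Finset.sum_le_sum fun p _ => h₂ p U V hU hV hRU hRV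
      _ = (∑ p, (C₂ p : ℝ≥0∞)) * N2 (fun k => ‖vc U k - vc V k‖ₑ) := by rw [Finset.sum_mul]
      _ ≤ _ := by
        push_cast
        exact mul_le_mul' le_add_self le_rfl

lemma cx_transport (A : Coefficients d n) {U : Func d n} (hU : Reg U) (i : Fin n) :
    cx (transport A U) i = fun x => ∑ p : Fin d × Fin n,
      pe (A p.1 i p.2) U x * fderiv ℝ (cx U p.2) x (Pi.single p.1 1) := by
  ext x
  simp only [cx, transport]
  rw [Finset.sum_apply, Fintype.sum_prod_type]
  push_cast
  refine Finset.sum_congr rfl fun j _ => ?_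
  simp only [Matrix.mulVec, dotProduct, Coefficients.at, Matrix.map_apply]
  push_cast
  refine Finset.sum_congr rfl fun i' _ => ?_
  rw [hU.fderiv_comp]
  rfl

lemma Reg.isWiener_transport {U : Func d n} (hU : Reg U) (A : Coefficients d n) (i : Fin n) :
    IsWiener (cx (transport A U) i) := by
  rw [cx_transport A hU]
  exact IsWiener.sum _ fun p _ => (hU.isWiener_pe _).mul
    (isWiener_fderiv (hU.wiener _) (hU.summable_jb_comp _) _)

lemma Reg.vc_transport {U : Func d n} (hU : Reg U) (A : Coefficients d n) (k : Fin d → ℤ) :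
    vc (transport A U) k = top (bop A U) (vc U) k := by
  have hsum : Summable fun l => tker (bop A U) (vc U) k l :=
    summable_tker (FourierGalerkin.enorm_bop_le A U) (hU.tsum_bsum_ne_top A) hU.W1_ne_top k
  ext i
  have h1 : (top (bop A U) (vc U) k) i = ∑' l, (tker (bop A U) (vc U) k l) i :=
    (EuclideanSpace.proj (𝕜 := ℂ) i).map_tsum hsum
  have hpw := fun p : Fin d × Fin n => (hU.isWiener_pe (A p.1 i p.2))
  have hdw := fun p : Fin d × Fin n =>
    isWiener_fderiv (hU.wiener p.2) (hU.summable_jb_comp p.2) p.1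
  rw [h1, vc_apply_eq_fc, cx_transport A hU, IsWiener.fc_sum _ fun p _ => (hpw p).mul (hdw p)]
  simp_rw [fun p => (hpw p).fc_mul (hdw p),
    fc_fderiv (hU.wiener _) (hU.summable_jb_comp _)]
  rw [← Summable.tsum_finsetSum fun p _ => ?_]
  · refine tsum_congr fun l => ?_
    unfold tker
    rw [Fintype.sum_prod_type]
    simp only [PiLp.smul_apply, WithLp.ofLp_sum, Finset.sum_apply, bop_apply, smul_eq_mul]
    refine Finset.sum_congr rfl fun j _ => ?_
    rw [Finset.mul_sum]
    refine Finset.sum_congr rfl fun i' _ => ?_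
    rw [vc_apply_eq_fc]
    ring
  · have := summable_conv (hpw p).summable (hdw p).summable k
    simp_rw [fc_fderiv (hU.wiener _) (hU.summable_jb_comp _)] at this
    exact Summable.of_norm this

end Transport

section Synthesis

variable {d n : ℕ}

/-- The real part of the function with prescribed Fourier coefficients. -/
def synth (c : (Fin d → ℤ) → EuclideanSpace ℂ (Fin n)) : Func d n :=
  fun x i => (∑' k, c k i * character k x).re

/-- The symmetry of the Fourier coefficients of real-valued functions. -/
def Hermitian (c : (Fin d → ℤ) → EuclideanSpace ℂ (Fin n)) : Prop :=
  ∀ k i, c (-k) i = (starRingEnd ℂ) (c k i)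

lemma hermitian_vc (U : Func d n) : Hermitian (vc U) := fun k i => cx_eq_conj U k i

lemma summable_comp_of_n1 {c : (Fin d → ℤ) → EuclideanSpace ℂ (Fin n)}
    (h : n1 (fun k => ‖c k‖ₑ) ≠ ∞) (i : Fin n) : Summable fun k => ‖c k i‖ := by
  refine Summable.of_nonneg_of_le (fun _ => norm_nonneg _) (fun k => PiLp.norm_apply_le (c k) i)
    (summable_norm_of_tsum_enorm (ne_top_of_le_ne_top h (tsum_le_n1 _)))

lemma cx_synth {c : (Fin d → ℤ) → EuclideanSpace ℂ (Fin n)} (hc : Hermitian c)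
    (i : Fin n) (x : Fin d → ℝ) :
    cx (synth c) i x = ∑' k, c k i * character k x := by
  have h : (starRingEnd ℂ) (∑' k, c k i * character k x) = ∑' k, c k i * character k x := by
    rw [Complex.conj_tsum, ← (Equiv.neg (Fin d → ℤ)).tsum_eq]
    refine tsum_congr fun k => ?_
    rw [map_mul, conj_character, Equiv.neg_apply, neg_neg, hc, Complex.conj_conj]
  exact Complex.conj_eq_iff_re.1 h

lemma reg_synth {c : (Fin d → ℤ) → EuclideanSpace ℂ (Fin n)} (hc : Hermitian c)
    (h : n1 (fun k => ‖c k‖ₑ) ≠ ∞) : Reg (synth c) ∧ vc (synth c) = c := by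
  have h2 : vc (synth c) = c := by
    ext k i
    exact congrFun (fc_of_series (summable_comp_of_n1 h i) (cx_synth hc i)) k
  refine ⟨⟨fun i => IsWiener.of_series (summable_comp_of_n1 h i) (cx_synth hc i), ?_⟩, h2⟩
  unfold W1 ev
  rwa [h2]

lemma Reg.ext_vc {U V : Func d n} (hU : Reg U) (hV : Reg V) (h : vc U = vc V) : U = V := by
  ext x i
  have h1 := (hU.wiener i).eq_tsum x
  have h2 := (hV.wiener i).eq_tsum x
  have h3 : fc (cx U i) = fc (cx V i) := by
    ext k
    rw [← vc_apply_eq_fc, h, vc_apply_eq_fc]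
  rw [h3, ← h2] at h1
  exact Complex.ofReal_injective h1

lemma n1_finite_ne_top {E : Type*} [NormedAddCommGroup E] {c : (Fin d → ℤ) → E}
    {S : Finset (Fin d → ℤ)} (h : ∀ k, k ∉ S → c k = 0) : n1 (fun k => ‖c k‖ₑ) ≠ ∞ := by
  unfold n1
  rw [tsum_eq_sum (s := S) fun k hk => by simp [h k hk]]
  exact (ENNReal.sum_lt_top.2 fun k _ =>
    ENNReal.mul_lt_top (wt_ne_top 1 k).lt_top (by simp [enorm_lt_top])).ne

lemma nH_finite_ne_top {E : Type*} [NormedAddCommGroup E] {c : (Fin d → ℤ) → E} (s : ℝ)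
    {S : Finset (Fin d → ℤ)} (h : ∀ k, k ∉ S → c k = 0) : nH s (fun k => ‖c k‖ₑ) ≠ ∞ := by
  unfold nH N2
  rw [tsum_eq_sum (s := S) fun k hk => by simp [h k hk]]
  refine ENNReal.rpow_ne_top_of_nonneg (by norm_num) ?_
  exact (ENNReal.sum_lt_top.2 fun k _ => ENNReal.pow_lt_top
    (ENNReal.mul_lt_top (wt_ne_top s k).lt_top (by simp [enorm_lt_top]))).ne

/-- The Fourier coefficients of `f` in the box, and zero outside. -/
def boxCoeff (N : ℕ) (f : Func d n) (k : Fin d → ℤ) : EuclideanSpace ℂ (Fin n) :=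
  if k ∈ box d N then vc f k else 0

lemma hermitian_boxCoeff (N : ℕ) (f : Func d n) : Hermitian (boxCoeff N f) := by
  intro k i
  unfold boxCoeff
  by_cases hk : k ∈ box d N
  · rw [if_pos hk, if_pos (neg_mem_box hk)]
    exact hermitian_vc f k i
  · rw [if_neg hk, if_neg (fun h => hk (neg_mem_box_iff.1 h))]
    simp

lemma sharpFilter_eq_synth (N : ℕ) (f : Func d n) : sharpFilter N f = synth (boxCoeff N f) := by
  ext x i
  unfold sharpFilter synth
  congr 1
  rw [tsum_eq_sum (s := box d N) fun k hk => by simp [boxCoeff, hk]]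
  refine Finset.sum_congr rfl fun k hk => ?_
  have hk' : k ∈ box d N := hk
  rw [boxCoeff, if_pos hk', vc_apply]

lemma boxCoeff_eq_zero {N : ℕ} {f : Func d n} {k : Fin d → ℤ} (hk : k ∉ box d N) :
    boxCoeff N f k = 0 := if_neg hk

lemma reg_sharpFilter (N : ℕ) (f : Func d n) : Reg (sharpFilter N f) := by
  rw [sharpFilter_eq_synth]
  exact (reg_synth (hermitian_boxCoeff N f) (n1_finite_ne_top fun k => boxCoeff_eq_zero)).1

lemma vc_sharpFilter (N : ℕ) (f : Func d n) : vc (sharpFilter N f) = boxCoeff N f := by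
  rw [sharpFilter_eq_synth]
  exact (reg_synth (hermitian_boxCoeff N f) (n1_finite_ne_top fun k => boxCoeff_eq_zero)).2

/-- `P` is the Fourier multiplier by the indicator function of `S`. -/
def IsFilter (P : Func d n → Func d n) (S : Set (Fin d → ℤ)) : Prop :=
  ∀ f k, vc (P f) k = S.indicator (vc f) k

lemma isFilter_id : IsFilter (id : Func d n → Func d n) Set.univ := by
  intro f k
  simp

lemma isFilter_sharpFilter (N : ℕ) :
    IsFilter (sharpFilter N : Func d n → Func d n) (box d N) := by
  classical
  intro f k
  rw [vc_sharpFilter, boxCoeff, Set.indicator_apply]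
  rfl

lemma IsFilter.enorm_le {P : Func d n → Func d n} {S : Set (Fin d → ℤ)} (h : IsFilter P S)
    (f : Func d n) (k : Fin d → ℤ) : ‖vc (P f) k‖ₑ ≤ ‖vc f k‖ₑ := by
  rw [h]
  exact enorm_indicator_le_enorm_self _ _

end Synthesis

/-! ### Rates of change of the energies -/

section Rates

variable {d n : ℕ}

local notation "⟪" x ", " y "⟫" => inner ℂ x y

/-- The squared `H^s` norm of a sequence supported in the box. -/
def En (s : ℝ) (N : ℕ) (z : (Fin d → ℤ) → EuclideanSpace ℂ (Fin n)) : ℝ :=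
  ∑ k ∈ box d N, (jb k ^ s) ^ 2 * ‖z k‖ ^ 2

lemma En_nonneg (s : ℝ) (N : ℕ) (z : (Fin d → ℤ) → EuclideanSpace ℂ (Fin n)) : 0 ≤ En s N z :=
  Finset.sum_nonneg fun _ _ => by positivity

lemma nH_sq_eq_En (s : ℝ) {N : ℕ} {z : (Fin d → ℤ) → EuclideanSpace ℂ (Fin n)}
    (hz : ∀ k, k ∉ box d N → z k = 0) :
    nH s (fun k => ‖z k‖ₑ) ^ 2 = ENNReal.ofReal (En s N z) := by
  rw [nH, N2_sq, tsum_eq_sum (s := box d N) fun k hk => by simp [hz k hk], En,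
    ENNReal.ofReal_sum_of_nonneg fun _ _ => by positivity]
  refine Finset.sum_congr rfl fun k _ => ?_
  rw [wt, ← ofReal_norm, ← ENNReal.ofReal_mul (jb_rpow_pos _ _).le,
    ← ENNReal.ofReal_pow (mul_nonneg (jb_rpow_pos _ _).le (norm_nonneg _)), mul_pow]

lemma nH_eq_sqrt_En (s : ℝ) {N : ℕ} {z : (Fin d → ℤ) → EuclideanSpace ℂ (Fin n)}
    (hz : ∀ k, k ∉ box d N → z k = 0) :
    nH s (fun k => ‖z k‖ₑ) = ENNReal.ofReal (Real.sqrt (En s N z)) := by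
  have h : nH s (fun k => ‖z k‖ₑ) ^ 2 = ENNReal.ofReal (Real.sqrt (En s N z)) ^ 2 := by
    rw [nH_sq_eq_En s hz, ← ENNReal.ofReal_pow (Real.sqrt_nonneg _), Real.sq_sqrt (En_nonneg _ _ _)]
  exact le_antisymm ((ENNReal.pow_le_pow_left_iff two_ne_zero).1 h.le)
    ((ENNReal.pow_le_pow_left_iff two_ne_zero).1 h.ge)

lemma top_eq_sum {b : Fin d → (Fin d → ℤ) → EuclideanSpace ℂ (Fin n) →L[ℂ] EuclideanSpace ℂ (Fin n)}
    {S : Finset (Fin d → ℤ)} {z : (Fin d → ℤ) → EuclideanSpace ℂ (Fin n)}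
    (hz : ∀ k, k ∉ S → z k = 0) (k : Fin d → ℤ) :
    top b z k = ∑ l ∈ S, tker b z k l := by
  unfold top
  exact tsum_eq_sum fun l hl => by simp [tker, hz l hl]

/-- The rate of change of the `H^s` energy of a Galerkin approximation: the tame estimate. -/
lemma galerkin_rate (A : Coefficients d n)
    (hA : ∀ (j : Fin d) (u : Fin n → ℝ), (A.at j u).IsHermitian) {s : ℝ} (hs : 1 ≤ s) (R : ℝ) :
    ∃ C : ℝ, 0 ≤ C ∧ ∀ (N : ℕ) (U : Func d n) (ρ : ℝ), Reg U → (∀ k, k ∉ box d N → vc U k = 0) →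
      0 ≤ ρ → ρ ≤ R → W1 U ≤ ENNReal.ofReal ρ →
      |∑ k ∈ box d N, (jb k ^ s) ^ 2 * (⟪vc U k, vc (transport A U) k⟫).re|
        ≤ C * ρ * En s N (vc U) := by
  obtain ⟨C, hC, -⟩ := coefficient_bounds A (by linarith : 0 ≤ s) R.toNNReal
  refine ⟨2 * d * (s * 2 ^ s + 1) * C, by positivity, fun N U ρ hU hsupp hρ hρR hW => ?_⟩
  have hWR : W1 U ≤ (R.toNNReal : ℝ≥0∞) := hW.trans (ENNReal.ofReal_le_ofReal hρR)
  obtain ⟨h1, h2⟩ := hC U hU hWR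
  have hE := En_nonneg s N (vc U)
  have h3 := energy_Hs_le (symmKernel_bop A hA U) (hU.enorm_bop_le A) hs (box d N) (vc U)
  simp_rw [← top_eq_sum hsupp, ← hU.vc_transport A] at h3
  rw [← ENNReal.ofReal_le_ofReal_iff (by positivity)]
  refine h3.trans ?_
  have hH : nH s (fun k => ‖vc U k‖ₑ) = Hs s U := rfl
  have hn : n1 (fun k => ‖vc U k‖ₑ) = W1 U := rfl
  have hHE : Hs s U * Hs s U = ENNReal.ofReal (En s N (vc U)) := by
    rw [← sq, ← nH_sq_eq_En s hsupp]; rfl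
  rw [hH, hn]
  calc _ ≤ d * ENNReal.ofReal (s * 2 ^ s + 1) * (Hs s U *
        (C * ENNReal.ofReal ρ * Hs s U + C * Hs s U * ENNReal.ofReal ρ)) := by
        gcongr
        exact h1.trans (by gcongr)
    _ = 2 * d * ENNReal.ofReal (s * 2 ^ s + 1) * C * ENNReal.ofReal ρ * (Hs s U * Hs s U) := by ring
    _ = _ := by
      rw [hHE, ENNReal.ofReal_mul (by positivity), ENNReal.ofReal_mul (by positivity),
        ENNReal.ofReal_mul (by positivity), ENNReal.ofReal_mul (by positivity),
        ENNReal.ofReal_mul (by norm_num)]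
      simp

lemma abs_sum_re_inner_le (S : Finset (Fin d → ℤ)) (x y : (Fin d → ℤ) → EuclideanSpace ℂ (Fin n)) :
    ENNReal.ofReal |∑ k ∈ S, (⟪x k, y k⟫).re|
      ≤ N2 (fun k => ‖x k‖ₑ) * N2 (fun k => if k ∈ S then ‖y k‖ₑ else 0) := by
  refine le_trans ?_ (tsum_mul_le_N2 _ _)
  have h : |∑ k ∈ S, (⟪x k, y k⟫).re| ≤ ∑ k ∈ S, ‖x k‖ * ‖y k‖ :=
    (Finset.abs_sum_le_sum_abs _ _).trans (Finset.sum_le_sum fun k _ =>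
      (Complex.abs_re_le_norm _).trans (norm_inner_le_norm _ _))
  refine (ENNReal.ofReal_le_ofReal h).trans ?_
  rw [ENNReal.ofReal_sum_of_nonneg fun _ _ => by positivity]
  refine le_trans (Finset.sum_le_sum fun k hk => ?_) (ENNReal.sum_le_tsum S)
  rw [if_pos hk, ENNReal.ofReal_mul (norm_nonneg _), ofReal_norm, ofReal_norm]

/-- Data of a low-pass filter with symbol `χ`, with a commutator of size `ε`, for frequencies in the
set `S`. -/
structure LowPass (s : ℝ) (N : ℕ) (S : Set (Fin d → ℤ)) (χ : (Fin d → ℤ) → ℝ) (ε : ℝ) : Prop where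
  eps_nonneg : 0 ≤ ε
  subset : (box d N : Set (Fin d → ℤ)) ⊆ S
  nonneg : ∀ k, 0 ≤ χ k
  le_one : ∀ k, χ k ≤ 1
  support : ∀ k, k ∉ box d N → χ k = 0
  kernel : ∀ k ∈ box d N, ∀ l ∈ S, |χ k - χ l| * jb l
      ≤ ε * (jb (k - l) * jb l ^ s + jb (k - l) ^ s * jb l)
  remainder : ∀ l ∈ S, 1 - χ l ≤ ε * jb l ^ s

lemma lowPass_cutoff {N : ℕ} (hN : 1 ≤ N) {s : ℝ} (hs : 0 ≤ s) {S : Set (Fin d → ℤ)}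
    (hS : (box d N : Set (Fin d → ℤ)) ⊆ S) :
    LowPass s N S (cutoff N) (4 * 4 ^ s * (N : ℝ) ^ (-s)) where
  eps_nonneg := by positivity
  subset := hS
  nonneg := cutoff_nonneg N
  le_one := cutoff_le_one N
  support k hk := cutoff_eq_zero_of_notMem_box hN hk
  kernel k _ l _ := abs_cutoff_kernel_le hN hs k l
  remainder l _ := one_sub_cutoff_le hN hs l

open Classical in
lemma lowPass_box (N : ℕ) (s : ℝ) :
    LowPass (d := d) s N (box d N) (fun k => if k ∈ box d N then 1 else 0) 0 where
  eps_nonneg := le_rfl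
  subset := le_rfl
  nonneg k := by split_ifs <;> norm_num
  le_one k := by split_ifs <;> norm_num
  support k hk := if_neg hk
  kernel k hk l hl := by
    have hl' : l ∈ box d N := hl
    simp [hk, hl']
  remainder l hl := by
    have hl' : l ∈ box d N := hl
    simp [hl']

/-- The difference between a filtered function and another one, in Fourier variables. -/
def zdiff (χ : (Fin d → ℤ) → ℝ) (U V : Func d n) (k : Fin d → ℤ) : EuclideanSpace ℂ (Fin n) :=
  (χ k : ℂ) • vc U k - vc V k

lemma LowPass.N2_remainder_le {s : ℝ} {N : ℕ} {S : Set (Fin d → ℤ)} {χ : (Fin d → ℤ) → ℝ} {ε : ℝ}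
    (h : LowPass s N S χ ε) {U : Func d n} (hU : ∀ k, k ∉ S → vc U k = 0) :
    N2 (fun k => ‖vc U k - (χ k : ℂ) • vc U k‖ₑ) ≤ ENNReal.ofReal ε * Hs s U := by
  rw [Hs, ← nH_const_mul]
  refine N2_mono fun k => ?_
  by_cases hk : k ∈ S
  · have e : vc U k - (χ k : ℂ) • vc U k = ((1 - χ k : ℝ) : ℂ) • vc U k := by
      push_cast
      rw [sub_smul, one_smul]
    rw [e, enorm_smul, ← ofReal_norm, Complex.norm_real, Real.norm_of_nonneg
      (by linarith [h.le_one k])]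
    change _ ≤ wt s k * (ENNReal.ofReal ε * ‖vc U k‖ₑ)
    unfold wt
    calc _ ≤ ENNReal.ofReal (ε * jb k ^ s) * ‖vc U k‖ₑ := by
          gcongr
          exact h.remainder k hk
      _ = _ := by rw [ENNReal.ofReal_mul h.eps_nonneg]; ring
  · simp [hU k hk]

lemma N2_sub_le_zdiff {s : ℝ} {N : ℕ} {S : Set (Fin d → ℤ)} {χ : (Fin d → ℤ) → ℝ} {ε : ℝ}
    (h : LowPass s N S χ ε) {U : Func d n} (hU : ∀ k, k ∉ S → vc U k = 0) (V : Func d n) :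
    N2 (fun k => ‖vc U k - vc V k‖ₑ)
      ≤ N2 (fun k => ‖zdiff χ U V k‖ₑ) + ENNReal.ofReal ε * Hs s U := by
  rw [add_comm]
  refine le_trans ?_ (add_le_add (h.N2_remainder_le hU) le_rfl)
  refine le_trans (N2_mono fun k => ?_) (N2_add_le _ _)
  have e : vc U k - vc V k = (vc U k - (χ k : ℂ) • vc U k) + zdiff χ U V k := by
    unfold zdiff
    abel
  rw [e]
  exact enorm_add_le _ _

/-- Collects the contributions of the transport term, of the difference of the coefficients, and of
the commutator, where `a` is the distance in `L²`. -/
lemma compare_arith {d C Cs a m ρ ε : ℝ} (hd : 0 ≤ d) (hC0 : 0 ≤ C) (hCs0 : 0 ≤ Cs) (ha : 0 ≤ a)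
    (hm : 0 ≤ m) (hρ : 0 ≤ ρ) (hε : 0 ≤ ε) :
    d * (C * ρ * a ^ 2) + (a * (d * (C * (a + ε * m) * (Cs * m)))
        + a * (d * ε * (2 * (C * (Cs + 1) * m * m))))
      ≤ 4 * (d * C * (1 + Cs)) * (m + ρ) * (a ^ 2 + (ε * m) ^ 2) := by
  have hab : a * (ε * m) ≤ a ^ 2 + (ε * m) ^ 2 := by
    nlinarith [sq_nonneg (a - ε * m), sq_nonneg (a + ε * m)]
  set q := a ^ 2 + (ε * m) ^ 2 with hq
  have hq0 : 0 ≤ q := by positivity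
  have hqa : a ^ 2 ≤ q := by rw [hq]; linarith [sq_nonneg (ε * m)]
  set K := d * C * (1 + Cs) with hK
  have hdC : 0 ≤ d * C := by positivity
  have hdCs0 : 0 ≤ d * C * Cs := by positivity
  have hK0 : 0 ≤ K := by positivity
  have hdCs : d * C ≤ K := by rw [hK]; linarith
  have hdCs2 : d * C * Cs ≤ K := by rw [hK]; linarith
  have f1 : d * (C * ρ * a ^ 2) ≤ K * ρ * q := by
    calc d * (C * ρ * a ^ 2) = (d * C) * ρ * a ^ 2 := by ring
      _ ≤ K * ρ * q := by gcongr
  have f2 : a * (d * (C * (a + ε * m) * (Cs * m))) ≤ 2 * (K * m * q) := by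
    calc a * (d * (C * (a + ε * m) * (Cs * m)))
        = (d * C * Cs) * m * (a ^ 2 + a * (ε * m)) := by ring
      _ ≤ K * m * (q + q) := by gcongr
      _ = _ := by ring
  have f3 : a * (d * ε * (2 * (C * (Cs + 1) * m * m))) ≤ 2 * (K * m * q) := by
    calc a * (d * ε * (2 * (C * (Cs + 1) * m * m)))
        = 2 * (K * m * (a * (ε * m))) := by rw [hK]; ring
      _ ≤ 2 * (K * m * q) := by gcongr
  have hKρ : 0 ≤ K * ρ * q := by positivity
  have e : 4 * K * (m + ρ) * q = 2 * (K * m * q) + 2 * (K * m * q) + 4 * (K * ρ * q) := by ring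
  rw [e]
  linarith

set_option maxHeartbeats 800000 in
/-- The rate of change of the `L²` distance between a filtered solution and a Galerkin
approximation. The sharp projection is only tested against a function that it leaves invariant, so
that no derivative is lost. -/
lemma compare_rate (A : Coefficients d n)
    (hA : ∀ (j : Fin d) (u : Fin n → ℝ), (A.at j u).IsHermitian) {s : ℝ}
    (hs : (d : ℝ) / 2 + 1 < s) (R : ℝ) :
    ∃ C : ℝ, 0 ≤ C ∧ ∀ (N : ℕ) (S : Set (Fin d → ℤ)) (χ : (Fin d → ℤ) → ℝ) (ε : ℝ),
      LowPass s N S χ ε → ∀ (U V : Func d n) (m ρ : ℝ), Reg U → Reg V →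
      (∀ k, k ∉ S → vc U k = 0) → (∀ k, k ∉ box d N → vc V k = 0) →
      0 ≤ m → m ≤ R → 0 ≤ ρ → ρ ≤ R → Hs s U ≤ ENNReal.ofReal m → W1 V ≤ ENNReal.ofReal ρ →
      |∑ k ∈ box d N, (⟪zdiff χ U V k,
          -((χ k : ℂ) • vc (transport A U) k) + vc (transport A V) k⟫).re|
        ≤ C * (m + ρ) * (En 0 N (zdiff χ U V) + (ε * m) ^ 2) := by
  have hs0 : 0 ≤ s := by
    have : (0 : ℝ) ≤ d := by positivity
    linarith
  obtain ⟨Cs, hCs⟩ := n1_le_nH hs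
  obtain ⟨C, hC, hL⟩ := coefficient_bounds A hs0 (Cs * R.toNNReal + R.toNNReal)
  refine ⟨4 * (d * C * (1 + Cs)), by positivity, ?_⟩
  intro N S χ ε h U V m ρ hU hV hUS hVN hm hmR hρ hρR hHs hW
  have hWU' : W1 U ≤ Cs * ENNReal.ofReal m := (hCs _).trans (mul_le_mul' le_rfl hHs)
  have hWU : W1 U ≤ ((Cs * R.toNNReal + R.toNNReal : ℝ≥0) : ℝ≥0∞) := by
    refine hWU'.trans ?_
    push_cast
    exact le_trans (mul_le_mul' le_rfl (ENNReal.ofReal_le_ofReal hmR)) le_self_add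
  have hWV : W1 V ≤ ((Cs * R.toNNReal + R.toNNReal : ℝ≥0) : ℝ≥0∞) := by
    refine hW.trans ?_
    push_cast
    exact le_trans (ENNReal.ofReal_le_ofReal hρR) le_add_self
  obtain ⟨hU1, hU2⟩ := hC U hU hWU
  obtain ⟨hV1, -⟩ := hC V hV hWV
  set z := zdiff χ U V with hz
  have hzN : ∀ k, k ∉ box d N → z k = 0 := by
    intro k hk
    simp [hz, zdiff, h.support k hk, hVN k hk]
  set a : ℝ := Real.sqrt (En 0 N z) with ha
  have ha0 : 0 ≤ a := Real.sqrt_nonneg _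
  have hzE : N2 (fun k => ‖z k‖ₑ) = ENNReal.ofReal a := by
    rw [← nH_eq_sqrt_En 0 hzN, nH_zero_eq]
  set χu : (Fin d → ℤ) → EuclideanSpace ℂ (Fin n) := fun l => (χ l : ℂ) • vc U l with hχu
  have habs : ∀ k, |χ k| ≤ 1 := fun k => by rw [abs_of_nonneg (h.nonneg k)]; exact h.le_one k
  have hχle : n1 (fun k => ‖χu k‖ₑ) ≤ W1 U := by
    refine n1_mono fun k => ?_
    rw [hχu, enorm_smul]
    refine mul_le_of_le_one_left zero_le ?_
    rw [← ofReal_norm, Complex.norm_real]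
    exact ENNReal.ofReal_le_one.2 (habs k)
  have hχfin : n1 (fun k => ‖χu k‖ₑ) ≠ ∞ := ne_top_of_le_ne_top hU.W1_ne_top hχle
  -- decomposition of the time derivative
  set t2 : (Fin d → ℤ) → EuclideanSpace ℂ (Fin n) :=
    fun k => top (fun j m => bop A V j m - bop A U j m) χu k with ht2
  set t3 : (Fin d → ℤ) → EuclideanSpace ℂ (Fin n) :=
    fun k => top (bop A U) χu k - (χ k : ℂ) • top (bop A U) (vc U) k with ht3
  have hsV := fun (u : (Fin d → ℤ) → EuclideanSpace ℂ (Fin n)) (hu : n1 (fun k => ‖u k‖ₑ) ≠ ∞) k =>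
    summable_tker (enorm_bop_le A V) (hV.tsum_bsum_ne_top A) hu k
  have hsU := fun (u : (Fin d → ℤ) → EuclideanSpace ℂ (Fin n)) (hu : n1 (fun k => ‖u k‖ₑ) ≠ ∞) k =>
    summable_tker (enorm_bop_le A U) (hU.tsum_bsum_ne_top A) hu k
  have hdec : ∀ k, -((χ k : ℂ) • vc (transport A U) k) + vc (transport A V) k
      = -(∑ l ∈ box d N, tker (bop A V) z k l) + (t2 k + t3 k) := by
    intro k
    rw [hU.vc_transport, hV.vc_transport, ← top_eq_sum hzN]
    have e1 : top (bop A V) z k = top (bop A V) χu k - top (bop A V) (vc V) k := by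
      unfold top
      rw [← (hsV χu hχfin k).tsum_sub (hsV (vc V) hV.W1_ne_top k)]
      refine tsum_congr fun l => ?_
      unfold tker
      rw [← Finset.sum_sub_distrib]
      refine Finset.sum_congr rfl fun j _ => ?_
      rw [← smul_sub, ← map_sub]
      rfl
    have e2 : t2 k = top (bop A V) χu k - top (bop A U) χu k := by
      rw [ht2]
      unfold top
      rw [← (hsV χu hχfin k).tsum_sub (hsU χu hχfin k)]
      refine tsum_congr fun l => ?_
      unfold tker
      rw [← Finset.sum_sub_distrib]
      refine Finset.sum_congr rfl fun j _ => ?_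
      rw [← smul_sub]
      rfl
    have e3 : t3 k = top (bop A U) χu k - (χ k : ℂ) • top (bop A U) (vc U) k := rfl
    rw [e1, e2, e3]
    abel
  have hsplit : (∑ k ∈ box d N, (⟪z k,
      -((χ k : ℂ) • vc (transport A U) k) + vc (transport A V) k⟫).re)
      = -(∑ k ∈ box d N, (⟪z k, ∑ l ∈ box d N, tker (bop A V) z k l⟫).re)
        + ((∑ k ∈ box d N, (⟪z k, t2 k⟫).re) + ∑ k ∈ box d N, (⟪z k, t3 k⟫).re) := by
    rw [← Finset.sum_add_distrib, ← Finset.sum_neg_distrib, ← Finset.sum_add_distrib]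
    refine Finset.sum_congr rfl fun k _ => ?_
    rw [hdec, inner_add_right, inner_add_right, inner_neg_right]
    simp only [Complex.add_re, Complex.neg_re]
  have hε := h.eps_nonneg
  -- the transport term
  have b1 : |∑ k ∈ box d N, (⟪z k, ∑ l ∈ box d N, tker (bop A V) z k l⟫).re|
      ≤ d * (C * ρ * a ^ 2) := by
    rw [← ENNReal.ofReal_le_ofReal_iff (by positivity)]
    refine (energy_L2_le (symmKernel_bop A hA V) (hV.enorm_bop_le A) (box d N) z).trans ?_
    rw [hzE]
    calc _ ≤ (d : ℝ≥0∞) * (C * ENNReal.ofReal ρ * ENNReal.ofReal a ^ 2) := by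
          gcongr
          exact hV1.trans (by gcongr)
      _ = _ := by
        rw [ENNReal.ofReal_mul (by positivity), ENNReal.ofReal_mul (by positivity),
          ENNReal.ofReal_mul (by positivity), ENNReal.ofReal_pow ha0]
        simp
  -- the difference of the coefficients
  have b2 : |∑ k ∈ box d N, (⟪z k, t2 k⟫).re| ≤ a * (d * (C * (a + ε * m) * (Cs * m))) := by
    rw [← ENNReal.ofReal_le_ofReal_iff (by positivity)]
    refine (abs_sum_re_inner_le _ z t2).trans ?_
    rw [hzE]
    have e1 : N2 (fun k => if k ∈ box d N then ‖t2 k‖ₑ else 0) ≤ N2 (fun k => ‖t2 k‖ₑ) :=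
      N2_mono fun k => by split_ifs <;> simp
    have e2 : N2 (fun k => ‖vc V k - vc U k‖ₑ) ≤ ENNReal.ofReal (a + ε * m) := by
      have : N2 (fun k => ‖vc V k - vc U k‖ₑ) = N2 (fun k => ‖vc U k - vc V k‖ₑ) := by
        congr 1
        ext k
        rw [← enorm_neg, neg_sub]
      rw [this]
      refine (N2_sub_le_zdiff h hUS V).trans ?_
      rw [ENNReal.ofReal_add ha0 (by positivity), ENNReal.ofReal_mul hε, ← hzE]
      gcongr
    calc _ ≤ ENNReal.ofReal a * (d * (N2 (bdiff A V U) * n1 (fun k => ‖χu k‖ₑ))) := by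
          gcongr
          exact e1.trans (N2_top_le (enorm_bop_sub_le A V U) χu)
      _ ≤ ENNReal.ofReal a * (d * (C * ENNReal.ofReal (a + ε * m) * (Cs * ENNReal.ofReal m))) := by
          gcongr
          · exact (hL V U hV hU hWV hWU).trans (by gcongr)
          · exact hχle.trans hWU'
      _ = _ := by
        rw [ENNReal.ofReal_mul ha0, ENNReal.ofReal_mul (by positivity),
          ENNReal.ofReal_mul (by positivity), ENNReal.ofReal_mul (by positivity),
          ENNReal.ofReal_mul (by positivity)]
        simp
  -- the commutator with the filter
  have b3 : |∑ k ∈ box d N, (⟪z k, t3 k⟫).re| ≤ a * (d * ε * (2 * (C * (Cs + 1) * m * m))) := by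
    rw [← ENNReal.ofReal_le_ofReal_iff (by positivity)]
    refine (abs_sum_re_inner_le _ z t3).trans ?_
    rw [hzE]
    calc _ ≤ ENNReal.ofReal a * (d * ENNReal.ofReal ε *
          (n1 (bsum0 A U) * Hs s U + nH s (bsum0 A U) * W1 U)) := by
          gcongr
          exact N2_commutator_le (enorm_bop_le A U) (hU.tsum_bsum_ne_top A) (hU.enorm_bop_le A)
            hU.W1_ne_top habs hε (box d N) fun k hk l hl => h.kernel k hk l (by
              by_contra hlS
              exact hl (hUS l hlS))
      _ ≤ ENNReal.ofReal a * (d * ENNReal.ofReal ε *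
          (C * (Cs * ENNReal.ofReal m) * ENNReal.ofReal m
            + C * ENNReal.ofReal m * (Cs * ENNReal.ofReal m))) := by
          gcongr
          · exact hU1.trans (by gcongr)
          · exact hU2.trans (by gcongr)
      _ ≤ ENNReal.ofReal a * (d * ENNReal.ofReal ε *
          (2 * (C * (Cs + 1) * ENNReal.ofReal m * ENNReal.ofReal m))) := by
          gcongr
          calc (C * (Cs * ENNReal.ofReal m) * ENNReal.ofReal m
            + C * ENNReal.ofReal m * (Cs * ENNReal.ofReal m))
              = 2 * (C * Cs * ENNReal.ofReal m * ENNReal.ofReal m) := by ring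
            _ ≤ _ := by
              gcongr
              exact le_self_add
      _ = _ := by
        rw [ENNReal.ofReal_mul ha0, ENNReal.ofReal_mul (by positivity),
          ENNReal.ofReal_mul (by positivity), ENNReal.ofReal_mul (by positivity),
          ENNReal.ofReal_mul (by positivity), ENNReal.ofReal_mul (by positivity),
          ENNReal.ofReal_mul (by positivity), ENNReal.ofReal_add (by positivity) (by positivity)]
        simp
  rw [hsplit]
  have haE : a ^ 2 = En 0 N z := Real.sq_sqrt (En_nonneg _ _ _)
  rw [← haE]
  refine le_trans ?_ (compare_arith (d.cast_nonneg) C.2 Cs.2 ha0 hm hρ hε)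
  refine (abs_add_le _ _).trans (add_le_add ?_ ((abs_add_le _ _).trans (add_le_add b2 b3)))
  rw [abs_neg]
  exact b1

end Rates

/-! ### Evolution of the Fourier coefficients -/

section Gronwall

lemma abs_gronwall_of_nonneg {f f' : ℝ → ℝ} {κ t : ℝ} (ht : 0 ≤ t)
    (h : ∀ τ ∈ Set.Icc 0 t, HasDerivAt f (f' τ) τ) (hb : ∀ τ ∈ Set.Icc 0 t, |f' τ| ≤ κ * f τ) :
    f t ≤ f 0 * Real.exp (κ * t) := by
  have hd : ∀ τ ∈ Set.Icc 0 t, HasDerivAt (fun σ => f σ * Real.exp (-(κ * σ)))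
      (f' τ * Real.exp (-(κ * τ)) + f τ * (Real.exp (-(κ * τ)) * -(κ * 1))) τ := by
    intro τ hτ
    exact (h τ hτ).mul (((hasDerivAt_id τ).const_mul κ).neg.exp)
  have hanti : AntitoneOn (fun σ => f σ * Real.exp (-(κ * σ))) (Set.Icc 0 t) := by
    refine antitoneOn_of_deriv_nonpos (convex_Icc _ _)
      (fun τ hτ => (hd τ hτ).continuousAt.continuousWithinAt)
      (fun τ hτ => (hd τ (interior_subset hτ)).differentiableAt.differentiableWithinAt)
      (fun τ hτ => ?_)
    rw [(hd τ (interior_subset hτ)).deriv]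
    have h1 := (abs_le.1 (hb τ (interior_subset hτ))).2
    have h2 := Real.exp_pos (-(κ * τ))
    nlinarith
  have h1 := hanti (Set.left_mem_Icc.2 ht) (Set.right_mem_Icc.2 ht) ht
  simp only [mul_zero, neg_zero, Real.exp_zero, mul_one] at h1
  calc f t = f t * Real.exp (-(κ * t)) * Real.exp (κ * t) := by
        rw [mul_assoc, ← Real.exp_add, neg_add_cancel, Real.exp_zero, mul_one]
    _ ≤ _ := by gcongr

/-- Gronwall's inequality in both time directions. -/
lemma abs_gronwall {f f' : ℝ → ℝ} {κ t : ℝ}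
    (h : ∀ τ ∈ Set.uIcc 0 t, HasDerivAt f (f' τ) τ) (hb : ∀ τ ∈ Set.uIcc 0 t, |f' τ| ≤ κ * f τ) :
    f t ≤ f 0 * Real.exp (κ * |t|) := by
  rcases le_total 0 t with ht | ht
  · rw [Set.uIcc_of_le ht] at h hb
    rw [abs_of_nonneg ht]
    exact abs_gronwall_of_nonneg ht h hb
  · rw [Set.uIcc_of_ge ht] at h hb
    have hm : ∀ τ ∈ Set.Icc 0 (-t), -τ ∈ Set.Icc t 0 := fun τ hτ => by
      constructor <;> linarith [hτ.1, hτ.2]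
    have h1 := abs_gronwall_of_nonneg (f := fun σ => f (-σ)) (f' := fun σ => -f' (-σ)) (κ := κ)
      (t := -t) (by linarith) (fun τ hτ => ?_) (fun τ hτ => ?_)
    · rw [abs_of_nonpos ht]
      simpa using h1
    · have := (h (-τ) (hm τ hτ)).comp τ (hasDerivAt_neg τ)
      rw [mul_neg_one] at this
      exact this
    · rw [abs_neg]
      exact hb _ (hm τ hτ)

end Gronwall

section ModeFlow

variable {d n : ℕ}

lemma hasDerivAt_norm_sq_of {f : ℝ → EuclideanSpace ℂ (Fin n)} {f' : EuclideanSpace ℂ (Fin n)}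
    {t : ℝ} (h : HasDerivAt f f' t) :
    HasDerivAt (fun τ => ‖f τ‖ ^ 2) (2 * (inner ℂ (f t) f').re) t := by
  have h1 := Complex.reCLM.hasFDerivAt.comp_hasDerivAt t (h.inner ℂ h)
  have h2 : (inner ℂ f' (f t)).re = (inner ℂ (f t) f').re := by
    rw [← inner_conj_symm, Complex.conj_re]
  refine (h1.congr_deriv ?_).congr_of_eventuallyEq (Filter.Eventually.of_forall fun τ => ?_)
  · simp only [Complex.reCLM_apply, Complex.add_re, h2]
    ring
  · exact norm_sq_eq_re_inner (𝕜 := ℂ) (f τ)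

/-- The evolution `∂_t U + P (∑_j A_j(U) ∂_{x_j} U) = 0` in Fourier variables, for times in `J`,
where `P` is the multiplier by the indicator function of `S` and `U` has frequencies in `S`. -/
structure ModeFlow (A : Coefficients d n) (S : Set (Fin d → ℤ)) (J : Set ℝ) (U : ℝ → Func d n) :
    Prop where
  reg : ∀ t ∈ J, Reg (U t)
  supp : ∀ t ∈ J, ∀ k, k ∉ S → vc (U t) k = 0
  deriv : ∀ t ∈ J, ∀ k ∈ S, HasDerivAt (fun τ => vc (U τ) k) (-vc (transport A (U t)) k) t

lemma ModeFlow.mono {A : Coefficients d n} {S : Set (Fin d → ℤ)} {J J' : Set ℝ} {U : ℝ → Func d n}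
    (h : ModeFlow A S J U) (hJ : J' ⊆ J) : ModeFlow A S J' U :=
  ⟨fun t ht => h.reg t (hJ ht), fun t ht => h.supp t (hJ ht), fun t ht => h.deriv t (hJ ht)⟩

lemma ModeFlow.shift {A : Coefficients d n} {S : Set (Fin d → ℤ)} {J : Set ℝ} {U : ℝ → Func d n}
    (h : ModeFlow A S J U) (t₀ : ℝ) :
    ModeFlow A S ((fun t => t + t₀) ⁻¹' J) (fun t => U (t + t₀)) :=
  ⟨fun _ ht => h.reg _ ht, fun _ ht => h.supp _ ht, fun _ ht k hk =>
    (h.deriv _ ht k hk).comp_add_const _ t₀⟩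

lemma ModeFlow.congr {A : Coefficients d n} {S : Set (Fin d → ℤ)} {J : Set ℝ} {U V : ℝ → Func d n}
    (h : ModeFlow A S J U) (hJ : IsOpen J) (he : Set.EqOn V U J) : ModeFlow A S J V := by
  refine ⟨fun t ht => ?_, fun t ht => ?_, fun t ht k hk => ?_⟩
  · rw [he ht]
    exact h.reg t ht
  · rw [he ht]
    exact h.supp t ht
  · rw [he ht]
    refine (h.deriv t ht k hk).congr_of_eventuallyEq ?_
    filter_upwards [hJ.mem_nhds ht] with τ hτ
    rw [he hτ]

/-- A priori bound for the Galerkin approximations: the `H^s` norm grows at most at a rate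
proportional to the Wiener norm `W1`. -/
lemma exists_energy_bound (A : Coefficients d n)
    (hA : ∀ (j : Fin d) (u : Fin n → ℝ), (A.at j u).IsHermitian) {s : ℝ} (hs : 1 ≤ s) (R : ℝ) :
    ∃ C : ℝ, 0 ≤ C ∧ ∀ (N : ℕ) (U : ℝ → Func d n) (t ρ a : ℝ),
      ModeFlow A (box d N) (Set.uIcc 0 t) U → 0 ≤ ρ → ρ ≤ R → 0 ≤ a →
      (∀ τ ∈ Set.uIcc 0 t, W1 (U τ) ≤ ENNReal.ofReal ρ) → Hs s (U 0) ≤ ENNReal.ofReal a →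
      Hs s (U t) ≤ ENNReal.ofReal (a * Real.exp (C * ρ * |t|)) := by
  obtain ⟨C, hC0, hC⟩ := galerkin_rate A hA hs R
  refine ⟨C, hC0, fun N U t ρ a hU hρ hρR ha hW h0 => ?_⟩
  have hd : ∀ τ ∈ Set.uIcc 0 t, HasDerivAt (fun τ => En s N (vc (U τ)))
      (∑ k ∈ box d N, (jb k ^ s) ^ 2 * (2 * (inner ℂ (vc (U τ) k)
        (-vc (transport A (U τ)) k)).re)) τ := fun τ hτ =>
    HasDerivAt.fun_sum fun k hk => (hasDerivAt_norm_sq_of (hU.deriv τ hτ k hk)).const_mul _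
  have hE := abs_gronwall (κ := 2 * (C * ρ)) hd fun τ hτ => by
    have h1 := hC N (U τ) ρ (hU.reg τ hτ) (hU.supp τ hτ) hρ hρR (hW τ hτ)
    have h2 : (∑ k ∈ box d N, (jb k ^ s) ^ 2 * (2 * (inner ℂ (vc (U τ) k)
        (-vc (transport A (U τ)) k)).re))
        = -2 * ∑ k ∈ box d N, (jb k ^ s) ^ 2 * (inner ℂ (vc (U τ) k)
          (vc (transport A (U τ)) k)).re := by
      rw [Finset.mul_sum]
      refine Finset.sum_congr rfl fun k _ => ?_
      rw [inner_neg_right, Complex.neg_re]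
      ring
    rw [h2, abs_mul, abs_neg, abs_two]
    linarith
  have h00 : (0 : ℝ) ∈ Set.uIcc 0 t := Set.left_mem_uIcc
  have htt : t ∈ Set.uIcc 0 t := Set.right_mem_uIcc
  have e : ∀ τ ∈ Set.uIcc 0 t, Hs s (U τ) = ENNReal.ofReal (Real.sqrt (En s N (vc (U τ)))) :=
    fun τ hτ => nH_eq_sqrt_En s (hU.supp τ hτ)
  rw [e 0 h00, ENNReal.ofReal_le_ofReal_iff ha, Real.sqrt_le_left ha] at h0
  rw [e t htt]
  refine ENNReal.ofReal_le_ofReal (Real.sqrt_le_iff.2 ⟨by positivity, hE.trans ?_⟩)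
  have e2 : Real.exp (2 * (C * ρ) * |t|) = Real.exp (C * ρ * |t|) ^ 2 := by
    rw [← Real.exp_nat_mul]
    congr 1
    push_cast
    ring
  rw [mul_pow, e2]
  gcongr

/-- Stability: the `L²` distance between a solution and a Galerkin approximation with the same
initial low frequencies. -/
lemma exists_compare_bound (A : Coefficients d n)
    (hA : ∀ (j : Fin d) (u : Fin n → ℝ), (A.at j u).IsHermitian) {s : ℝ}
    (hs : (d : ℝ) / 2 + 1 < s) (R : ℝ) :
    ∃ C : ℝ, 0 ≤ C ∧ ∀ (N : ℕ) (S : Set (Fin d → ℤ)) (χ : (Fin d → ℤ) → ℝ) (ε : ℝ),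
      LowPass s N S χ ε → ∀ (U V : ℝ → Func d n) (t m ρ : ℝ),
      ModeFlow A S (Set.uIcc 0 t) U → ModeFlow A (box d N) (Set.uIcc 0 t) V →
      0 ≤ m → m ≤ R → 0 ≤ ρ → ρ ≤ R →
      (∀ τ ∈ Set.uIcc 0 t, Hs s (U τ) ≤ ENNReal.ofReal m) →
      (∀ τ ∈ Set.uIcc 0 t, W1 (V τ) ≤ ENNReal.ofReal ρ) →
      (∀ k ∈ box d N, vc (V 0) k = vc (U 0) k) →
      N2 (fun k => ‖vc (U t) k - vc (V t) k‖ₑ)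
        ≤ ENNReal.ofReal (3 * ε * m * Real.exp (C * (m + ρ) * |t|)) := by
  obtain ⟨C, hC0, hC⟩ := compare_rate A hA hs R
  refine ⟨C, hC0, fun N S χ ε h U V t m ρ hU hV hm hmR hρ hρR hHs hW h0 => ?_⟩
  have hε := h.eps_nonneg
  have h00 : (0 : ℝ) ∈ Set.uIcc 0 t := Set.left_mem_uIcc
  have htt : t ∈ Set.uIcc 0 t := Set.right_mem_uIcc
  have hz : ∀ τ ∈ Set.uIcc 0 t, ∀ k, k ∉ box d N → zdiff χ (U τ) (V τ) k = 0 := by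
    intro τ hτ k hk
    simp [zdiff, h.support k hk, hV.supp τ hτ k hk]
  have hdz : ∀ τ ∈ Set.uIcc 0 t, ∀ k ∈ box d N, HasDerivAt (fun τ => zdiff χ (U τ) (V τ) k)
      (-((χ k : ℂ) • vc (transport A (U τ)) k) + vc (transport A (V τ)) k) τ := by
    intro τ hτ k hk
    have := ((hU.deriv τ hτ k (h.subset hk)).const_smul (χ k : ℂ)).sub (hV.deriv τ hτ k hk)
    rw [smul_neg, sub_neg_eq_add] at this
    exact this
  set q := (ε * m) ^ 2 with hq
  have hd : ∀ τ ∈ Set.uIcc 0 t, HasDerivAt (fun τ => En 0 N (zdiff χ (U τ) (V τ)) + q)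
      (∑ k ∈ box d N, (jb k ^ (0 : ℝ)) ^ 2 * (2 * (inner ℂ (zdiff χ (U τ) (V τ) k)
        (-((χ k : ℂ) • vc (transport A (U τ)) k) + vc (transport A (V τ)) k)).re)) τ :=
    fun τ hτ => (HasDerivAt.fun_sum fun k hk =>
      (hasDerivAt_norm_sq_of (hdz τ hτ k hk)).const_mul _).add_const q
  have hE := abs_gronwall (κ := 2 * (C * (m + ρ))) hd fun τ hτ => by
    have h1 := hC N S χ ε h (U τ) (V τ) m ρ (hU.reg τ hτ) (hV.reg τ hτ) (hU.supp τ hτ)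
      (hV.supp τ hτ) hm hmR hρ hρR (hHs τ hτ) (hW τ hτ)
    simp only [Real.rpow_zero, one_pow, one_mul]
    rw [← Finset.mul_sum, abs_mul, abs_two]
    linarith
  have hE0 : En 0 N (zdiff χ (U 0) (V 0)) ≤ q := by
    have e1 : nH 0 (fun k => ‖zdiff χ (U 0) (V 0) k‖ₑ)
        ≤ N2 (fun k => ‖vc (U 0) k - (χ k : ℂ) • vc (U 0) k‖ₑ) := by
      rw [nH_zero_eq]
      refine N2_mono fun k => ?_
      by_cases hk : k ∈ box d N
      · rw [zdiff, h0 k hk, ← enorm_neg, neg_sub]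
      · simp [hz 0 h00 k hk]
    rw [nH_eq_sqrt_En 0 (hz 0 h00)] at e1
    have e2 := e1.trans ((h.N2_remainder_le (hU.supp 0 h00)).trans
      (mul_le_mul' le_rfl (hHs 0 h00)))
    rw [← ENNReal.ofReal_mul hε, ENNReal.ofReal_le_ofReal_iff (by positivity),
      Real.sqrt_le_left (by positivity)] at e2
    exact e2
  refine (N2_sub_le_zdiff h (hU.supp t htt) (V t)).trans ?_
  rw [← nH_zero_eq, nH_eq_sqrt_En 0 (hz t htt)]
  set X := Real.exp (C * (m + ρ) * |t|) with hX
  have hX1 : 1 ≤ X := Real.one_le_exp (by positivity)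
  have hXX : Real.exp (2 * (C * (m + ρ)) * |t|) = X ^ 2 := by
    rw [hX, ← Real.exp_nat_mul]
    congr 1
    push_cast
    ring
  rw [hXX] at hE
  have hsq : Real.sqrt (En 0 N (zdiff χ (U t) (V t))) ≤ 2 * (ε * m) * X := by
    refine Real.sqrt_le_iff.2 ⟨by positivity, ?_⟩
    have hq0 : 0 ≤ q := by positivity
    have : (En 0 N (zdiff χ (U 0) (V 0)) + q) * X ^ 2 ≤ (q + q) * X ^ 2 := by gcongr
    have h4 : (2 * (ε * m) * X) ^ 2 = 4 * q * X ^ 2 := by rw [hq]; ring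
    have h5 : 0 ≤ q * X ^ 2 := by positivity
    rw [h4]
    linarith
  calc _ ≤ ENNReal.ofReal (2 * (ε * m) * X) + ENNReal.ofReal ε * ENNReal.ofReal m := by
        gcongr
        exact hHs t htt
    _ = ENNReal.ofReal (2 * (ε * m) * X + ε * m) := by
        rw [← ENNReal.ofReal_mul hε, ← ENNReal.ofReal_add (by positivity) (by positivity)]
    _ ≤ _ := by
        refine ENNReal.ofReal_le_ofReal ?_
        have : ε * m * 1 ≤ ε * m * X := by gcongr
        linarith

lemma N2_le_tsum {ι : Type*} (x : ι → ℝ≥0∞) : N2 x ≤ ∑' k, x k := by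
  rw [N2_le_iff, sq, ← ENNReal.tsum_mul_right]
  refine ENNReal.tsum_le_tsum fun k => ?_
  rw [sq]
  gcongr
  exact ENNReal.le_tsum k

/-- The sum of the moduli of the entries of the constant matrices `A_j(0)`. -/
def constBound (A : Coefficients d n) : ℝ≥0 :=
  ∑ p : Fin d × Fin n × Fin n, ‖((MvPolynomial.eval 0 (A p.1 p.2.1 p.2.2) : ℝ) : ℂ)‖₊

lemma Reg.tsum_bsum_le {U : Func d n} (hU : Reg U) (A : Coefficients d n) :
    ∑' m, bsum A U m ≤ n1 (bsum0 A U) + constBound A := by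
  unfold bsum bsum0 constBound
  rw [Summable.tsum_finsetSum fun _ _ => ENNReal.summable, n1_sum]
  push_cast
  rw [← Finset.sum_add_distrib]
  exact Finset.sum_le_sum fun p _ => hU.tsum_ec_pe_le _

/-- Lipschitz dependence of the quasilinear operator on its argument, with a loss of derivative. -/
lemma exists_transport_sub_le (A : Coefficients d n) (R : ℝ≥0) :
    ∃ C : ℝ≥0, ∀ U V : Func d n, Reg U → Reg V → W1 U ≤ R → W1 V ≤ R →
      N2 (fun k => ‖vc (transport A U) k - vc (transport A V) k‖ₑ)
        ≤ C * (N2 (fun k => ‖vc U k - vc V k‖ₑ) + n1 (fun k => ‖vc U k - vc V k‖ₑ)) := by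
  obtain ⟨C, hC, hL⟩ := coefficient_bounds A (le_refl (0 : ℝ)) R
  refine ⟨d * (C * R + constBound A), fun U V hU hV hRU hRV => ?_⟩
  set u := fun k => vc U k - vc V k with hu
  have hn : n1 (fun k => ‖u k‖ₑ) ≠ ∞ := by
    have h1 : n1 (fun k => ‖u k‖ₑ) ≤ n1 (fun k => ev U k + ev V k) :=
      n1_mono fun k => enorm_sub_le
    rw [n1_add] at h1
    exact ne_top_of_le_ne_top (ENNReal.add_ne_top.2 ⟨hU.W1_ne_top, hV.W1_ne_top⟩) h1
  have hs : ∀ (w : (Fin d → ℤ) → EuclideanSpace ℂ (Fin n)), n1 (fun k => ‖w k‖ₑ) ≠ ∞ → ∀ k,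
      Summable fun l => tker (bop A U) w k l := fun w hw k =>
    summable_tker (enorm_bop_le A U) (hU.tsum_bsum_ne_top A) hw k
  have hsV : ∀ k, Summable fun l => tker (bop A V) (vc V) k l := fun k =>
    summable_tker (enorm_bop_le A V) (hV.tsum_bsum_ne_top A) hV.W1_ne_top k
  have hdec : ∀ k, vc (transport A U) k - vc (transport A V) k
      = top (bop A U) u k + top (fun j m => bop A U j m - bop A V j m) (vc V) k := by
    intro k
    rw [hU.vc_transport, hV.vc_transport]
    unfold top
    rw [← (hs (vc U) hU.W1_ne_top k).tsum_sub (hsV k)]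
    have e2 : (fun l => tker (fun j m => bop A U j m - bop A V j m) (vc V) k l)
        = fun l => tker (bop A U) (vc V) k l - tker (bop A V) (vc V) k l := by
      ext1 l
      unfold tker
      rw [← Finset.sum_sub_distrib]
      exact Finset.sum_congr rfl fun j _ => by rw [← smul_sub]; rfl
    have hs2 : Summable fun l => tker (fun j m => bop A U j m - bop A V j m) (vc V) k l := by
      rw [e2]
      exact (hs (vc V) hV.W1_ne_top k).sub (hsV k)
    rw [← (hs u hn k).tsum_add hs2]
    refine tsum_congr fun l => ?_
    rw [congrFun e2 l]
    unfold tker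
    rw [← Finset.sum_sub_distrib, ← Finset.sum_sub_distrib, ← Finset.sum_add_distrib]
    refine Finset.sum_congr rfl fun j _ => ?_
    rw [hu, map_sub, smul_sub]
    abel
  have b1 : N2 (fun k => ‖top (bop A U) u k‖ₑ)
      ≤ d * ((C * R + constBound A) * n1 (fun k => ‖u k‖ₑ)) := by
    refine (N2_mono fun k => enorm_top_le (enorm_bop_le A U) u k).trans ?_
    rw [N2_const_mul]
    gcongr
    refine (N2_conv_le _ _).trans ?_
    gcongr
    · refine (hU.tsum_bsum_le A).trans ?_
      gcongr
      exact (hC U hU hRU).1.trans (by gcongr)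
    · exact N2_le_tsum _
  have b2 : N2 (fun k => ‖top (fun j m => bop A U j m - bop A V j m) (vc V) k‖ₑ)
      ≤ d * (C * N2 (fun k => ‖u k‖ₑ) * R) := by
    refine (N2_top_le (enorm_bop_sub_le A U V) (vc V)).trans ?_
    gcongr
    · exact hL U V hU hV hRU hRV
    · exact hRV
  calc _ ≤ N2 (fun k => ‖top (bop A U) u k‖ₑ)
        + N2 (fun k => ‖top (fun j m => bop A U j m - bop A V j m) (vc V) k‖ₑ) := by
        refine (N2_mono fun k => ?_).trans (N2_add_le _ _)
        rw [hdec]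
        exact enorm_add_le _ _
    _ ≤ d * ((C * R + constBound A) * n1 (fun k => ‖u k‖ₑ))
        + d * (C * N2 (fun k => ‖u k‖ₑ) * R) := add_le_add b1 b2
    _ ≤ d * ((C * R + constBound A) * n1 (fun k => ‖u k‖ₑ))
        + d * ((C * R + constBound A) * N2 (fun k => ‖u k‖ₑ)) := by
        refine add_le_add le_rfl (mul_le_mul' le_rfl ?_)
        calc C * N2 (fun k => ‖u k‖ₑ) * R = C * R * N2 (fun k => ‖u k‖ₑ) := by ring
          _ ≤ _ := mul_le_mul' le_self_add le_rfl
    _ = _ := by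
        push_cast
        ring

end ModeFlow

/-! ### Classical solutions in Fourier variables -/

section Bounds

variable {d n : ℕ}

lemma hsNorm_eq_toReal (s : ℝ) (U : Func d n) : hsNorm s U = (Hs s U).toReal := by
  by_cases h : Summable (hsTerm s U)
  · rw [Hs_eq_ofReal h, ENNReal.toReal_ofReal (hsNorm_nonneg s U)]
  · have h1 : Hs s U = ∞ := by
      by_contra h2
      exact h (Hs_ne_top_iff.1 h2)
    rw [h1, hsNorm, tsum_eq_zero_of_not_summable h]
    simp

lemma MemHs.sub {s : ℝ} {U V : Func d n} (hU : MemHs s U) (hV : MemHs s V) : MemHs s (U - V) := by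
  refine ⟨fun j x => ?_, hU.2.1.sub hV.2.1, Hs_ne_top_iff.1 ?_⟩
  · rw [Pi.sub_apply, Pi.sub_apply, hU.1, hV.1]
  · have h : Hs s (U - V) ≤ Hs s U + Hs s V := by
      refine (nH_mono fun k => ?_).trans (nH_add_le s (ev U) (ev V))
      rw [ev, vc_sub_of_integrableOn hU.integrableOn hV.integrableOn]
      exact enorm_sub_le
    exact ne_top_of_le_ne_top (ENNReal.add_ne_top.2 ⟨hU.Hs_ne_top, hV.Hs_ne_top⟩) h

lemma Hs_le_add_sub {s : ℝ} {U V : Func d n} (hU : ∀ i, IntegrableOn (cx U i) (cell d))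
    (hV : ∀ i, IntegrableOn (cx V i) (cell d)) : Hs s U ≤ Hs s (U - V) + Hs s V := by
  refine (nH_mono fun k => ?_).trans (nH_add_le s (ev (U - V)) (ev V))
  rw [ev, ev, vc_sub_of_integrableOn hU hV]
  calc ‖vc U k‖ₑ = ‖(vc U k - vc V k) + vc V k‖ₑ := by rw [sub_add_cancel]
    _ ≤ _ := enorm_add_le _ _

/-- The quasilinear operator loses one derivative. -/
lemma exists_nH_transport_le (A : Coefficients d n) {s : ℝ} (hs : (d : ℝ) / 2 + 1 < s) (m : ℝ≥0) :
    ∃ K : ℝ≥0, ∀ U : Func d n, Reg U → Hs s U ≤ m →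
      nH (s - 1) (fun k => ‖vc (transport A U) k‖ₑ) ≤ K := by
  have hd : (0 : ℝ) ≤ d := by positivity
  obtain ⟨Cs, hCs⟩ := n1_le_nH (d := d) hs
  obtain ⟨C, hC, -⟩ := coefficient_bounds A (by linarith : 0 ≤ s) (Cs * m)
  set B : ℝ≥0 := C * (Cs * m) + constBound A with hB
  refine ⟨d * ((2 ^ (s - 1) : ℝ).toNNReal * ((C * m + B) * (Cs * m) + B * m)), fun U hU hm => ?_⟩
  have hW : W1 U ≤ ((Cs * m : ℝ≥0) : ℝ≥0∞) := by
    push_cast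
    exact (hCs _).trans (mul_le_mul' le_rfl hm)
  obtain ⟨h1, h2⟩ := hC U hU hW
  have hsum : ∑' l, bsum A U l ≤ B := by
    refine (hU.tsum_bsum_le A).trans ?_
    rw [hB]
    push_cast
    gcongr
    refine h1.trans ?_
    gcongr
    exact_mod_cast hW
  have hsplit : ∀ k, bsum A U k ≤ bsum0 A U k + B * (if k = 0 then 1 else 0) := by
    intro k
    by_cases hk : k = 0
    · rw [if_pos hk, mul_one]
      exact le_add_left ((ENNReal.le_tsum k).trans hsum)
    · rw [if_neg hk, mul_zero, add_zero, hU.bsum_eq A hk]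
  have hdelta : nH (s - 1) (fun k : Fin d → ℤ => if k = 0 then (1 : ℝ≥0∞) else 0) ≤ 1 := by
    rw [nH, N2_le_iff, tsum_eq_single 0 fun k hk => by simp [hk]]
    simp [wt, jb]
  have hb : nH (s - 1) (bsum A U) ≤ C * m + B := by
    refine (nH_mono hsplit).trans ((nH_add_le _ _ _).trans (add_le_add ?_ ?_))
    · exact (nH_mono_exp (by linarith) _).trans (h2.trans (by gcongr))
    · rw [nH_const_mul]
      exact mul_le_of_le_one_right zero_le hdelta
  have hu : nH (s - 1) (fun l => wt 1 l * ‖vc U l‖ₑ) ≤ m := by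
    refine le_trans (le_of_eq ?_) hm
    unfold Hs nH
    congr 1
    ext k
    rw [← mul_assoc, ← wt_add, sub_add_cancel]
    rfl
  have ht : ∀ k, ‖vc (transport A U) k‖ₑ
      ≤ d * conv (bsum A U) (fun l => wt 1 l * ‖vc U l‖ₑ) k := fun k => by
    rw [hU.vc_transport]
    exact enorm_top_le (enorm_bop_le A U) (vc U) k
  refine (nH_mono ht).trans ?_
  rw [nH_const_mul]
  push_cast
  gcongr
  refine (nH_conv_le (by linarith) _ _).trans ?_
  have e : ENNReal.ofReal (2 ^ (s - 1)) = (((2 : ℝ) ^ (s - 1)).toNNReal : ℝ≥0∞) := rfl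
  rw [e]
  gcongr
  exact_mod_cast hW

/-- The tails of a sequence in `ℓ¹` are small, uniformly on balls of the weighted `ℓ²` space. -/
lemma tendsto_tail_weight {r : ℝ} (hr : (d : ℝ) / 2 < r) :
    Filter.Tendsto (fun F : Finset (Fin d → ℤ) =>
      N2 (fun k => if k ∈ F then 0 else wt (-r) k)) Filter.atTop (𝓝 0) := by
  have hsum : ∑' k : Fin d → ℤ, wt (-r) k ^ 2 ≠ ∞ := by
    have h := (summable_jb_rpow (d := d) (r := 2 * r) (by linarith)).tsum_ofReal_ne_top
    convert h using 3 with k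
    rw [wt, ← ENNReal.ofReal_pow (jb_rpow_pos _ _).le, ← Real.rpow_natCast,
      ← Real.rpow_mul (jb_nonneg k)]
    congr 2
    push_cast
    ring
  have h1 := ENNReal.tendsto_tsum_compl_atTop_zero hsum
  have h2 := ((ENNReal.continuous_rpow_const (y := (1 / 2 : ℝ))).tendsto 0).comp h1
  rw [ENNReal.zero_rpow_of_pos (by norm_num)] at h2
  refine h2.congr fun F => ?_
  simp only [Function.comp, N2]
  congr 1
  have h3 := tsum_subtype ((F : Set (Fin d → ℤ))ᶜ) (fun k : Fin d → ℤ => wt (-r) k ^ 2)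
  refine h3.trans (tsum_congr fun k => ?_)
  by_cases hk : k ∈ F <;> simp [hk]

lemma tail_le (r : ℝ) (x : (Fin d → ℤ) → ℝ≥0∞) (F : Finset (Fin d → ℤ)) :
    ∑' k, (if k ∈ F then 0 else x k) ≤ N2 (fun k => if k ∈ F then 0 else wt (-r) k) * nH r x := by
  refine le_trans (ENNReal.tsum_le_tsum fun k => ?_) (tsum_mul_le_N2 _ _)
  split_ifs
  · simp
  · rw [← mul_assoc, ← wt_add]
    simp

end Bounds

section Solutions

variable {d n : ℕ}

/-- `P` is the Fourier multiplier by the indicator function of `S`, and it preserves the regularity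
classes in use. -/
structure Multiplier (P : Func d n → Func d n) (S : Set (Fin d → ℤ)) : Prop where
  isFilter : IsFilter P S
  wiener : ∀ f, (∀ i, IsWiener (cx f i)) → ∀ i, IsWiener (cx (P f) i)
  memHs : ∀ s f, MemHs s f → MemHs s (P f)

lemma multiplier_id : Multiplier (id : Func d n → Func d n) Set.univ :=
  ⟨isFilter_id, fun _ h => h, fun _ _ h => h⟩

lemma multiplier_sharpFilter (N : ℕ) :
    Multiplier (sharpFilter N : Func d n → Func d n) (box d N) := by
  refine ⟨isFilter_sharpFilter N, fun f _ => (reg_sharpFilter N f).wiener, fun s f hf => ?_⟩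
  exact (reg_sharpFilter N f).memHs (ne_top_of_le_ne_top hf.Hs_ne_top
    (nH_mono ((isFilter_sharpFilter N).enorm_le f)))

/-- A classical solution on the open interval `J`, described by its Fourier coefficients. -/
structure Flow (A : Coefficients d n) (S : Set (Fin d → ℤ)) (s : ℝ) (J : Set ℝ)
    (U : ℝ → Func d n) : Prop extends ModeFlow A S J U where
  isOpen : IsOpen J
  ordConnected : J.OrdConnected
  zero_mem : (0 : ℝ) ∈ J
  Hs_ne_top : ∀ t ∈ J, Hs s (U t) ≠ ∞
  cont : ∀ t₀ ∈ J, Filter.Tendsto (fun t => Hs s (U t - U t₀)) (𝓝 t₀) (𝓝 0)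

lemma Flow.eventually_le {A : Coefficients d n} {S : Set (Fin d → ℤ)} {s : ℝ} {J : Set ℝ}
    {U : ℝ → Func d n} (h : Flow A S s J U) {t : ℝ} (ht : t ∈ J) :
    ∃ m : ℝ≥0, ∀ᶠ τ in 𝓝 t, τ ∈ J ∧ Hs s (U τ) ≤ m := by
  refine ⟨1 + (Hs s (U t)).toNNReal, ?_⟩
  filter_upwards [h.isOpen.mem_nhds ht, (h.cont t ht).eventually_le_const zero_lt_one] with τ h1 h2
  refine ⟨h1, (Hs_le_add_sub (h.reg τ h1).integrableOn (h.reg t ht).integrableOn).trans ?_⟩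
  push_cast
  rw [ENNReal.coe_toNNReal (h.Hs_ne_top t ht)]
  gcongr

lemma exists_tsum_transport_le (A : Coefficients d n) {s : ℝ} (hs : (d : ℝ) / 2 + 1 < s) (m : ℝ≥0) :
    ∃ K : ℝ≥0, ∀ U : Func d n, Reg U → Hs s U ≤ m →
      ∑' k, ‖vc (transport A U) k‖ₑ ≤ K := by
  obtain ⟨K, hK⟩ := exists_nH_transport_le A hs m
  obtain ⟨C, hC⟩ := tsum_le_nH (d := d) (r := s - 1) (by linarith)
  refine ⟨C * K, fun U hU hm => (hC _).trans ?_⟩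
  push_cast
  gcongr
  exact hK U hU hm

lemma norm_apply_le_of_tsum {f : Func d n} (h : ∀ i, IsWiener (cx f i)) {K : ℝ≥0}
    (hK : ∑' k, ‖vc f k‖ₑ ≤ K) (i : Fin n) (x : Fin d → ℝ) : ‖cx f i x‖ ≤ K := by
  have h1 : ‖cx f i x‖ₑ ≤ (K : ℝ≥0∞) := ((h i).norm_le x).trans
    ((ENNReal.tsum_le_tsum fun k => ec_cx_le f i k).trans hK)
  rw [← ofReal_norm] at h1
  exact_mod_cast (ENNReal.ofReal_le_iff_le_toReal ENNReal.coe_ne_top).1 h1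

lemma IsClassicalSolution.reg {P : Func d n → Func d n} {A : Coefficients d n} {s : ℝ}
    {U₀ : Func d n} {J : Set ℝ} {U : ℝ → Func d n} (hs : (d : ℝ) / 2 + 1 < s)
    (h : IsClassicalSolution P A s U₀ J U) {t : ℝ} (ht : t ∈ J) : Reg (U t) := by
  obtain ⟨C, hC⟩ := n1_le_nH (d := d) hs
  refine Reg.of_continuous (h.contDiff t ht).continuous (h.memHs t ht).1 ?_
  exact ne_top_of_le_ne_top (ENNReal.mul_ne_top ENNReal.coe_ne_top (h.memHs t ht).Hs_ne_top) (hC _)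

lemma IsClassicalSolution.tendsto_Hs {P : Func d n → Func d n} {A : Coefficients d n} {s : ℝ}
    {U₀ : Func d n} {J : Set ℝ} {U : ℝ → Func d n}
    (h : IsClassicalSolution P A s U₀ J U) {t₀ : ℝ} (ht₀ : t₀ ∈ J) :
    Filter.Tendsto (fun t => Hs s (U t - U t₀)) (𝓝 t₀) (𝓝 0) := by
  have h1 := h.continuous_hs t₀ ht₀
  rw [h.isOpen.nhdsWithin_eq ht₀] at h1
  have h2 := ENNReal.tendsto_ofReal h1
  rw [ENNReal.ofReal_zero] at h2
  refine h2.congr' ?_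
  filter_upwards [h.isOpen.mem_nhds ht₀] with t ht
  rw [((h.memHs t ht).sub (h.memHs t₀ ht₀)).Hs_eq]

/-- Differentiation under the integral sign in the Fourier coefficients of a classical solution. -/
lemma IsClassicalSolution.hasDerivAt_vc {P : Func d n → Func d n} {S : Set (Fin d → ℤ)}
    (hP : Multiplier P S) {A : Coefficients d n} {s : ℝ} {U₀ : Func d n} {J : Set ℝ}
    {U : ℝ → Func d n} (hs : (d : ℝ) / 2 + 1 < s) (h : IsClassicalSolution P A s U₀ J U) {t : ℝ}
    (ht : t ∈ J) (k : Fin d → ℤ) :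
    HasDerivAt (fun τ => vc (U τ) k) (-vc (P (transport A (U t))) k) t := by
  have hW : ∀ τ ∈ J, ∀ i, IsWiener (cx (P (transport A (U τ))) i) := fun τ hτ =>
    hP.wiener _ ((h.reg hs hτ).isWiener_transport A)
  obtain ⟨K, hK⟩ := exists_tsum_transport_le A hs (1 + (Hs s (U t)).toNNReal)
  set N : Set ℝ := {τ | τ ∈ J ∧ Hs s (U τ - U t) ≤ 1} with hN
  have hNt : N ∈ 𝓝 t := by
    filter_upwards [h.isOpen.mem_nhds ht, (h.tendsto_Hs ht).eventually_le_const zero_lt_one]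
      with τ h1 h2 using ⟨h1, h2⟩
  have hbound : ∀ τ ∈ N, ∀ i x, ‖cx (P (transport A (U τ))) i x‖ ≤ K := by
    intro τ hτ i x
    refine norm_apply_le_of_tsum (hW τ hτ.1) ?_ i x
    refine (ENNReal.tsum_le_tsum fun k => hP.isFilter.enorm_le _ k).trans
      (hK (U τ) (h.reg hs hτ.1) ?_)
    refine (Hs_le_add_sub (h.reg hs hτ.1).integrableOn (h.reg hs ht).integrableOn).trans ?_
    push_cast
    rw [ENNReal.coe_toNNReal (h.memHs t ht).Hs_ne_top]
    gcongr
    exact hτ.2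
  have hcoord : ∀ i, HasDerivAt (fun τ => fc (cx (U τ) i) k)
      (-fc (cx (P (transport A (U t))) i) k) t := by
    intro i
    have hmain := hasDerivAt_integral_of_dominated_loc_of_deriv_le
      (μ := volume.restrict (cell d)) (𝕜 := ℝ) (E := ℂ) (bound := fun _ => (K : ℝ))
      (F := fun τ x => cx (U τ) i x * character (-k) x)
      (F' := fun τ x => -cx (P (transport A (U τ))) i x * character (-k) x) hNt ?_ ?_ ?_ ?_ ?_ ?_
    · have h2 := hmain.2.const_mul ((((2 * Real.pi) ^ d)⁻¹ : ℝ) : ℂ)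
      refine h2.congr_deriv ?_
      unfold fc
      simp_rw [neg_mul, integral_neg]
      ring
    · filter_upwards [h.isOpen.mem_nhds ht] with τ hτ
      exact (((h.reg hs hτ).wiener i).continuous.mul
        (continuous_character _)).aestronglyMeasurable
    · exact (((h.reg hs ht).wiener i).continuous.mul (continuous_character _)).integrableOn_cell
    · exact (((hW t ht i).continuous.neg).mul (continuous_character _)).aestronglyMeasurable
    · refine Filter.Eventually.of_forall fun x τ hτ => ?_
      rw [norm_mul, norm_neg, norm_character, mul_one]
      exact hbound τ hτ i x
    · exact integrable_const _
    · refine Filter.Eventually.of_forall fun x τ hτ => ?_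
      have h1 := (hasDerivAt_pi.1 (h.equation τ hτ.1 x)) i
      have h2 := (h1.ofReal_comp).mul_const (character (-k) x)
      refine h2.congr_deriv ?_
      simp [cx]
  have hpi := hasDerivAt_pi.2 hcoord
  exact ((PiLp.continuousLinearEquiv 2 ℝ (fun _ : Fin n => ℂ)).symm.toContinuousLinearMap
    |>.hasFDerivAt.comp_hasDerivAt t hpi)

lemma IsClassicalSolution.flow {P : Func d n → Func d n} {S : Set (Fin d → ℤ)}
    (hP : Multiplier P S) {A : Coefficients d n} {s : ℝ} {U₀ : Func d n} {J : Set ℝ}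
    {U : ℝ → Func d n} (hs : (d : ℝ) / 2 + 1 < s) (h : IsClassicalSolution P A s U₀ J U) :
    Flow A S s J U ∧ vc (U 0) = S.indicator (vc U₀) := by
  have h0 : vc (U 0) = S.indicator (vc U₀) := by
    ext1 k
    rw [← hP.isFilter]
    ext i
    rw [vc_apply_eq_fc, vc_apply_eq_fc]
    refine fc_congr_ae ?_ k
    filter_upwards [h.initial] with x hx
    simp only [cx, hx]
  refine ⟨⟨⟨fun t ht => h.reg hs ht, fun t ht k hk => ?_, fun t ht k hk => ?_⟩, h.isOpen,
    h.ordConnected, h.zero_mem, fun t ht => (h.memHs t ht).Hs_ne_top, fun t ht => h.tendsto_Hs ht⟩,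
    h0⟩
  · have hd : ∀ τ ∈ J, HasDerivAt (fun τ => vc (U τ) k) 0 τ := fun τ hτ => by
      have := h.hasDerivAt_vc hP hs hτ k
      rwa [hP.isFilter, Set.indicator_of_notMem hk, neg_zero] at this
    have h1 := h.isOpen.is_const_of_deriv_eq_zero h.ordConnected.isPreconnected
      (fun τ hτ => (hd τ hτ).differentiableAt.differentiableWithinAt)
      (fun τ hτ => (hd τ hτ).deriv) ht h.zero_mem
    rw [h1, h0, Set.indicator_of_notMem hk]
  · have := h.hasDerivAt_vc hP hs ht k
    rwa [hP.isFilter, Set.indicator_of_mem hk] at this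

lemma MemHs.memLp_cx {s : ℝ} {U : Func d n} (h : MemHs s U) (i : Fin n) :
    MemLp (cx U i) 2 (volume.restrict (cell d)) := (h.2.1.eval i).ofReal

lemma ae_eq_of_vc {s : ℝ} {U V : Func d n} (hU : MemHs s U) (hV : MemHs s V) (h : vc U = vc V) :
    U =ᵐ[volume] V := by
  have h1 : ∀ i, (fun x => cx U i x - cx V i x) =ᵐ[volume] 0 := by
    intro i
    refine ae_eq_zero_of_fc ((hU.memLp_cx i).sub (hV.memLp_cx i)) ?_ fun k => ?_
    · intro j x
      simp only [cx, hU.1 j x, hV.1 j x]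
    · rw [FourierGalerkin.fc_sub (hU.integrableOn i) (hV.integrableOn i), ← vc_apply_eq_fc, h,
        ← vc_apply_eq_fc, sub_self]
  filter_upwards [ae_all_iff.2 h1] with x hx
  ext i
  have := hx i
  simp only [cx, Pi.zero_apply] at this
  exact_mod_cast sub_eq_zero.1 this

/-- The equation holds pointwise in space: the Fourier series of the time derivative converges
uniformly in space, and locally uniformly in time, since `∑_j A_j(U) ∂_j U` is locally bounded in
`H^{s-1}` and `s - 1 > d/2`. -/
lemma Flow.hasDerivAt_apply {P : Func d n → Func d n} {S : Set (Fin d → ℤ)}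
    (hP : Multiplier P S) {A : Coefficients d n} {s : ℝ} {J : Set ℝ}
    {U : ℝ → Func d n} (hs : (d : ℝ) / 2 + 1 < s) (h : Flow A S s J U) {t : ℝ} (ht : t ∈ J)
    (x : Fin d → ℝ) : HasDerivAt (fun τ => U τ x) (-(P (transport A (U t)) x)) t := by
  classical
  obtain ⟨m, hm⟩ := h.eventually_le ht
  obtain ⟨N, hNs, hNo, htN⟩ := eventually_nhds_iff.1 hm
  obtain ⟨K, hK⟩ := exists_nH_transport_le A hs m
  have hW : ∀ τ ∈ N, ∀ i, IsWiener (cx (P (transport A (U τ))) i) := fun τ hτ =>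
    hP.wiener _ ((h.reg τ (hNs τ hτ).1).isWiener_transport A)
  refine hasDerivAt_pi.2 fun i => ?_
  have hmain : HasDerivAt (fun τ => cx (U τ) i x) (-cx (P (transport A (U t))) i x) t := by
    refine hasDerivAt_of_tendstoLocallyUniformlyOn (l := Filter.atTop)
      (f := fun (F : Finset (Fin d → ℤ)) τ => ∑ k ∈ F, fc (cx (U τ) i) k * character k x)
      (f' := fun (F : Finset (Fin d → ℤ)) τ =>
        ∑ k ∈ F, -fc (cx (P (transport A (U τ))) i) k * character k x)
      (g' := fun τ => -cx (P (transport A (U τ))) i x) hNo ?_ ?_ ?_ htN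
    · refine TendstoUniformlyOn.tendstoLocallyUniformlyOn ?_
      rw [EMetric.tendstoUniformlyOn_iff]
      intro ε hε
      have htail := (ENNReal.Tendsto.mul_const (b := (K : ℝ≥0∞))
        (tendsto_tail_weight (d := d) (r := s - 1) (by linarith)) (Or.inr ENNReal.coe_ne_top))
      rw [zero_mul] at htail
      filter_upwards [htail.eventually_lt_const hε] with F hF τ hτ
      refine lt_of_le_of_lt ?_ hF
      have hsum := (hW τ hτ i).summable
      have e : -cx (P (transport A (U τ))) i x
          - ∑ k ∈ F, -fc (cx (P (transport A (U τ))) i) k * character k x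
          = -∑' k, (if k ∈ F then 0 else fc (cx (P (transport A (U τ))) i) k * character k x) := by
        have h1 := (summable_mul_character hsum x)
        rw [(hW τ hτ i).eq_tsum x]
        have h2 : ∑ k ∈ F, fc (cx (P (transport A (U τ))) i) k * character k x
            = ∑' k, (if k ∈ F then fc (cx (P (transport A (U τ))) i) k * character k x else 0) := by
          rw [tsum_eq_sum (s := F) fun k hk => if_neg hk]
          exact Finset.sum_congr rfl fun k hk => (if_pos hk).symm
        have h3 : Summable fun k =>
            (if k ∈ F then fc (cx (P (transport A (U τ))) i) k * character k x else 0) :=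
          summable_of_hasFiniteSupport (F.finite_toSet.subset fun k hk => by
            by_contra hkF
            exact hk (if_neg hkF))
        simp_rw [neg_mul, Finset.sum_neg_distrib]
        rw [sub_neg_eq_add, h2, neg_add_eq_sub, ← neg_sub, ← h1.tsum_sub h3]
        congr 2
        ext k
        split_ifs <;> simp
      rw [edist_eq_enorm_sub, e, enorm_neg]
      refine enorm_tsum_le_tsum_enorm.trans ?_
      refine le_trans (ENNReal.tsum_le_tsum fun k => ?_) ((tail_le (s - 1)
        (fun k => ‖vc (transport A (U τ)) k‖ₑ) F).trans (mul_le_mul' le_rfl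
          (hK _ (h.reg τ (hNs τ hτ).1) (hNs τ hτ).2)))
      split_ifs
      · simp
      · rw [enorm_mul]
        have : ‖character k x‖ₑ = 1 := by rw [← ofReal_norm, norm_character]; simp
        rw [this, mul_one]
        exact (ec_cx_le _ i k).trans (hP.isFilter.enorm_le _ k)
    · refine Filter.Eventually.of_forall fun F τ hτ => HasDerivAt.fun_sum fun k _ => ?_
      refine HasDerivAt.mul_const ?_ _
      have hk : HasDerivAt (fun τ => vc (U τ) k) (-vc (P (transport A (U τ))) k) τ := by
        rw [hP.isFilter]
        by_cases hkS : k ∈ S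
        · rw [Set.indicator_of_mem hkS]
          exact h.deriv τ (hNs τ hτ).1 k hkS
        · rw [Set.indicator_of_notMem hkS, neg_zero]
          refine (hasDerivAt_const τ (0 : EuclideanSpace ℂ (Fin n))).congr_of_eventuallyEq ?_
          filter_upwards [hNo.mem_nhds hτ] with σ hσ
          exact h.supp σ (hNs σ hσ).1 k hkS
      exact ((EuclideanSpace.proj (𝕜 := ℂ) i).restrictScalars ℝ).hasFDerivAt.comp_hasDerivAt τ hk
    · intro τ hτ
      have hw := (h.reg τ (hNs τ hτ).1).wiener i
      rw [hw.eq_tsum x]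
      exact (summable_mul_character hw.summable x).hasSum
  have h2 := Complex.reCLM.hasFDerivAt.comp_hasDerivAt t hmain
  refine h2.congr_deriv ?_
  simp [cx]

lemma Flow.isClassicalSolution {P : Func d n → Func d n} {S : Set (Fin d → ℤ)}
    (hP : Multiplier P S) {A : Coefficients d n} {s : ℝ} {J : Set ℝ} {U₀ : Func d n}
    {U : ℝ → Func d n} (hs : (d : ℝ) / 2 + 1 < s) (h : Flow A S s J U) (hU₀ : MemHs s U₀)
    (h0 : vc (U 0) = S.indicator (vc U₀)) : IsClassicalSolution P A s U₀ J U where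
  isOpen := h.isOpen
  ordConnected := h.ordConnected
  zero_mem := h.zero_mem
  memHs t ht := (h.reg t ht).memHs (h.Hs_ne_top t ht)
  continuous_hs t₀ ht₀ := by
    have h1 := (ENNReal.tendsto_toReal ENNReal.zero_ne_top).comp (h.cont t₀ ht₀)
    refine (h1.mono_left nhdsWithin_le_nhds).congr fun t => ?_
    exact (hsNorm_eq_toReal _ _).symm
  contDiff t ht := (h.reg t ht).contDiff
  equation t ht x := h.hasDerivAt_apply hP hs ht x
  initial := by
    refine ae_eq_of_vc ((h.reg 0 h.zero_mem).memHs (h.Hs_ne_top 0 h.zero_mem))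
      (hP.memHs s U₀ hU₀) ?_
    rw [h0]
    ext1 k
    rw [hP.isFilter]

end Solutions

/-! ### Maximal solutions -/

section Maximal

variable {d n : ℕ} {A : Coefficients d n} {S : Set (Fin d → ℤ)} {s : ℝ}

lemma Flow.shift {J : Set ℝ} {U : ℝ → Func d n} (h : Flow A S s J U) {t₀ : ℝ} (ht₀ : t₀ ∈ J) :
    Flow A S s ((fun t => t + t₀) ⁻¹' J) (fun t => U (t + t₀)) where
  toModeFlow := h.toModeFlow.shift t₀
  isOpen := h.isOpen.preimage (continuous_add_const t₀)
  ordConnected := h.ordConnected.preimage_mono fun _ _ hab => by simpa using hab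
  zero_mem := by simpa using ht₀
  Hs_ne_top t ht := h.Hs_ne_top _ ht
  cont t ht := (h.cont _ ht).comp ((continuous_add_const t₀).tendsto t)

lemma Flow.congr {J : Set ℝ} {U V : ℝ → Func d n} (h : Flow A S s J U) (he : Set.EqOn V U J) :
    Flow A S s J V where
  toModeFlow := h.toModeFlow.congr h.isOpen he
  isOpen := h.isOpen
  ordConnected := h.ordConnected
  zero_mem := h.zero_mem
  Hs_ne_top t ht := by
    rw [he ht]
    exact h.Hs_ne_top t ht
  cont t ht := by
    rw [he ht]
    refine (h.cont t ht).congr' ?_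
    filter_upwards [h.isOpen.mem_nhds ht] with τ hτ
    rw [he hτ]

variable (A S s) in
/-- Two solutions with the same initial value agree. -/
def UniqueFlow : Prop :=
  ∀ (J J' : Set ℝ) (U U' : ℝ → Func d n), Flow A S s J U → Flow A S s J' U' → U 0 = U' 0 →
    Set.EqOn U U' (J ∩ J')

variable (A S s) in
/-- The solution `U` on `J` with initial value `u` extends all others. -/
structure IsMaxFlow (u : Func d n) (J : Set ℝ) (U : ℝ → Func d n) : Prop where
  flow : Flow A S s J U
  init : U 0 = u
  max : ∀ J' U', Flow A S s J' U' → U' 0 = u → J' ⊆ J ∧ Set.EqOn U' U J'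

/-- The maximal solution lives on the union of the intervals of all solutions. -/
lemma exists_isMaxFlow (hu : UniqueFlow A S s) {u : Func d n}
    (hex : ∃ J U, Flow A S s J U ∧ U 0 = u) : ∃ J U, IsMaxFlow A S s u J U := by
  classical
  set J : Set ℝ := {t | ∃ J' U', Flow A S s J' U' ∧ U' 0 = u ∧ t ∈ J'} with hJ
  choose! J' U' hF h0 hm using fun t (ht : t ∈ J) => ht
  have hJ₁ : ∀ J₁ U₁, Flow A S s J₁ U₁ → U₁ 0 = u → J₁ ⊆ J := fun J₁ U₁ h1 h2 t ht =>
    ⟨J₁, U₁, h1, h2, ht⟩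
  set U : ℝ → Func d n := fun t => U' t t with hU
  have heq : ∀ J₁ U₁, Flow A S s J₁ U₁ → U₁ 0 = u → Set.EqOn U U₁ J₁ := fun J₁ U₁ h1 h2 t ht => by
    have htJ := hJ₁ J₁ U₁ h1 h2 ht
    exact hu _ _ _ _ (hF t htJ) h1 ((h0 t htJ).trans h2.symm) ⟨hm t htJ, ht⟩
  have hloc : ∀ t ∈ J, Flow A S s (J' t) U := fun t ht =>
    (hF t ht).congr (heq _ _ (hF t ht) (h0 t ht))
  obtain ⟨J₀, U₀, h₀, hi₀⟩ := hex
  have h0J : (0 : ℝ) ∈ J := hJ₁ J₀ U₀ h₀ hi₀ h₀.zero_mem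
  refine ⟨J, U, ⟨⟨fun t ht => (hloc t ht).reg t (hm t ht), fun t ht => (hloc t ht).supp t (hm t ht),
    fun t ht => (hloc t ht).deriv t (hm t ht)⟩, ?_, ?_, h0J,
    fun t ht => (hloc t ht).Hs_ne_top t (hm t ht), fun t ht => (hloc t ht).cont t (hm t ht)⟩,
    (heq J₀ U₀ h₀ hi₀ h₀.zero_mem).trans hi₀,
    fun J₁ U₁ h1 h2 => ⟨hJ₁ J₁ U₁ h1 h2, (heq J₁ U₁ h1 h2).symm⟩⟩
  · refine isOpen_iff_mem_nhds.2 fun t ht => Filter.mem_of_superset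
      ((hF t ht).isOpen.mem_nhds (hm t ht)) (hJ₁ _ _ (hF t ht) (h0 t ht))
  · have : J = ⋃ t ∈ J, J' t := by
      ext t
      simp only [Set.mem_iUnion]
      exact ⟨fun ht => ⟨t, ht, hm t ht⟩, fun ⟨τ, hτ, h⟩ => hJ₁ _ _ (hF τ hτ) (h0 τ hτ) h⟩
    have hp : IsPreconnected J := by
      rw [this]
      refine isPreconnected_of_forall 0 fun t ht => ?_
      simp only [Set.mem_iUnion] at ht
      obtain ⟨τ, hτ, h⟩ := ht
      exact ⟨J' τ, Set.subset_biUnion_of_mem hτ, (hF τ hτ).zero_mem, h,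
        (hF τ hτ).ordConnected.isPreconnected⟩
    exact hp.ordConnected

/-- A maximal solution can be continued by any solution that starts from one of its values. -/
lemma IsMaxFlow.add_mem (hu : UniqueFlow A S s) {u : Func d n} {J J₁ : Set ℝ} {U V : ℝ → Func d n}
    (h : IsMaxFlow A S s u J U) {t₁ : ℝ} (ht₁ : t₁ ∈ J) (hV : Flow A S s J₁ V) (h0 : V 0 = U t₁)
    {t : ℝ} (ht : t ∈ J₁) : t + t₁ ∈ J := by
  obtain ⟨K, W, hW⟩ := exists_isMaxFlow hu ⟨J₁, V, hV, h0⟩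
  obtain ⟨h1, h2⟩ := hW.max _ _ (h.flow.shift ht₁) (by simp)
  have hm : -t₁ ∈ (fun t => t + t₁) ⁻¹' J := by simpa using h.flow.zero_mem
  have h3 := hW.flow.shift (h1 hm)
  have h4 := (h.max _ _ h3 (by
    have := h2 hm
    simp only [neg_add_cancel] at this
    rw [zero_add, ← this, h.init])).1
  apply h4
  simpa using (hW.max _ _ hV h0).1 ht

lemma uniqueMaximal_of_isMaxFlow {P : Func d n → Func d n} (hP : Multiplier P S)
    (hs : (d : ℝ) / 2 + 1 < s) {U₀ u : Func d n} (hU₀ : MemHs s U₀) (hu : Reg u)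
    (hu₀ : vc u = S.indicator (vc U₀)) {J : Set ℝ} {U : ℝ → Func d n}
    (h : IsMaxFlow A S s u J U) : IsMaximalSolution P A s U₀ J U ∧
      ∀ I V, IsMaximalSolution P A s U₀ I V → I = J ∧ Set.EqOn V U J := by
  have hsol : IsClassicalSolution P A s U₀ J U :=
    h.flow.isClassicalSolution hP hs hU₀ (by rw [h.init, hu₀])
  have hsub : ∀ I V, IsClassicalSolution P A s U₀ I V → I ⊆ J ∧ Set.EqOn V U I := by
    intro I V hV
    obtain ⟨hf, h0⟩ := hV.flow hP hs
    exact h.max I V hf ((hV.reg hs hV.zero_mem).ext_vc hu (h0.trans hu₀.symm))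
  refine ⟨⟨hsol, fun I V hV _ _ => (hsub I V hV).1⟩, fun I V hV => ?_⟩
  obtain ⟨h1, h2⟩ := hsub I V hV.1
  have h3 := hV.2 J U hsol h1 h2.symm
  have h4 : I = J := h1.antisymm h3
  subst h4
  exact ⟨rfl, h2⟩

end Maximal

section Continuity

variable {d n : ℕ} {A : Coefficients d n} {S : Set (Fin d → ℤ)} {s : ℝ}

lemma Hs_sub_comm (s : ℝ) {U V : Func d n} (hU : ∀ i, IntegrableOn (cx U i) (cell d))
    (hV : ∀ i, IntegrableOn (cx V i) (cell d)) : Hs s (U - V) = Hs s (V - U) := by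
  unfold Hs
  congr 1
  ext k
  rw [ev, ev, vc_sub_of_integrableOn hU hV, vc_sub_of_integrableOn hV hU, ← enorm_neg, neg_sub]

lemma Hs_eq_nH_sub (s : ℝ) {U V : Func d n} (hU : Reg U) (hV : Reg V) :
    Hs s (U - V) = nH s (fun k => ‖vc U k - vc V k‖ₑ) := by
  unfold Hs
  congr 1
  ext k
  rw [ev, hU.vc_sub hV]

lemma abs_hsNorm_sub_le {U V : Func d n} (hU : MemHs s U) (hV : MemHs s V) :
    |hsNorm s U - hsNorm s V| ≤ hsNorm s (U - V) := by
  have key : ∀ {U V : Func d n}, MemHs s U → MemHs s V →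
      hsNorm s U ≤ hsNorm s (U - V) + hsNorm s V := by
    intro U V hU hV
    have h := Hs_le_add_sub (s := s) hU.integrableOn hV.integrableOn
    rw [hU.Hs_eq, hV.Hs_eq, (hU.sub hV).Hs_eq, ← ENNReal.ofReal_add (hsNorm_nonneg _ _)
      (hsNorm_nonneg _ _)] at h
    exact (ENNReal.ofReal_le_ofReal_iff (add_nonneg (hsNorm_nonneg _ _) (hsNorm_nonneg _ _))).1 h
  have hc : hsNorm s (V - U) = hsNorm s (U - V) := by
    rw [hsNorm_eq_toReal, hsNorm_eq_toReal, Hs_sub_comm s hV.integrableOn hU.integrableOn]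
  have h1 := key hU hV
  have h2 := key hV hU
  rw [abs_le]
  constructor <;> linarith

lemma Flow.memHs {J : Set ℝ} {U : ℝ → Func d n} (h : Flow A S s J U) {t : ℝ} (ht : t ∈ J) :
    MemHs s (U t) := (h.reg t ht).memHs (h.Hs_ne_top t ht)

lemma Flow.continuousOn_hsNorm {J : Set ℝ} {U : ℝ → Func d n} (h : Flow A S s J U) :
    ContinuousOn (fun t => hsNorm s (U t)) J := by
  intro t₀ ht₀
  refine ContinuousAt.continuousWithinAt ?_
  unfold ContinuousAt
  rw [tendsto_iff_dist_tendsto_zero]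
  have h1 := (ENNReal.tendsto_toReal ENNReal.zero_ne_top).comp (h.cont t₀ ht₀)
  refine squeeze_zero' (Filter.Eventually.of_forall fun _ => dist_nonneg) ?_ h1
  filter_upwards [h.isOpen.mem_nhds ht₀] with t ht
  rw [Real.dist_eq, Function.comp, ← hsNorm_eq_toReal]
  exact abs_hsNorm_sub_le (h.memHs ht) (h.memHs ht₀)

lemma Flow.uIcc_subset {J : Set ℝ} {U : ℝ → Func d n} (h : Flow A S s J U) {t : ℝ} (ht : t ∈ J) :
    Set.uIcc 0 t ⊆ J := h.ordConnected.uIcc_subset h.zero_mem ht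

lemma Flow.exists_bound {J : Set ℝ} {U : ℝ → Func d n} (h : Flow A S s J U) {t : ℝ} (ht : t ∈ J) :
    ∃ m : ℝ, 0 ≤ m ∧ ∀ τ ∈ Set.uIcc 0 t, Hs s (U τ) ≤ ENNReal.ofReal m := by
  obtain ⟨m, hm⟩ := isCompact_uIcc.bddAbove_image (h.continuousOn_hsNorm.mono (h.uIcc_subset ht))
  have hm' : ∀ τ ∈ Set.uIcc 0 t, hsNorm s (U τ) ≤ m := fun τ hτ => hm ⟨τ, hτ, rfl⟩
  refine ⟨m, (hsNorm_nonneg _ _).trans (hm' 0 Set.left_mem_uIcc), fun τ hτ => ?_⟩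
  rw [(h.memHs (h.uIcc_subset ht hτ)).Hs_eq]
  exact ENNReal.ofReal_le_ofReal (hm' τ hτ)

lemma vc_eq_of_N2_eq_zero {U V : Func d n} (h : N2 (fun k => ‖vc U k - vc V k‖ₑ) = 0) :
    vc U = vc V := by
  ext1 k
  have h1 := le_N2 (fun k => ‖vc U k - vc V k‖ₑ) k
  rw [h] at h1
  exact sub_eq_zero.1 (enorm_eq_zero.1 (le_antisymm h1 zero_le))

/-- Uniqueness for the Galerkin approximations. -/
lemma uniqueFlow_box (A : Coefficients d n)
    (hA : ∀ (j : Fin d) (u : Fin n → ℝ), (A.at j u).IsHermitian)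
    (hs : (d : ℝ) / 2 + 1 < s) (N : ℕ) : UniqueFlow A (box d N) s := by
  intro J J' U U' hU hU' h0 t ht
  obtain ⟨m, hm0, hm⟩ := hU.exists_bound ht.1
  obtain ⟨m', hm'0, hm'⟩ := hU'.exists_bound ht.2
  obtain ⟨Cs, hCs⟩ := n1_le_nH (d := d) hs
  obtain ⟨C, hC0, hC⟩ := exists_compare_bound A hA hs (m + Cs * m')
  have hp : 0 ≤ (Cs : ℝ) * m' := by positivity
  have h1 := hC N _ _ 0 (lowPass_box N s) U U' t m (Cs * m')
    (hU.toModeFlow.mono (hU.uIcc_subset ht.1)) (hU'.toModeFlow.mono (hU'.uIcc_subset ht.2)) hm0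
    (by linarith) (by positivity) (by linarith) hm (fun τ hτ => by
      rw [ENNReal.ofReal_mul (by positivity), ENNReal.ofReal_coe_nnreal]
      exact (hCs _).trans (mul_le_mul' le_rfl (hm' τ hτ))) (fun k _ => by rw [h0])
  refine (hU.reg t ht.1).ext_vc (hU'.reg t ht.2) (vc_eq_of_N2_eq_zero (le_antisymm ?_ zero_le))
  simpa using h1

/-- Otherwise `g` reaches the value `a`, and the hypothesis fails at the first such time. -/
lemma bootstrap_of_nonneg {g : ℝ → ℝ} {a t : ℝ} (hg : ContinuousOn g (Set.Icc 0 t))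
    (h0 : g 0 < a) (h : ∀ τ ∈ Set.Icc 0 t, (∀ σ ∈ Set.Icc 0 τ, g σ ≤ a) → g τ < a) :
    ∀ τ ∈ Set.Icc 0 t, g τ < a := by
  by_contra! hcon
  obtain ⟨τ₀, hτ₀, hbad⟩ := hcon
  set B : Set ℝ := Set.Icc 0 t ∩ g ⁻¹' Set.Ici a with hB
  have hBc : IsClosed B := hg.preimage_isClosed_of_isClosed isClosed_Icc isClosed_Ici
  have hBb : BddBelow B := ⟨0, fun x hx => hx.1.1⟩
  have hσ : sInf B ∈ B := hBc.csInf_mem ⟨τ₀, hτ₀, hbad⟩ hBb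
  set σ := sInf B with hσdef
  have hlt : ∀ τ ∈ Set.Ico 0 σ, g τ < a := by
    intro τ hτ
    by_contra! hge
    exact absurd (csInf_le hBb ⟨⟨hτ.1, hτ.2.le.trans hσ.1.2⟩, hge⟩) (not_le.2 hτ.2)
  have hσ0 : 0 < σ := by
    rcases hσ.1.1.lt_or_eq with h | h
    · exact h
    · have h1 : a ≤ g σ := hσ.2
      rw [← h] at h1
      linarith
  have hle : g σ ≤ a := by
    have h1 : Filter.Tendsto g (𝓝[Set.Ico 0 σ] σ) (𝓝 (g σ)) :=
      (hg σ hσ.1).mono fun x hx => ⟨hx.1, hx.2.le.trans hσ.1.2⟩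
    have : (𝓝[Set.Ico 0 σ] σ).NeBot := by
      rw [← mem_closure_iff_nhdsWithin_neBot, closure_Ico hσ0.ne]
      exact Set.right_mem_Icc.2 hσ0.le
    refine le_of_tendsto h1 ?_
    filter_upwards [self_mem_nhdsWithin] with x hx using (hlt x hx).le
  have := h σ hσ.1 fun x hx => by
    rcases hx.2.lt_or_eq with h2 | h2
    · exact (hlt x ⟨hx.1, h2⟩).le
    · rw [h2]
      exact hle
  exact absurd hσ.2 (not_le.2 this)

/-- The continuity method: a bound that improves itself persists. -/
lemma bootstrap {g : ℝ → ℝ} {a t : ℝ} (hg : ContinuousOn g (Set.uIcc 0 t))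
    (h0 : g 0 < a) (h : ∀ τ ∈ Set.uIcc 0 t, (∀ σ ∈ Set.uIcc 0 τ, g σ ≤ a) → g τ < a) :
    ∀ τ ∈ Set.uIcc 0 t, g τ < a := by
  rcases le_total 0 t with ht | ht
  · rw [Set.uIcc_of_le ht] at hg h ⊢
    refine bootstrap_of_nonneg hg h0 fun τ hτ hσ => h τ hτ ?_
    rwa [Set.uIcc_of_le hτ.1]
  · rw [Set.uIcc_of_ge ht] at hg h ⊢
    have hneg : ∀ τ, τ ∈ Set.Icc 0 (-t) → -τ ∈ Set.Icc t 0 := fun τ hτ => by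
      constructor <;> linarith [hτ.1, hτ.2]
    have h1 := bootstrap_of_nonneg (g := fun τ => g (-τ)) (a := a) (t := -t)
      (hg.comp continuous_neg.continuousOn hneg) (by simpa using h0) fun τ hτ hσ => by
        refine h (-τ) (hneg τ hτ) ?_
        rw [Set.uIcc_of_ge (by linarith [hτ.1])]
        intro σ hσ'
        have := hσ (-σ) ⟨by linarith [hσ'.2], by linarith [hσ'.1]⟩
        rwa [neg_neg] at this
    intro τ hτ
    have := h1 (-τ) ⟨by linarith [hτ.2], by linarith [hτ.1]⟩
    rwa [neg_neg] at this

end Continuity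

/-! ### The Galerkin approximations -/

section GalerkinLocal

variable {d n : ℕ}

/-- Extension by zero of a finite family of Fourier coefficients. -/
def extend (N : ℕ) (c : box d N → EuclideanSpace ℂ (Fin n)) (k : Fin d → ℤ) :
    EuclideanSpace ℂ (Fin n) :=
  if h : k ∈ box d N then c ⟨k, h⟩ else 0

lemma extend_of_mem {N : ℕ} (c : box d N → EuclideanSpace ℂ (Fin n)) (k : box d N) :
    extend N c k = c k := dif_pos k.2

lemma extend_of_notMem {N : ℕ} (c : box d N → EuclideanSpace ℂ (Fin n)) {k : Fin d → ℤ}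
    (hk : k ∉ box d N) : extend N c k = 0 := dif_neg hk

lemma extend_sub {N : ℕ} (c c' : box d N → EuclideanSpace ℂ (Fin n)) (k : Fin d → ℤ) :
    extend N (c - c') k = extend N c k - extend N c' k := by
  unfold extend
  split_ifs <;> simp

lemma tsum_wt_extend_le (r : ℝ) {N : ℕ} (c : box d N → EuclideanSpace ℂ (Fin n)) :
    ∑' k, wt r k * ‖extend N c k‖ₑ ≤ (∑ k ∈ box d N, wt r k) * ‖c‖ₑ := by
  rw [tsum_eq_sum (s := box d N) fun k hk => by simp [extend_of_notMem c hk], Finset.sum_mul]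
  refine Finset.sum_le_sum fun k hk => ?_
  gcongr
  rw [extend, dif_pos hk, ← ofReal_norm, ← ofReal_norm]
  exact ENNReal.ofReal_le_ofReal (norm_le_pi_norm c ⟨k, hk⟩)

/-- The real vector space of the Fourier coefficients, in the box, of real-valued functions. -/
def hermitianSubmodule (d n N : ℕ) : Submodule ℝ (box d N → EuclideanSpace ℂ (Fin n)) where
  carrier := {c | Hermitian (extend N c)}
  zero_mem' k i := by simp [extend]
  add_mem' {a b} ha hb k i := by
    have e : ∀ k, extend N (a + b) k = extend N a k + extend N b k := fun k => by
      unfold extend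
      split_ifs <;> simp
    rw [e, e, PiLp.add_apply, PiLp.add_apply, ha, hb, map_add]
  smul_mem' r a ha k i := by
    have e : ∀ k, extend N (r • a) k = r • extend N a k := fun k => by
      unfold extend
      split_ifs <;> simp
    rw [e, e, PiLp.smul_apply, PiLp.smul_apply, ha]
    simp

lemma mem_hermitianSubmodule {N : ℕ} {c : box d N → EuclideanSpace ℂ (Fin n)} :
    c ∈ hermitianSubmodule d n N ↔ Hermitian (extend N c) := Iff.rfl

/-- The function with given Fourier coefficients in the box. -/
def ofCoeff {N : ℕ} (c : hermitianSubmodule d n N) : Func d n := synth (extend N c.1)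

lemma reg_ofCoeff {N : ℕ} (c : hermitianSubmodule d n N) : Reg (ofCoeff c) :=
  (reg_synth c.2 (n1_finite_ne_top fun _ hk => extend_of_notMem c.1 hk)).1

lemma vc_ofCoeff {N : ℕ} (c : hermitianSubmodule d n N) : vc (ofCoeff c) = extend N c.1 :=
  (reg_synth c.2 (n1_finite_ne_top fun _ hk => extend_of_notMem c.1 hk)).2

/-- The restriction to the box of the Fourier coefficients of a function. -/
def toCoeff (N : ℕ) (f : Func d n) : hermitianSubmodule d n N :=
  ⟨fun k => vc f k, mem_hermitianSubmodule.2 (by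
    have e : extend N (fun k => vc f k) = boxCoeff N f := by
      ext1 k
      unfold extend boxCoeff
      split_ifs <;> rfl
    rw [e]
    exact hermitian_boxCoeff N f)⟩

lemma ofCoeff_toCoeff {N : ℕ} {f : Func d n} (hf : Reg f) (h : ∀ k, k ∉ box d N → vc f k = 0) :
    ofCoeff (toCoeff N f) = f := by
  refine (reg_ofCoeff _).ext_vc hf ?_
  rw [vc_ofCoeff]
  ext1 k
  unfold extend toCoeff
  split_ifs with hk
  · rfl
  · exact (h k hk).symm

/-- The vector field of the Galerkin approximation. -/
def galerkinField (A : Coefficients d n) (N : ℕ) (c : hermitianSubmodule d n N) :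
    hermitianSubmodule d n N :=
  -toCoeff N (transport A (ofCoeff c))

lemma W1_ofCoeff_le {N : ℕ} (c : hermitianSubmodule d n N) :
    W1 (ofCoeff c) ≤ (∑ k ∈ box d N, wt 1 k) * ‖c‖ₑ := by
  unfold W1 n1 ev
  rw [vc_ofCoeff]
  exact tsum_wt_extend_le 1 c.1

lemma sum_wt_ne_top (r : ℝ) (N : ℕ) : ∑ k ∈ box d N, wt r k ≠ ∞ :=
  (ENNReal.sum_lt_top.2 fun k _ => (wt_ne_top r k).lt_top).ne

lemma exists_lipschitz_galerkinField (A : Coefficients d n) (N : ℕ) (R : ℝ≥0) :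
    ∃ K : ℝ≥0, ∀ c c' : hermitianSubmodule d n N, ‖c‖ ≤ R → ‖c'‖ ≤ R →
      ‖galerkinField A N c - galerkinField A N c'‖ ≤ K * ‖c - c'‖ := by
  set w : ℝ≥0 := (∑ k ∈ box d N, wt 1 k).toNNReal with hw
  have hwe : (w : ℝ≥0∞) = ∑ k ∈ box d N, wt 1 k := ENNReal.coe_toNNReal (sum_wt_ne_top 1 N)
  obtain ⟨C, hC⟩ := exists_transport_sub_le A (w * R)
  refine ⟨C * (w + w), fun c c' hc hc' => ?_⟩
  have hW : ∀ c : hermitianSubmodule d n N, ‖c‖ ≤ R → W1 (ofCoeff c) ≤ ((w * R : ℝ≥0) : ℝ≥0∞) := by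
    intro c hc
    refine (W1_ofCoeff_le c).trans ?_
    rw [← hwe]
    push_cast
    gcongr
    rw [← ofReal_norm, ← ENNReal.ofReal_coe_nnreal]
    exact ENNReal.ofReal_le_ofReal hc
  have h1 := hC _ _ (reg_ofCoeff c) (reg_ofCoeff c') (hW c hc) (hW c' hc')
  have hn : n1 (fun k => ‖vc (ofCoeff c) k - vc (ofCoeff c') k‖ₑ) ≤ w * ‖c - c'‖ₑ := by
    rw [hwe, vc_ofCoeff, vc_ofCoeff]
    simp_rw [← extend_sub]
    exact tsum_wt_extend_le 1 (c.1 - c'.1)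
  have h2 : N2 (fun k => ‖vc (transport A (ofCoeff c)) k - vc (transport A (ofCoeff c')) k‖ₑ)
      ≤ ENNReal.ofReal (((C * (w + w) : ℝ≥0) : ℝ) * ‖c - c'‖) := by
    refine h1.trans ?_
    rw [ENNReal.ofReal_mul NNReal.zero_le_coe, ENNReal.ofReal_coe_nnreal, ofReal_norm]
    push_cast
    rw [mul_assoc, add_mul]
    gcongr
    exact (N2_le_tsum _).trans ((tsum_le_n1 _).trans hn)
  refine (pi_norm_le_iff_of_nonneg (by positivity)).2 fun k => ?_
  have h3 := (le_N2 _ k.1).trans h2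
  rw [← ofReal_norm, ENNReal.ofReal_le_ofReal_iff (by positivity)] at h3
  refine le_trans (le_of_eq ?_) h3
  rw [← norm_neg]
  congr 1
  change -(-vc (transport A (ofCoeff c)) k - -vc (transport A (ofCoeff c')) k) = _
  abel

/-- Local existence for the Galerkin approximations, with a time of existence that is uniform on
bounded sets for each fixed `N`. -/
lemma exists_galerkin_local (A : Coefficients d n) {s : ℝ} (hs : 0 ≤ s) (N : ℕ) (R : ℝ) :
    ∃ δ : ℝ, 0 < δ ∧ ∀ u : Func d n, Reg u → (∀ k, k ∉ box d N → vc u k = 0) →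
      Hs s u ≤ ENNReal.ofReal R → ∃ U, Flow A (box d N) s (Set.Ioo (-δ) δ) U ∧ U 0 = u := by
  obtain ⟨K, hK⟩ := exists_lipschitz_galerkinField A N (R.toNNReal + 1)
  set L : ℝ≥0 := ‖galerkinField A N 0‖₊ + K * (R.toNNReal + 1) with hL
  -- within this time the solution cannot leave the ball of radius `1` around its initial value
  refine ⟨1 / (L + 1), by positivity, fun u hu hsupp hR => ?_⟩
  set δ : ℝ := 1 / (L + 1) with hδ
  have hδ0 : 0 < δ := by positivity
  set c₀ := toCoeff N u with hc₀
  have hc₀R : ‖c₀‖ ≤ R.toNNReal := by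
    refine (pi_norm_le_iff_of_nonneg NNReal.zero_le_coe).2 fun k => ?_
    have h1 : ‖vc u k‖ₑ ≤ Hs s u := by
      refine le_trans ?_ (le_N2 (fun k => wt s k * ev u k) k.1)
      exact le_mul_of_one_le_left zero_le (one_le_wt hs _)
    have h2 := h1.trans hR
    rw [← ofReal_norm] at h2
    have h3 : ENNReal.ofReal R = ENNReal.ofReal (R.toNNReal : ℝ) := by
      rw [ENNReal.ofReal_coe_nnreal]
      rfl
    rw [h3, ENNReal.ofReal_le_ofReal_iff NNReal.zero_le_coe] at h2
    exact h2
  have hball : ∀ c ∈ Metric.closedBall c₀ ((1 : ℝ≥0) : ℝ), ‖c‖ ≤ ((R.toNNReal + 1 : ℝ≥0) : ℝ) := by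
    intro c hc
    rw [mem_closedBall_iff_norm] at hc
    calc ‖c‖ = ‖c₀ + (c - c₀)‖ := by rw [add_sub_cancel]
      _ ≤ ‖c₀‖ + ‖c - c₀‖ := norm_add_le _ _
      _ ≤ R.toNNReal + 1 := add_le_add hc₀R hc
  have hmem : (0 : ℝ) ∈ Set.Icc (-δ) δ := ⟨by linarith, hδ0.le⟩
  have hPL : IsPicardLindelof (fun _ c => galerkinField A N c) (tmin := -δ) (tmax := δ)
      ⟨0, hmem⟩ c₀ 1 0 L K := by
    refine ⟨fun t _ => ?_, fun c _ => continuousOn_const, fun t _ c hc => ?_, ?_⟩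
    · refine LipschitzOnWith.of_dist_le_mul fun c hc c' hc' => ?_
      rw [dist_eq_norm, dist_eq_norm]
      exact hK c c' (hball c hc) (hball c' hc')
    · have h1 := hK c 0 (hball c hc) (by rw [norm_zero]; exact NNReal.zero_le_coe)
      rw [sub_zero] at h1
      calc ‖galerkinField A N c‖
          = ‖galerkinField A N 0 + (galerkinField A N c - galerkinField A N 0)‖ := by
            rw [add_sub_cancel]
        _ ≤ ‖galerkinField A N 0‖ + ‖galerkinField A N c - galerkinField A N 0‖ := norm_add_le _ _
        _ ≤ ‖galerkinField A N 0‖ + K * ((R.toNNReal + 1 : ℝ≥0) : ℝ) := by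
            gcongr
            exact h1.trans (by gcongr; exact hball c hc)
        _ = L := by rw [hL]; push_cast; rfl
    · simp only [sub_zero, zero_sub, neg_neg, max_self, NNReal.coe_one, NNReal.coe_zero]
      rw [hδ, mul_one_div, div_le_one (by positivity)]
      linarith
  obtain ⟨α, hα0, hα⟩ := hPL.exists_eq_forall_mem_Icc_hasDerivWithinAt₀
  have hα0' : α 0 = c₀ := hα0
  have hd : ∀ t ∈ Set.Ioo (-δ) δ, HasDerivAt α (galerkinField A N (α t)) t := fun t ht =>
    (hα t ⟨ht.1.le, ht.2.le⟩).hasDerivAt (Icc_mem_nhds ht.1 ht.2)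
  refine ⟨fun t => ofCoeff (α t), ⟨⟨fun t _ => reg_ofCoeff _, fun t _ k hk => ?_,
    fun t ht k hk => ?_⟩, isOpen_Ioo, Set.ordConnected_Ioo, ⟨by linarith, hδ0⟩, fun t _ => ?_,
    fun t ht => ?_⟩, ?_⟩
  · rw [vc_ofCoeff]
    exact extend_of_notMem _ hk
  · have h1 := ((ContinuousLinearMap.proj (R := ℝ) (φ := fun _ : box d N =>
      EuclideanSpace ℂ (Fin n)) ⟨k, hk⟩).comp
        (hermitianSubmodule d n N).subtypeL).hasFDerivAt.comp_hasDerivAt t (hd t ht)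
    refine (h1.congr_of_eventuallyEq (Filter.Eventually.of_forall fun τ => ?_))
    change vc (ofCoeff (α τ)) k = _
    rw [vc_ofCoeff]
    exact extend_of_mem (α τ).1 ⟨k, hk⟩
  · unfold Hs ev
    rw [vc_ofCoeff]
    exact nH_finite_ne_top s fun k hk => extend_of_notMem _ hk
  · have hle : ∀ τ, Hs s (ofCoeff (α τ) - ofCoeff (α t))
        ≤ (∑ k ∈ box d N, wt s k) * ‖α τ - α t‖ₑ := by
      intro τ
      rw [Hs_eq_nH_sub s (reg_ofCoeff _) (reg_ofCoeff _), vc_ofCoeff, vc_ofCoeff]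
      simp_rw [← extend_sub]
      exact (N2_le_tsum _).trans (tsum_wt_extend_le s ((α τ).1 - (α t).1))
    refine tendsto_of_tendsto_of_tendsto_of_le_of_le tendsto_const_nhds ?_ (fun _ => zero_le) hle
    have h1 : Filter.Tendsto (fun τ => ‖α τ - α t‖ₑ) (𝓝 t) (𝓝 0) := by
      have h2 := ENNReal.tendsto_ofReal (tendsto_iff_norm_sub_tendsto_zero.1
        (hd t ht).continuousAt)
      rw [ENNReal.ofReal_zero] at h2
      exact h2.congr fun τ => ofReal_norm _
    have h2 := ENNReal.Tendsto.const_mul (a := ∑ k ∈ box d N, wt s k) h1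
      (Or.inr (sum_wt_ne_top s N))
    rwa [mul_zero] at h2
  · change ofCoeff (α 0) = u
    rw [hα0', hc₀, ofCoeff_toCoeff hu hsupp]

end GalerkinLocal

section GalerkinGlobal

variable {d n : ℕ}

/-- A maximal Galerkin approximation does not stop as long as its norm stays bounded. -/
lemma galerkin_continuation (A : Coefficients d n)
    (hA : ∀ (j : Fin d) (u : Fin n → ℝ), (A.at j u).IsHermitian) {s : ℝ}
    (hs : (d : ℝ) / 2 + 1 < s) {N : ℕ} {u : Func d n} {J : Set ℝ} {V : ℝ → Func d n}
    (h : IsMaxFlow A (box d N) s u J V) {t R : ℝ}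
    (hR : ∀ τ ∈ J, τ ∈ Set.uIcc 0 t → Hs s (V τ) ≤ ENNReal.ofReal R) : t ∈ J := by
  have hd : (0 : ℝ) ≤ d := by positivity
  obtain ⟨δ, hδ, hloc⟩ := exists_galerkin_local A (by linarith : 0 ≤ s) N R
  have hmemIcc : ∀ μ ∈ Set.Icc (0 : ℝ) 1, μ * t ∈ Set.uIcc 0 t := by
    intro μ hμ
    rcases le_total 0 t with ht | ht
    · rw [Set.uIcc_of_le ht]
      exact ⟨mul_nonneg hμ.1 ht, mul_le_of_le_one_left ht hμ.2⟩
    · rw [Set.uIcc_of_ge ht]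
      exact ⟨by nlinarith [hμ.1, hμ.2], mul_nonpos_of_nonneg_of_nonpos hμ.1 ht⟩
  set B : Set ℝ := {μ | μ ∈ Set.Icc (0 : ℝ) 1 ∧ μ * t ∈ J} with hB
  have hB0 : (0 : ℝ) ∈ B := ⟨⟨le_rfl, zero_le_one⟩, by simpa using h.flow.zero_mem⟩
  have hBb : BddAbove B := ⟨1, fun μ hμ => hμ.1.2⟩
  set η : ℝ := δ / (|t| + 1) with hη
  have hη0 : 0 < η := by positivity
  obtain ⟨μ, hμ, hμlt⟩ := exists_lt_of_lt_csSup ⟨0, hB0⟩ (sub_lt_self (sSup B) hη0)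
  obtain ⟨W, hW, hW0⟩ := hloc (V (μ * t)) (h.flow.reg _ hμ.2) (h.flow.supp _ hμ.2)
    (hR _ hμ.2 (hmemIcc μ hμ.1))
  have hstep : ∀ ν ∈ Set.Icc (0 : ℝ) 1, |ν - μ| ≤ η → ν ∈ B := by
    intro ν hν hle
    refine ⟨hν, ?_⟩
    have hlt : |ν * t - μ * t| < δ := by
      rw [← sub_mul, abs_mul]
      calc |ν - μ| * |t| ≤ η * |t| := by gcongr
        _ < η * (|t| + 1) := by gcongr; linarith
        _ = δ := by rw [hη]; field_simp
    have := h.add_mem (uniqueFlow_box A hA hs N) hμ.2 hW hW0 (t := ν * t - μ * t) (abs_lt.1 hlt)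
    rwa [sub_add_cancel] at this
  by_cases h1 : 1 ≤ μ + η
  · have := hstep 1 ⟨zero_le_one, le_rfl⟩ (by
      rw [abs_of_nonneg (by linarith [hμ.1.2])]
      linarith)
    simpa using this.2
  · have := hstep (μ + η) ⟨by linarith [hμ.1.1], by linarith⟩ (by
      rw [add_sub_cancel_left, abs_of_pos hη0])
    linarith [le_csSup hBb this]

lemma exists_galerkin_max (A : Coefficients d n)
    (hA : ∀ (j : Fin d) (u : Fin n → ℝ), (A.at j u).IsHermitian) {s : ℝ}
    (hs : (d : ℝ) / 2 + 1 < s) {N : ℕ} {u : Func d n} (hu : Reg u)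
    (hsupp : ∀ k, k ∉ box d N → vc u k = 0) : ∃ J V, IsMaxFlow A (box d N) s u J V := by
  have hd : (0 : ℝ) ≤ d := by positivity
  refine exists_isMaxFlow (uniqueFlow_box A hA hs N) ?_
  obtain ⟨δ, -, hloc⟩ := exists_galerkin_local A (by linarith : 0 ≤ s) N (Hs s u).toReal
  have hfin : Hs s u ≠ ∞ := nH_finite_ne_top s hsupp
  obtain ⟨V, hV, hV0⟩ := hloc u hu hsupp (by rw [ENNReal.ofReal_toReal hfin])
  exact ⟨_, V, hV, hV0⟩

lemma abs_le_of_mem_uIcc {τ t : ℝ} (h : τ ∈ Set.uIcc 0 t) : |τ| ≤ |t| := by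
  have := Set.abs_sub_left_of_mem_uIcc h
  simpa using this

/-- Uniform bounds for the Galerkin approximations, on a time interval whose length is inversely
proportional to the size of the data and does not depend on `N`. -/
lemma exists_galerkin_bound (A : Coefficients d n)
    (hA : ∀ (j : Fin d) (u : Fin n → ℝ), (A.at j u).IsHermitian) {s : ℝ}
    (hs : (d : ℝ) / 2 + 1 < s) (M : ℝ) :
    ∃ C T : ℝ, 0 < C ∧ 0 < T ∧ Real.exp (C * T) ≤ 2 ∧ ∀ (N : ℕ) (u : Func d n) (r : ℝ)
      (J : Set ℝ) (V : ℝ → Func d n), 0 ≤ r → r ≤ M → Hs s u ≤ ENNReal.ofReal r →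
      IsMaxFlow A (box d N) s u J V → ∀ t, |t| * r ≤ T →
        t ∈ J ∧ Hs s (V t) ≤ ENNReal.ofReal (r * Real.exp (C * r * |t|)) := by
  have hd : (0 : ℝ) ≤ d := by positivity
  obtain ⟨Cs, hCs⟩ := n1_le_nH (d := d) hs
  obtain ⟨C₁, hC₁, hE⟩ := exists_energy_bound A hA (by linarith : 1 ≤ s) (Cs * (2 * |M| + 1))
  set C : ℝ := C₁ * (Cs * 2) + 1 with hC
  have hCpos : 0 < C := by positivity
  set T : ℝ := Real.log 2 / (2 * C) with hT
  have hlog : 0 < Real.log 2 := Real.log_pos one_lt_two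
  have hTpos : 0 < T := by positivity
  have hexp : Real.exp (C * T) < 2 := by
    rw [← Real.lt_log_iff_exp_lt two_pos, hT]
    have : C * (Real.log 2 / (2 * C)) = Real.log 2 / 2 := by field_simp
    rw [this]
    linarith
  refine ⟨C, T, hCpos, hTpos, hexp.le, fun N u r J V hr hrM hur h => ?_⟩
  have hMr : r ≤ |M| := hrM.trans (le_abs_self M)
  have hV0 : Hs s (V 0) ≤ ENNReal.ofReal r := by rw [h.init]; exact hur
  -- the bound on the part of the time interval where the solution exists; for zero data, the
  -- bootstrap uses the threshold `1` in place of `2 r = 0`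
  have key : ∀ t ∈ J, |t| * r ≤ T → Hs s (V t) ≤ ENNReal.ofReal (r * Real.exp (C * r * |t|)) := by
    intro t ht htr
    have hJ := h.flow.uIcc_subset ht
    set a : ℝ := if r = 0 then 1 else 2 * r with ha
    have ha0 : 0 ≤ a := by rw [ha]; split_ifs <;> linarith
    have haM : a ≤ 2 * |M| + 1 := by
      rw [ha]
      split_ifs
      · linarith [abs_nonneg M]
      · linarith
    have hra : r < a := by
      rw [ha]
      split_ifs with h0
      · rw [h0]; exact one_pos
      · have : 0 < r := lt_of_le_of_ne hr (Ne.symm h0)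
        linarith
    have hstep : ∀ τ ∈ Set.uIcc 0 t, (∀ σ ∈ Set.uIcc 0 τ, hsNorm s (V σ) ≤ a) →
        Hs s (V τ) ≤ ENNReal.ofReal (r * Real.exp (C₁ * (Cs * a) * |τ|)) := by
      intro τ hτ hσ
      have hsub : Set.uIcc 0 τ ⊆ J := h.flow.uIcc_subset (hJ hτ)
      refine hE N V τ (Cs * a) r (h.flow.toModeFlow.mono hsub) (by positivity) (by gcongr) hr
        (fun σ hστ => ?_) hV0
      rw [ENNReal.ofReal_mul NNReal.zero_le_coe, ENNReal.ofReal_coe_nnreal]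
      refine (hCs _).trans (mul_le_mul' le_rfl ?_)
      change Hs s (V σ) ≤ _
      rw [(h.flow.memHs (hsub hστ)).Hs_eq]
      exact ENNReal.ofReal_le_ofReal (hσ σ hστ)
    have hrexp : ∀ τ, r * Real.exp (C₁ * (Cs * a) * |τ|) ≤ r * Real.exp (C * r * |τ|) := by
      intro τ
      by_cases h0 : r = 0
      · simp [h0]
      · rw [ha, if_neg h0, hC]
        have h1 : C₁ * (Cs * (2 * r)) ≤ (C₁ * (Cs * 2) + 1) * r := by linarith
        gcongr
    have hboot := bootstrap (g := fun τ => hsNorm s (V τ)) (a := a)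
      (h.flow.continuousOn_hsNorm.mono hJ)
      (lt_of_le_of_lt (hsNorm_le_of_Hs_le hr hV0) hra) fun τ hτ hσ => by
        refine lt_of_le_of_lt (hsNorm_le_of_Hs_le (by positivity)
          ((hstep τ hτ hσ).trans (ENNReal.ofReal_le_ofReal (hrexp τ)))) ?_
        by_cases h0 : r = 0
        · rw [h0, zero_mul]
          linarith
        · rw [ha, if_neg h0, mul_comm 2 r]
          have hrpos : 0 < r := lt_of_le_of_ne hr (Ne.symm h0)
          refine mul_lt_mul_of_pos_left (lt_of_le_of_lt (Real.exp_le_exp.2 ?_) hexp) hrpos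
          have h5 : |τ| * r ≤ |t| * r := mul_le_mul_of_nonneg_right (abs_le_of_mem_uIcc hτ) hr
          calc C * r * |τ| = C * (|τ| * r) := by ring
            _ ≤ C * T := by
              gcongr
              exact h5.trans htr
    exact (hstep t Set.right_mem_uIcc fun σ hσ => (hboot σ hσ).le).trans
      (ENNReal.ofReal_le_ofReal (hrexp t))
  intro t htr
  have hexp2 : ∀ τ, |τ| * r ≤ T → r * Real.exp (C * r * |τ|) ≤ r * 2 := by
    intro τ hτ
    gcongr
    refine le_trans (Real.exp_le_exp.2 ?_) hexp.le
    calc C * r * |τ| = C * (|τ| * r) := by ring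
      _ ≤ C * T := by gcongr
  have ht : t ∈ J := galerkin_continuation A hA hs h (R := r * 2) fun τ hτ hτt => by
    have h5 : |τ| * r ≤ T := 
      (mul_le_mul_of_nonneg_right (abs_le_of_mem_uIcc hτt) hr).trans htr
    exact (key τ hτ h5).trans (ENNReal.ofReal_le_ofReal (hexp2 τ h5))
  exact ⟨ht, key t ht htr⟩

end GalerkinGlobal

/-! ### Convergence of the Galerkin approximations and uniqueness -/

section Convergence

variable {d n : ℕ}

/-- Interpolation: an `L²` error of order `N^{-s}` and a bound in `H^s` give convergence in the
Wiener norm. -/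
lemma exists_n1_interp {s : ℝ} (hs : (d : ℝ) / 2 + 1 < s) :
    ∃ γ : ℝ, 0 < γ ∧ γ ≤ s ∧ ∃ C : ℝ≥0, ∀ (N : ℕ) (x : (Fin d → ℤ) → ℝ≥0∞) (a b : ℝ), 1 ≤ N →
      0 ≤ a → 0 ≤ b → N2 x ≤ ENNReal.ofReal (a * (N : ℝ) ^ (-s)) → nH s x ≤ ENNReal.ofReal b →
      n1 x ≤ ENNReal.ofReal (C * (a + b) * (N : ℝ) ^ (-γ)) := by
  have hd : (0 : ℝ) ≤ d := by positivity
  set γ : ℝ := (s - (d / 2 + 1)) / 2 with hγ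
  obtain ⟨C, hC⟩ := n1_le_nH (d := d) (s := s - γ) (by rw [hγ]; linarith)
  refine ⟨γ, by rw [hγ]; linarith, by rw [hγ]; linarith, C, fun N x a b hN ha hb h1 h2 => ?_⟩
  have hN0 : (0 : ℝ) < N := by exact_mod_cast hN
  refine (hC x).trans ?_
  have h3 := nH_interp (lam := (N : ℝ)) (r := s - γ) (s := s) hN0 (by rw [hγ]; linarith)
    (by rw [hγ]; linarith) x
  rw [nH_zero_eq] at h3
  calc C * nH (s - γ) x ≤ C * (ENNReal.ofReal ((N : ℝ) ^ (s - γ)) *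
        ENNReal.ofReal (a * (N : ℝ) ^ (-s)) + ENNReal.ofReal ((N : ℝ) ^ (s - γ - s)) *
          ENNReal.ofReal b) := by
        gcongr
        exact h3.trans (by gcongr)
    _ = ENNReal.ofReal (C * ((N : ℝ) ^ (s - γ) * (a * (N : ℝ) ^ (-s))
        + (N : ℝ) ^ (s - γ - s) * b)) := by
        rw [← ENNReal.ofReal_mul (by positivity), ← ENNReal.ofReal_mul (by positivity),
          ← ENNReal.ofReal_add (by positivity) (by positivity), ← ENNReal.ofReal_coe_nnreal,
          ← ENNReal.ofReal_mul NNReal.zero_le_coe]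
    _ = _ := by
        congr 1
        have e1 : (N : ℝ) ^ (s - γ) * (N : ℝ) ^ (-s) = (N : ℝ) ^ (-γ) := by
          rw [← Real.rpow_add hN0]
          ring_nf
        have e2 : (N : ℝ) ^ (s - γ - s) = (N : ℝ) ^ (-γ) := by ring_nf
        rw [e2, ← e1]
        ring

lemma vc_boxCoeff_initial {N : ℕ} {u v : Func d n} (h : vc u = boxCoeff N v) :
    (∀ k ∈ box d N, vc u k = vc v k) ∧ ∀ s, Hs s u ≤ Hs s v := by
  constructor
  · intro k hk
    rw [h, boxCoeff, if_pos hk]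
  · intro s
    refine nH_mono fun k => ?_
    rw [ev, h, boxCoeff]
    split_ifs
    · exact le_rfl
    · simp

/-- The Galerkin approximations exist as long as the solution does, and converge to it. -/
lemma exists_approx (A : Coefficients d n)
    (hA : ∀ (j : Fin d) (u : Fin n → ℝ), (A.at j u).IsHermitian) {s : ℝ}
    (hs : (d : ℝ) / 2 + 1 < s) (L B : ℝ) :
    ∃ N₀ : ℕ, 1 ≤ N₀ ∧ ∃ K : ℝ, 0 < K ∧ ∀ (U : ℝ → Func d n) (t m : ℝ),
      ModeFlow A Set.univ (Set.uIcc 0 t) U → 0 ≤ m → m ≤ B → |t| ≤ L →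
      (∀ τ ∈ Set.uIcc 0 t, Hs s (U τ) ≤ ENNReal.ofReal m) →
      ∀ N, N₀ ≤ N → ∀ (u : Func d n) (J : Set ℝ) (V : ℝ → Func d n), vc u = boxCoeff N (U 0) →
        IsMaxFlow A (box d N) s u J V →
        t ∈ J ∧ N2 (fun k => ‖vc (U t) k - vc (V t) k‖ₑ) ≤ ENNReal.ofReal (K * m * (N : ℝ) ^ (-s)) ∧
          Hs s (V t) ≤ ENNReal.ofReal (K * m) := by
  have hd : (0 : ℝ) ≤ d := by positivity
  have hs0 : 0 ≤ s := by linarith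
  obtain ⟨Cs, hCs⟩ := n1_le_nH (d := d) hs
  obtain ⟨γ, hγ0, -, Ci, hCi⟩ := exists_n1_interp (d := d) hs
  -- a bound for the Wiener norm of `V`, valid as long as it is at distance at most `1` from `U`,
  -- and the resulting growth factor `X₁` of the `H^s` norm
  set R₁ : ℝ := Cs * |B| + 1 with hR₁
  obtain ⟨C₁, hC₁, hE⟩ := exists_energy_bound A hA (by linarith : 1 ≤ s) R₁
  set X₁ : ℝ := Real.exp (C₁ * R₁ * |L|) with hX₁
  -- the rough bound for `V` in `H^s` that the continuity method improves to `m * X₁ < a`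
  set a : ℝ := |B| * X₁ + 1 with ha
  obtain ⟨C₂, hC₂, hcomp⟩ := exists_compare_bound A hA hs (|B| + Cs * a)
  set X₂ : ℝ := Real.exp (C₂ * (|B| + Cs * a) * |L|) with hX₂
  have hR₁0 : 0 < R₁ := by positivity
  have ha0 : 0 < a := by positivity
  -- for large `N` the error in the Wiener norm is at most `1`
  have hlim : Filter.Tendsto (fun N : ℕ => Ci * (12 * 4 ^ s * |B| * X₂ + (|B| + a)) *
      (N : ℝ) ^ (-γ)) Filter.atTop (𝓝 0) := by
    have := ((tendsto_rpow_neg_atTop hγ0).comp tendsto_natCast_atTop_atTop).const_mul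
      (Ci * (12 * 4 ^ s * |B| * X₂ + (|B| + a)))
    rwa [mul_zero] at this
  obtain ⟨N₁, hN₁⟩ := Filter.eventually_atTop.1 (hlim.eventually_le_const one_pos)
  refine ⟨max N₁ 1, le_max_right _ _, 12 * 4 ^ s * X₂ + X₁, by positivity, ?_⟩
  intro U t m hU hm hmB htL hUm N hN u J V hu h
  have hN1 : 1 ≤ N := (le_max_right _ _).trans hN
  have hNsmall := hN₁ N ((le_max_left _ _).trans hN)
  have hmB' : m ≤ |B| := hmB.trans (le_abs_self B)
  have htL' : |t| ≤ |L| := htL.trans (le_abs_self L)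
  obtain ⟨hinit, hinitH⟩ := vc_boxCoeff_initial hu
  have hV0 : Hs s (V 0) ≤ ENNReal.ofReal m := by
    rw [h.init]
    exact (hinitH s).trans (hUm 0 Set.left_mem_uIcc)
  -- consequences of the rough bound by `a`
  have hW_of : ∀ σ ∈ J, hsNorm s (V σ) ≤ a → W1 (V σ) ≤ ENNReal.ofReal (Cs * a) := by
    intro σ hσ hle
    rw [ENNReal.ofReal_mul NNReal.zero_le_coe, ENNReal.ofReal_coe_nnreal]
    refine (hCs _).trans (mul_le_mul' le_rfl ?_)
    change Hs s (V σ) ≤ _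
    rw [(h.flow.memHs hσ).Hs_eq]
    exact ENNReal.ofReal_le_ofReal hle
  have hN2 : ∀ τ ∈ J, τ ∈ Set.uIcc 0 t → (∀ σ ∈ Set.uIcc 0 τ, hsNorm s (V σ) ≤ a) →
      N2 (fun k => ‖vc (U τ) k - vc (V τ) k‖ₑ)
        ≤ ENNReal.ofReal (12 * 4 ^ s * m * X₂ * (N : ℝ) ^ (-s)) := by
    intro τ hτJ hτ hσ
    have hsub := h.flow.uIcc_subset hτJ
    have hsub2 : Set.uIcc 0 τ ⊆ Set.uIcc 0 t := Set.uIcc_subset_uIcc_left hτ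
    refine (hcomp N Set.univ _ _ (lowPass_cutoff hN1 hs0 (Set.subset_univ _)) U V τ m (Cs * a)
      (hU.mono hsub2) (h.flow.toModeFlow.mono hsub) hm
      (hmB'.trans (le_add_of_nonneg_right (by positivity)))
      (by positivity) (by linarith [abs_nonneg B]) (fun σ hσ => hUm σ (hsub2 hσ))
      (fun σ hσ' => hW_of σ (hsub hσ') (hσ σ hσ')) (by rw [h.init]; exact hinit)).trans ?_
    refine ENNReal.ofReal_le_ofReal ?_
    have hexp : Real.exp (C₂ * (m + Cs * a) * |τ|) ≤ X₂ := by
      rw [hX₂]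
      have := (abs_le_of_mem_uIcc hτ).trans htL'
      gcongr
    calc _ ≤ 3 * (4 * 4 ^ s * (N : ℝ) ^ (-s)) * m * X₂ := by gcongr
      _ = _ := by ring
  have hstep : ∀ τ ∈ J, τ ∈ Set.uIcc 0 t → (∀ σ ∈ Set.uIcc 0 τ, hsNorm s (V σ) ≤ a) →
      Hs s (V τ) ≤ ENNReal.ofReal (m * X₁) := by
    intro τ hτJ hτ hσ
    have hsub := h.flow.uIcc_subset hτJ
    have hsub2 : Set.uIcc 0 τ ⊆ Set.uIcc 0 t := Set.uIcc_subset_uIcc_left hτ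
    refine (hE N V τ R₁ m (h.flow.toModeFlow.mono hsub) hR₁0.le le_rfl hm (fun σ hσ' => ?_)
      hV0).trans (ENNReal.ofReal_le_ofReal ?_)
    · have hσJ := hsub hσ'
      have hσt := hsub2 hσ'
      have hUσ := hUm σ hσt
      have e1 := hN2 σ hσJ hσt fun ρ hρ => hσ ρ (Set.uIcc_subset_uIcc_left hσ' hρ)
      have e2 : nH s (fun k => ‖vc (U σ) k - vc (V σ) k‖ₑ) ≤ ENNReal.ofReal (m + a) := by
        refine (nH_mono fun k => enorm_sub_le).trans ((nH_add_le s (ev (U σ)) (ev (V σ))).trans ?_)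
        rw [ENNReal.ofReal_add hm ha0.le]
        refine add_le_add hUσ ?_
        change Hs s (V σ) ≤ _
        rw [(h.flow.memHs hσJ).Hs_eq]
        exact ENNReal.ofReal_le_ofReal (hσ σ hσ')
      have e3 := hCi N _ (12 * 4 ^ s * m * X₂) (m + a) hN1 (by positivity) (by positivity) e1 e2
      have e4 : n1 (fun k => ‖vc (U σ) k - vc (V σ) k‖ₑ) ≤ ENNReal.ofReal 1 := by
        refine e3.trans (ENNReal.ofReal_le_ofReal (le_trans ?_ hNsmall))
        gcongr
      have e5 : W1 (V σ) ≤ n1 (fun k => ‖vc (U σ) k - vc (V σ) k‖ₑ) + W1 (U σ) := by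
        unfold W1
        rw [← n1_add]
        refine n1_mono fun k => ?_
        calc ‖vc (V σ) k‖ₑ = ‖-(vc (U σ) k - vc (V σ) k) + vc (U σ) k‖ₑ := by congr 1; abel
          _ ≤ ‖vc (U σ) k - vc (V σ) k‖ₑ + ‖vc (U σ) k‖ₑ := by
            refine (enorm_add_le _ _).trans ?_
            rw [enorm_neg]
      refine e5.trans ?_
      rw [hR₁, add_comm, ENNReal.ofReal_add (by positivity) zero_le_one,
        ENNReal.ofReal_mul NNReal.zero_le_coe, ENNReal.ofReal_coe_nnreal]
      refine add_le_add ((hCs _).trans (mul_le_mul' le_rfl ?_)) e4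
      exact hUσ.trans (ENNReal.ofReal_le_ofReal hmB')
    · have := (abs_le_of_mem_uIcc hτ).trans htL'
      rw [hX₁]
      gcongr
  have hbootJ : ∀ τ ∈ J, τ ∈ Set.uIcc 0 t → ∀ σ ∈ Set.uIcc 0 τ, hsNorm s (V σ) ≤ a := by
    intro τ hτJ hτ σ hσ
    have hsub := h.flow.uIcc_subset hτJ
    have hlt : m * X₁ < a := by
      rw [ha]
      have : m * X₁ ≤ |B| * X₁ := by gcongr
      linarith
    refine (bootstrap (g := fun τ => hsNorm s (V τ)) (h.flow.continuousOn_hsNorm.mono hsub)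
      (lt_of_le_of_lt (hsNorm_le_of_Hs_le (mul_nonneg hm (Real.exp_pos _).le) (hV0.trans
        (ENNReal.ofReal_le_ofReal ?_))) hlt) (fun ρ hρ hle => lt_of_le_of_lt
        (hsNorm_le_of_Hs_le (mul_nonneg hm (Real.exp_pos _).le) (hstep ρ (hsub hρ)
          (Set.uIcc_subset_uIcc_left hτ hρ) hle)) hlt) σ hσ).le
    exact le_mul_of_one_le_right hm (Real.one_le_exp (by positivity))
  have htJ : t ∈ J := galerkin_continuation A hA hs h (R := m * X₁) fun τ hτJ hτ =>
    hstep τ hτJ hτ (hbootJ τ hτJ hτ)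
  have hb := hbootJ t htJ Set.right_mem_uIcc
  refine ⟨htJ, (hN2 t htJ Set.right_mem_uIcc hb).trans (ENNReal.ofReal_le_ofReal ?_),
    (hstep t htJ Set.right_mem_uIcc hb).trans (ENNReal.ofReal_le_ofReal ?_)⟩
  · have : 0 ≤ m * X₁ := by positivity
    refine mul_le_mul_of_nonneg_right ?_ (by positivity)
    linarith
  · have : 0 ≤ 12 * 4 ^ s * X₂ * m := by positivity
    linarith

/-- Uniqueness for the hyperbolic system: two solutions with the same data are limits of the same
Galerkin approximations. Only boundedness in `H^s` is needed. -/
lemma modeFlow_unique (A : Coefficients d n)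
    (hA : ∀ (j : Fin d) (u : Fin n → ℝ), (A.at j u).IsHermitian) {s : ℝ}
    (hs : (d : ℝ) / 2 + 1 < s) {U U' : ℝ → Func d n} {t m : ℝ} (hm : 0 ≤ m)
    (hU : ModeFlow A Set.univ (Set.uIcc 0 t) U) (hU' : ModeFlow A Set.univ (Set.uIcc 0 t) U')
    (hb : ∀ τ ∈ Set.uIcc 0 t, Hs s (U τ) ≤ ENNReal.ofReal m)
    (hb' : ∀ τ ∈ Set.uIcc 0 t, Hs s (U' τ) ≤ ENNReal.ofReal m) (h0 : U 0 = U' 0) :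
    U t = U' t := by
  have hd : (0 : ℝ) ≤ d := by positivity
  obtain ⟨N₀, hN₀, K, hK, hmain⟩ := exists_approx A hA hs |t| m
  have hle : ∀ N, N₀ ≤ N → N2 (fun k => ‖vc (U t) k - vc (U' t) k‖ₑ)
      ≤ ENNReal.ofReal (2 * (K * m) * (N : ℝ) ^ (-s)) := by
    intro N hN
    obtain ⟨J, V, hV⟩ := exists_galerkin_max A hA hs (N := N) (reg_sharpFilter N (U 0))
      (fun k hk => by rw [vc_sharpFilter, boxCoeff_eq_zero hk])
    obtain ⟨-, h1, -⟩ := hmain U t m hU hm le_rfl le_rfl hb N hN _ J V (vc_sharpFilter N (U 0)) hV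
    obtain ⟨-, h2, -⟩ := hmain U' t m hU' hm le_rfl le_rfl hb' N hN _ J V
      (by rw [vc_sharpFilter, h0]) hV
    calc _ ≤ N2 (fun k => ‖vc (U t) k - vc (V t) k‖ₑ)
          + N2 (fun k => ‖vc (U' t) k - vc (V t) k‖ₑ) := by
          refine (N2_mono fun k => ?_).trans (N2_add_le _ _)
          have : vc (U t) k - vc (U' t) k
              = (vc (U t) k - vc (V t) k) - (vc (U' t) k - vc (V t) k) := by abel
          rw [this]
          exact enorm_sub_le
      _ ≤ _ := by
          refine (add_le_add h1 h2).trans ?_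
          rw [← ENNReal.ofReal_add (by positivity) (by positivity)]
          exact ENNReal.ofReal_le_ofReal (by linarith)
  have hlim : Filter.Tendsto (fun N : ℕ => ENNReal.ofReal (2 * (K * m) * (N : ℝ) ^ (-s)))
      Filter.atTop (𝓝 0) := by
    have h1 := ((tendsto_rpow_neg_atTop (by linarith : 0 < s)).comp
      tendsto_natCast_atTop_atTop).const_mul (2 * (K * m))
    rw [mul_zero] at h1
    have h2 := ENNReal.tendsto_ofReal h1
    rwa [ENNReal.ofReal_zero] at h2
  have hz := ge_of_tendsto hlim (Filter.eventually_atTop.2 ⟨N₀, hle⟩)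
  exact (hU.reg t Set.right_mem_uIcc).ext_vc (hU'.reg t Set.right_mem_uIcc)
    (vc_eq_of_N2_eq_zero (le_antisymm hz zero_le))

lemma uniqueFlow_univ (A : Coefficients d n)
    (hA : ∀ (j : Fin d) (u : Fin n → ℝ), (A.at j u).IsHermitian) {s : ℝ}
    (hs : (d : ℝ) / 2 + 1 < s) : UniqueFlow A Set.univ s := by
  intro J J' U U' hU hU' h0 t ht
  obtain ⟨m, hm0, hm⟩ := hU.exists_bound ht.1
  obtain ⟨m', hm'0, hm'⟩ := hU'.exists_bound ht.2
  exact modeFlow_unique A hA hs (add_nonneg hm0 hm'0) (hU.toModeFlow.mono (hU.uIcc_subset ht.1))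
    (hU'.toModeFlow.mono (hU'.uIcc_subset ht.2))
    (fun τ hτ => (hm τ hτ).trans (ENNReal.ofReal_le_ofReal (by linarith)))
    (fun τ hτ => (hm' τ hτ).trans (ENNReal.ofReal_le_ofReal (by linarith))) h0

end Convergence

/-! ### Existence for the hyperbolic system -/

section Limits

variable {d : ℕ} {E : Type*} [NormedAddCommGroup E]

/-- Lower semicontinuity of the weighted `ℓ²` norms under coefficientwise convergence. -/
lemma nH_le_of_tendsto (r : ℝ) {α : Type*} {l : Filter α} [l.NeBot] {x : α → (Fin d → ℤ) → E}
    {c : (Fin d → ℤ) → E} {a : ℝ≥0∞} (h : ∀ k, Filter.Tendsto (fun i => x i k) l (𝓝 (c k)))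
    (hb : ∀ᶠ i in l, nH r (fun k => ‖x i k‖ₑ) ≤ a) : nH r (fun k => ‖c k‖ₑ) ≤ a := by
  rw [nH, N2_le_iff, ENNReal.tsum_eq_iSup_sum]
  refine iSup_le fun F => ?_
  have h1 : Filter.Tendsto (fun i => ∑ k ∈ F, (wt r k * ‖x i k‖ₑ) ^ 2) l
      (𝓝 (∑ k ∈ F, (wt r k * ‖c k‖ₑ) ^ 2)) :=
    tendsto_finsetSum F fun k _ => ENNReal.Tendsto.pow
      (ENNReal.Tendsto.const_mul (h k).enorm (Or.inr (wt_ne_top r k)))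
  refine le_of_tendsto h1 ?_
  filter_upwards [hb] with i hi
  exact (ENNReal.sum_le_tsum F).trans (N2_le_iff.1 hi)

lemma parallelogram_enorm [InnerProductSpace ℂ E] (x y : E) :
    ‖x - y‖ₑ ^ 2 + ‖x + y‖ₑ ^ 2 = 2 * ‖x‖ₑ ^ 2 + 2 * ‖y‖ₑ ^ 2 := by
  have h := parallelogram_law_with_norm ℂ x y
  have e : ‖x - y‖ ^ 2 + ‖x + y‖ ^ 2 = 2 * ‖x‖ ^ 2 + 2 * ‖y‖ ^ 2 := by nlinarith
  simp_rw [← ofReal_norm]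
  rw [← ENNReal.ofReal_pow (norm_nonneg _), ← ENNReal.ofReal_pow (norm_nonneg _),
    ← ENNReal.ofReal_pow (norm_nonneg _), ← ENNReal.ofReal_pow (norm_nonneg _),
    ← ENNReal.ofReal_add (by positivity) (by positivity), e,
    ENNReal.ofReal_add (by positivity) (by positivity), ENNReal.ofReal_mul (by norm_num),
    ENNReal.ofReal_mul (by norm_num)]
  simp

/-- Coefficientwise convergence and convergence of the bounds for the norms imply convergence in
norm. -/
lemma tendsto_nH_sub [InnerProductSpace ℂ E] (r : ℝ) {α : Type*} {l : Filter α}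
    {x : α → (Fin d → ℤ) → E} {c : (Fin d → ℤ) → E} {b : α → ℝ} {β : ℝ} (hβ : 0 ≤ β)
    (h : ∀ k, Filter.Tendsto (fun i => x i k) l (𝓝 (c k)))
    (hb : ∀ᶠ i in l, nH r (fun k => ‖x i k‖ₑ) ≤ ENNReal.ofReal (b i))
    (hc : nH r (fun k => ‖c k‖ₑ) = ENNReal.ofReal β) (hbβ : Filter.Tendsto b l (𝓝 β)) :
    Filter.Tendsto (fun i => nH r (fun k => ‖x i k - c k‖ₑ)) l (𝓝 0) := by
  have hcsum : ∑' k, (wt r k * ‖c k‖ₑ) ^ 2 = ENNReal.ofReal (β ^ 2) := by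
    rw [← N2_sq, ENNReal.ofReal_pow hβ, ← hc]
    rfl
  have hterm : ∀ z : (Fin d → ℤ) → E, ∀ k, (wt r k * ‖z k‖ₑ) ^ 2
      = ENNReal.ofReal ((jb k ^ r) ^ 2 * ‖z k‖ ^ 2) := fun z k => by
    rw [wt, ← ofReal_norm, ← ENNReal.ofReal_mul (jb_rpow_pos _ _).le,
      ← ENNReal.ofReal_pow (mul_nonneg (jb_rpow_pos _ _).le (norm_nonneg _)), mul_pow]
  rw [ENNReal.tendsto_nhds_zero]
  intro ε hε
  obtain ⟨η, hη0, hηε⟩ : ∃ η : ℝ, 0 < η ∧ ENNReal.ofReal η ≤ ε ^ 2 := by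
    have h0 : (0 : ℝ≥0∞) < ε ^ 2 := by positivity
    obtain ⟨η, hη, hη2⟩ := ENNReal.lt_iff_exists_nnreal_btwn.1 h0
    exact ⟨η, by exact_mod_cast hη, by rw [ENNReal.ofReal_coe_nnreal]; exact hη2.le⟩
  -- a finite set of frequencies that carries most of the norm of the limit
  obtain ⟨F, hF⟩ : ∃ F : Finset (Fin d → ℤ),
      4 * β ^ 2 - 4 * ∑ k ∈ F, (jb k ^ r) ^ 2 * ‖c k‖ ^ 2 < η := by
    have h1 := (ENNReal.summable (f := fun k => (wt r k * ‖c k‖ₑ) ^ 2)).hasSum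
    rw [hcsum] at h1
    have h2 : Filter.Tendsto (fun F : Finset (Fin d → ℤ) =>
        (∑ k ∈ F, (wt r k * ‖c k‖ₑ) ^ 2).toReal) Filter.atTop (𝓝 (β ^ 2)) := by
      have := (ENNReal.tendsto_toReal ENNReal.ofReal_ne_top).comp h1
      rwa [ENNReal.toReal_ofReal (by positivity)] at this
    have h3 : Filter.Tendsto (fun F : Finset (Fin d → ℤ) =>
        4 * β ^ 2 - 4 * ∑ k ∈ F, (jb k ^ r) ^ 2 * ‖c k‖ ^ 2) Filter.atTop (𝓝 0) := by
      have := (h2.const_mul 4).const_sub (4 * β ^ 2)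
      rw [sub_self] at this
      refine this.congr fun F => ?_
      congr 2
      simp_rw [hterm]
      rw [← ENNReal.ofReal_sum_of_nonneg fun _ _ => by positivity,
        ENNReal.toReal_ofReal (Finset.sum_nonneg fun _ _ => by positivity)]
    exact (h3.eventually_lt_const hη0).exists
  set p : α → ℝ := fun i => ∑ k ∈ F, (jb k ^ r) ^ 2 * ‖x i k + c k‖ ^ 2 with hp
  have hplim : Filter.Tendsto (fun i => 2 * b i ^ 2 + 2 * β ^ 2 - p i) l
      (𝓝 (4 * β ^ 2 - 4 * ∑ k ∈ F, (jb k ^ r) ^ 2 * ‖c k‖ ^ 2)) := by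
    have h1 : Filter.Tendsto p l (𝓝 (∑ k ∈ F, (jb k ^ r) ^ 2 * ‖c k + c k‖ ^ 2)) :=
      tendsto_finsetSum F fun k _ => (((h k).add_const (c k)).norm.pow 2).const_mul _
    have h2 := (((hbβ.pow 2).const_mul 2).add_const (2 * β ^ 2)).sub h1
    convert h2 using 2
    have e : ∀ k, ‖c k + c k‖ = 2 * ‖c k‖ := fun k => by
      rw [← two_smul ℂ, norm_smul]
      simp
    simp_rw [e]
    rw [Finset.mul_sum]
    congr 1
    · ring
    · exact Finset.sum_congr rfl fun k _ => by ring
  filter_upwards [hb, hplim.eventually_lt_const hF, hbβ.eventually_mem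
    (Ioi_mem_nhds (show β - 1 < β by linarith))] with i hi hpi _
  rw [nH, N2_le_iff]
  refine le_trans ?_ hηε
  have hsum : ∑' k, (wt r k * ‖x i k - c k‖ₑ) ^ 2 + ∑' k, (wt r k * ‖x i k + c k‖ₑ) ^ 2
      = 2 * ∑' k, (wt r k * ‖x i k‖ₑ) ^ 2 + 2 * ∑' k, (wt r k * ‖c k‖ₑ) ^ 2 := by
    rw [← ENNReal.tsum_add, ← ENNReal.tsum_mul_left, ← ENNReal.tsum_mul_left, ← ENNReal.tsum_add]
    refine tsum_congr fun k => ?_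
    simp_rw [mul_pow]
    rw [← mul_add, parallelogram_enorm]
    ring
  have hxsum : ∑' k, (wt r k * ‖x i k‖ₑ) ^ 2 ≤ ENNReal.ofReal (b i ^ 2) := by
    refine (N2_le_iff.1 hi).trans ?_
    rcases le_total 0 (b i) with h0 | h0
    · rw [ENNReal.ofReal_pow h0]
    · rw [ENNReal.ofReal_of_nonpos h0]
      simp
  have hpsum : ENNReal.ofReal (p i) ≤ ∑' k, (wt r k * ‖x i k + c k‖ₑ) ^ 2 := by
    rw [hp, ENNReal.ofReal_sum_of_nonneg fun _ _ => by positivity]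
    refine le_trans (le_of_eq (Finset.sum_congr rfl fun k _ => ?_)) (ENNReal.sum_le_tsum F)
    exact (hterm (fun k => x i k + c k) k).symm
  have hle : ∑' k, (wt r k * ‖x i k - c k‖ₑ) ^ 2 + ENNReal.ofReal (p i)
      ≤ ENNReal.ofReal (2 * b i ^ 2 + 2 * β ^ 2) := by
    calc _ ≤ ∑' k, (wt r k * ‖x i k - c k‖ₑ) ^ 2 + ∑' k, (wt r k * ‖x i k + c k‖ₑ) ^ 2 := by
          gcongr
      _ ≤ 2 * ENNReal.ofReal (b i ^ 2) + 2 * ENNReal.ofReal (β ^ 2) := by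
          rw [hsum, hcsum]
          gcongr
      _ = _ := by
          rw [ENNReal.ofReal_add (by positivity) (by positivity), ENNReal.ofReal_mul (by norm_num),
            ENNReal.ofReal_mul (by norm_num)]
          simp
  calc _ ≤ ENNReal.ofReal (2 * b i ^ 2 + 2 * β ^ 2) - ENNReal.ofReal (p i) :=
        ENNReal.le_sub_of_add_le_right ENNReal.ofReal_ne_top hle
    _ = ENNReal.ofReal (2 * b i ^ 2 + 2 * β ^ 2 - p i) :=
        (ENNReal.ofReal_sub _ (Finset.sum_nonneg fun _ _ => by positivity)).symm
    _ ≤ ENNReal.ofReal η := ENNReal.ofReal_le_ofReal hpi.le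

end Limits

section Existence

variable {d n : ℕ}

/-- The distance of a Galerkin approximation to a solution with more frequencies and the same
initial low frequencies, on a time interval of length inversely proportional to the size of the
solutions. -/
lemma exists_galerkin_error (A : Coefficients d n)
    (hA : ∀ (j : Fin d) (u : Fin n → ℝ), (A.at j u).IsHermitian) {s : ℝ}
    (hs : (d : ℝ) / 2 + 1 < s) (R T : ℝ) :
    ∃ K : ℝ, 0 < K ∧ ∀ (r : ℝ) (N : ℕ) (S : Set (Fin d → ℤ)) (U V : ℝ → Func d n) (t : ℝ),
      0 ≤ r → r ≤ R → 1 ≤ N → (box d N : Set (Fin d → ℤ)) ⊆ S → |t| * r ≤ T →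
      ModeFlow A S (Set.uIcc 0 t) U → ModeFlow A (box d N) (Set.uIcc 0 t) V →
      (∀ k ∈ box d N, vc (V 0) k = vc (U 0) k) →
      (∀ τ ∈ Set.uIcc 0 t, Hs s (U τ) ≤ ENNReal.ofReal r) →
      (∀ τ ∈ Set.uIcc 0 t, Hs s (V τ) ≤ ENNReal.ofReal r) →
      N2 (fun k => ‖vc (U t) k - vc (V t) k‖ₑ) ≤ ENNReal.ofReal (K * r * (N : ℝ) ^ (-s)) := by
  have hd : (0 : ℝ) ≤ d := by positivity
  have hs0 : 0 ≤ s := by linarith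
  obtain ⟨Cs, hCs⟩ := n1_le_nH (d := d) hs
  obtain ⟨C, hC, hcomp⟩ := exists_compare_bound A hA hs ((1 + Cs) * R)
  refine ⟨12 * 4 ^ s * Real.exp (C * (1 + Cs) * T), by positivity, ?_⟩
  intro r N S U V t hr hrR hN hsub htr hU hV h0 hbU hbV
  have hCsr : 0 ≤ (Cs : ℝ) * r := by positivity
  have hle : (1 + Cs : ℝ) * r ≤ (1 + Cs) * R := by gcongr
  refine (hcomp N S _ _ (lowPass_cutoff hN hs0 hsub) U V t r (Cs * r) hU hV hr
    (by linarith) hCsr (by linarith) hbU (fun τ hτ => ?_) h0).trans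
    (ENNReal.ofReal_le_ofReal ?_)
  · rw [ENNReal.ofReal_mul NNReal.zero_le_coe, ENNReal.ofReal_coe_nnreal]
    exact (hCs _).trans (mul_le_mul' le_rfl (hbV τ hτ))
  · have hexp : Real.exp (C * (r + Cs * r) * |t|) ≤ Real.exp (C * (1 + Cs) * T) := by
      refine Real.exp_le_exp.2 ?_
      calc C * (r + Cs * r) * |t| = C * (1 + Cs) * (|t| * r) := by ring
        _ ≤ _ := by gcongr
    calc _ ≤ 3 * (4 * 4 ^ s * (N : ℝ) ^ (-s)) * r * Real.exp (C * (1 + Cs) * T) := by gcongr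
      _ = _ := by ring

/-- Existence for the hyperbolic system, as a limit of Galerkin approximations: the solution is
bounded in `H^s` and its Fourier coefficients solve the system. -/
lemma exists_modeFlow_univ (A : Coefficients d n)
    (hA : ∀ (j : Fin d) (u : Fin n → ℝ), (A.at j u).IsHermitian) {s : ℝ}
    (hs : (d : ℝ) / 2 + 1 < s) (M : ℝ) :
    ∃ C T : ℝ, 0 < C ∧ 0 < T ∧ Real.exp (C * T) ≤ 2 ∧ ∀ (u : Func d n) (r : ℝ), Reg u → 0 ≤ r →
      r ≤ M → Hs s u ≤ ENNReal.ofReal r →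
      ∃ U, ModeFlow A Set.univ {t | |t| * r < T} U ∧ U 0 = u ∧
        ∀ t, |t| * r < T → Hs s (U t) ≤ ENNReal.ofReal (r * Real.exp (C * r * |t|)) := by
  have hd : (0 : ℝ) ≤ d := by positivity
  have hs0 : 0 < s := by linarith
  obtain ⟨C, T, hC, hT, hexp, hgal⟩ := exists_galerkin_bound A hA hs M
  refine ⟨C, T, hC, hT, hexp, fun u r hu hr hrM hur => ?_⟩
  choose JN V hV using fun N : ℕ => exists_galerkin_max A hA hs (N := N) (reg_sharpFilter N u)
    (fun k hk => by rw [vc_sharpFilter, boxCoeff_eq_zero hk])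
  set I : Set ℝ := {t | |t| * r < T} with hI
  have hIo : IsOpen I := isOpen_lt (by fun_prop) continuous_const
  have hIsub : ∀ t ∈ I, Set.uIcc 0 t ⊆ I := fun t ht τ hτ =>
    lt_of_le_of_lt (mul_le_mul_of_nonneg_right (abs_le_of_mem_uIcc hτ) hr) ht
  have hV0 : ∀ N, vc (V N 0) = boxCoeff N u := fun N => by rw [(hV N).init, vc_sharpFilter]
  have hVb : ∀ N, ∀ t ∈ I, t ∈ JN N ∧ Hs s (V N t) ≤ ENNReal.ofReal (r * Real.exp (C * r * |t|)) :=
    fun N t ht => hgal N _ r _ _ hr hrM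
      (((vc_boxCoeff_initial (vc_sharpFilter N u)).2 s).trans hur) (hV N) t (le_of_lt ht)
  have hexp2 : ∀ t ∈ I, r * Real.exp (C * r * |t|) ≤ 2 * r := by
    intro t ht
    rw [mul_comm 2 r]
    gcongr
    refine le_trans (Real.exp_le_exp.2 ?_) hexp
    calc C * r * |t| = C * (|t| * r) := by ring
      _ ≤ C * T := by
        gcongr
        exact le_of_lt ht
  have hVb2 : ∀ N, ∀ t ∈ I, Hs s (V N t) ≤ ENNReal.ofReal (2 * r) := fun N t ht =>
    (hVb N t ht).2.trans (ENNReal.ofReal_le_ofReal (hexp2 t ht))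
  have hVm : ∀ N, ModeFlow A (box d N) I (V N) := fun N =>
    (hV N).flow.toModeFlow.mono fun t ht => (hVb N t ht).1
  obtain ⟨K, hK, herr⟩ := exists_galerkin_error A hA hs (2 * |M|) (2 * T)
  have hdiff : ∀ N N', 1 ≤ N → N ≤ N' → ∀ t ∈ I, N2 (fun k => ‖vc (V N' t) k - vc (V N t) k‖ₑ)
      ≤ ENNReal.ofReal (K * (2 * r) * (N : ℝ) ^ (-s)) := by
    intro N N' hN hNN' t ht
    have hsub : (box d N : Set (Fin d → ℤ)) ⊆ box d N' := by exact_mod_cast box_mono hNN'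
    refine herr (2 * r) N (box d N') (V N') (V N) t (by linarith)
      (by linarith [hrM.trans (le_abs_self M)]) hN hsub
      (by have : |t| * r < T := ht; linarith)
      ((hVm N').mono (hIsub t ht)) ((hVm N).mono (hIsub t ht)) (fun k hk => ?_)
      (fun τ hτ => hVb2 N' τ (hIsub t ht hτ)) (fun τ hτ => hVb2 N τ (hIsub t ht hτ))
    have hk' : k ∈ box d N' := hsub hk
    rw [hV0, hV0, boxCoeff, boxCoeff, if_pos hk, if_pos hk']
  have hpow : Filter.Tendsto (fun N : ℕ => (N : ℝ) ^ (-s)) Filter.atTop (𝓝 0) :=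
    (tendsto_rpow_neg_atTop hs0).comp tendsto_natCast_atTop_atTop
  -- the limit of the Fourier coefficients
  have hlim : ∀ t, t ∈ I → ∀ k, ∃ c, Filter.Tendsto (fun N => vc (V N t) k) Filter.atTop (𝓝 c) := by
    intro t ht k
    refine cauchySeq_tendsto_of_complete (Metric.cauchySeq_iff'.2 fun ε hε => ?_)
    have h1 := hpow.const_mul (K * (2 * r))
    rw [mul_zero] at h1
    obtain ⟨N, hN, hN1⟩ := ((h1.eventually_lt_const hε).and (Filter.eventually_ge_atTop 1)).exists
    refine ⟨N, fun N' hN' => ?_⟩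
    rw [dist_eq_norm]
    have h2 := (le_N2 (fun k => ‖vc (V N' t) k - vc (V N t) k‖ₑ) k).trans (hdiff N N' hN1 hN' t ht)
    rw [← ofReal_norm, ENNReal.ofReal_le_ofReal_iff (by positivity)] at h2
    exact lt_of_le_of_lt h2 hN
  choose! c hc using hlim
  have hcV : ∀ N, 1 ≤ N → ∀ t ∈ I, N2 (fun k => ‖c t k - vc (V N t) k‖ₑ)
      ≤ ENNReal.ofReal (K * (2 * r) * (N : ℝ) ^ (-s)) := by
    intro N hN t ht
    have h1 := nH_le_of_tendsto 0 (l := Filter.atTop)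
      (x := fun N' k => vc (V N' t) k - vc (V N t) k)
      (c := fun k => c t k - vc (V N t) k) (a := ENNReal.ofReal (K * (2 * r) * (N : ℝ) ^ (-s)))
      (fun k => (hc t ht k).sub_const _) (by
        filter_upwards [Filter.eventually_ge_atTop N] with N' hN'
        rw [nH_zero_eq]
        exact hdiff N N' hN hN' t ht)
    rwa [nH_zero_eq] at h1
  have hcb : ∀ t ∈ I, nH s (fun k => ‖c t k‖ₑ) ≤ ENNReal.ofReal (r * Real.exp (C * r * |t|)) :=
    fun t ht => nH_le_of_tendsto s (l := Filter.atTop) (hc t ht)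
      (Filter.Eventually.of_forall fun N => (hVb N t ht).2)
  have hherm : ∀ t ∈ I, Hermitian (c t) := by
    intro t ht k i
    have h1 := ((EuclideanSpace.proj i :
      EuclideanSpace ℂ (Fin n) →L[ℂ] ℂ).continuous.tendsto _).comp (hc t ht (-k))
    have h2 := (Complex.continuous_conj.tendsto _).comp
      (((EuclideanSpace.proj i : EuclideanSpace ℂ (Fin n) →L[ℂ] ℂ).continuous.tendsto _).comp
      (hc t ht k))
    exact tendsto_nhds_unique h1 (h2.congr fun N => (hermitian_vc (V N t) k i).symm)
  obtain ⟨Cs, hCs⟩ := n1_le_nH (d := d) hs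
  have hcn : ∀ t ∈ I, n1 (fun k => ‖c t k‖ₑ) ≤ ((Cs * (2 * r).toNNReal : ℝ≥0) : ℝ≥0∞) := by
    intro t ht
    push_cast
    exact (hCs _).trans (mul_le_mul' le_rfl ((hcb t ht).trans
      (ENNReal.ofReal_le_ofReal (hexp2 t ht))))
  set U : ℝ → Func d n := fun t => synth (c t) with hU
  have hUr : ∀ t ∈ I, Reg (U t) ∧ vc (U t) = c t := fun t ht =>
    reg_synth (hherm t ht) (ne_top_of_le_ne_top ENNReal.coe_ne_top (hcn t ht))
  have hUb : ∀ t ∈ I, Hs s (U t) ≤ ENNReal.ofReal (r * Real.exp (C * r * |t|)) := by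
    intro t ht
    unfold Hs ev
    rw [(hUr t ht).2]
    exact hcb t ht
  obtain ⟨γ, hγ, hγs, Ci, hCi⟩ := exists_n1_interp (d := d) hs
  obtain ⟨Ct, hCt⟩ := exists_transport_sub_le A (Cs * (2 * r).toNNReal)
  -- the time derivatives converge as well, in `L²` and uniformly in time
  set Q : ℝ := Ct * (K * (2 * r) + Ci * (K * (2 * r) + (2 * r + 2 * r))) with hQ
  have htrans : ∀ N, 1 ≤ N → ∀ t ∈ I,
      N2 (fun k => ‖vc (transport A (U t)) k - vc (transport A (V N t)) k‖ₑ)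
        ≤ ENNReal.ofReal (Q * (N : ℝ) ^ (-γ)) := by
    intro N hN t ht
    have hN1 : (1 : ℝ) ≤ N := by exact_mod_cast hN
    have e1 : N2 (fun k => ‖vc (U t) k - vc (V N t) k‖ₑ)
        ≤ ENNReal.ofReal (K * (2 * r) * (N : ℝ) ^ (-s)) := by
      rw [(hUr t ht).2]
      exact hcV N hN t ht
    have e2 : nH s (fun k => ‖vc (U t) k - vc (V N t) k‖ₑ) ≤ ENNReal.ofReal (2 * r + 2 * r) := by
      refine (nH_mono fun k => enorm_sub_le).trans ((nH_add_le s (ev (U t)) (ev (V N t))).trans ?_)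
      rw [ENNReal.ofReal_add (by positivity) (by positivity)]
      exact add_le_add ((hUb t ht).trans (ENNReal.ofReal_le_ofReal (hexp2 t ht))) (hVb2 N t ht)
    have e3 := hCi N _ _ _ hN (by positivity) (by positivity) e1 e2
    have hWU : W1 (U t) ≤ ((Cs * (2 * r).toNNReal : ℝ≥0) : ℝ≥0∞) := by
      unfold W1 ev
      rw [(hUr t ht).2]
      exact hcn t ht
    have hWV : W1 (V N t) ≤ ((Cs * (2 * r).toNNReal : ℝ≥0) : ℝ≥0∞) := by
      push_cast
      exact (hCs _).trans (mul_le_mul' le_rfl (hVb2 N t ht))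
    refine (hCt _ _ (hUr t ht).1 ((hVm N).reg t ht) hWU hWV).trans ?_
    calc _ ≤ (Ct : ℝ≥0∞) * (ENNReal.ofReal (K * (2 * r) * (N : ℝ) ^ (-γ))
          + ENNReal.ofReal (Ci * (K * (2 * r) + (2 * r + 2 * r)) * (N : ℝ) ^ (-γ))) := by
          gcongr
          refine e1.trans (ENNReal.ofReal_le_ofReal ?_)
          gcongr
      _ = _ := by
          rw [← ENNReal.ofReal_add (by positivity) (by positivity), ← ENNReal.ofReal_coe_nnreal,
            ← ENNReal.ofReal_mul NNReal.zero_le_coe]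
          congr 1
          ring
  have h0I : (0 : ℝ) ∈ I := by
    change |(0 : ℝ)| * r < T
    simpa using hT
  refine ⟨U, ⟨fun t ht => (hUr t ht).1, fun t _ k hk => absurd (Set.mem_univ k) hk,
    fun t ht k _ => ?_⟩, ?_, fun t ht => hUb t ht⟩
  · refine hasDerivAt_of_tendstoLocallyUniformlyOn (l := Filter.atTop)
      (f := fun (N : ℕ) τ => vc (V N τ) k) (f' := fun (N : ℕ) τ => -vc (transport A (V N τ)) k)
      (g' := fun τ => -vc (transport A (U τ)) k) hIo ?_ ?_ ?_ ht
    · refine TendstoUniformlyOn.tendstoLocallyUniformlyOn (Metric.tendstoUniformlyOn_iff.2 ?_)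
      intro ε hε
      have h1 := ((tendsto_rpow_neg_atTop hγ).comp tendsto_natCast_atTop_atTop).const_mul Q
      rw [mul_zero] at h1
      filter_upwards [h1.eventually_lt_const hε, Filter.eventually_ge_atTop 1] with N hN hN1 τ hτ
      refine lt_of_le_of_lt ?_ hN
      have h2 := (le_N2 (fun k => ‖vc (transport A (U τ)) k - vc (transport A (V N τ)) k‖ₑ) k).trans
        (htrans N hN1 τ hτ)
      rw [← ofReal_norm, ENNReal.ofReal_le_ofReal_iff (by positivity)] at h2
      rwa [dist_neg_neg, dist_eq_norm]
    · obtain ⟨N₀, hN₀⟩ : ∃ N₀ : ℕ, ∀ N, N₀ ≤ N → k ∈ box d N := by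
        refine ⟨⌈jb k⌉₊, fun N hN => mem_box_of_jb_le ?_⟩
        exact (Nat.le_ceil _).trans (by exact_mod_cast hN)
      filter_upwards [Filter.eventually_ge_atTop N₀] with N hN τ hτ
      exact (hVm N).deriv τ hτ k (hN₀ N hN)
    · intro τ hτ
      rw [(hUr τ hτ).2]
      exact hc τ hτ k
  · refine (hUr 0 h0I).1.ext_vc hu ?_
    rw [(hUr 0 h0I).2]
    ext1 k
    refine tendsto_nhds_unique (hc 0 h0I k) (tendsto_const_nhds.congr' ?_)
    filter_upwards [Filter.eventually_ge_atTop ⌈jb k⌉₊] with N hN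
    have hk : k ∈ box d N := mem_box_of_jb_le ((Nat.le_ceil _).trans (by exact_mod_cast hN))
    rw [hV0, boxCoeff, if_pos hk]

/-- Solutions that are bounded in `H^s` are continuous with values in `H^s`: they can be restarted
from any time, and the norm of the restarted solution is at most that of its data plus `O(t)`. -/
lemma ModeFlow.tendsto_Hs_sub {A : Coefficients d n}
    (hA : ∀ (j : Fin d) (u : Fin n → ℝ), (A.at j u).IsHermitian) {s : ℝ}
    (hs : (d : ℝ) / 2 + 1 < s) {J : Set ℝ} (hJ : IsOpen J) {U : ℝ → Func d n}
    (hU : ModeFlow A Set.univ J U) {m : ℝ} (hm : ∀ t ∈ J, Hs s (U t) ≤ ENNReal.ofReal m) {t₀ : ℝ}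
    (ht₀ : t₀ ∈ J) : Filter.Tendsto (fun t => Hs s (U t - U t₀)) (𝓝 t₀) (𝓝 0) := by
  have hfin : Hs s (U t₀) ≠ ∞ := ne_top_of_le_ne_top ENNReal.ofReal_ne_top (hm t₀ ht₀)
  set β : ℝ := (Hs s (U t₀)).toReal with hβ
  have hβ0 : 0 ≤ β := ENNReal.toReal_nonneg
  have hβe : Hs s (U t₀) = ENNReal.ofReal β := (ENNReal.ofReal_toReal hfin).symm
  obtain ⟨C, T, -, hT, -, hex⟩ := exists_modeFlow_univ A hA hs β
  obtain ⟨W, hW, hW0, hWb⟩ := hex (U t₀) β (hU.reg t₀ ht₀) hβ0 le_rfl hβe.le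
  obtain ⟨δ, hδ, hball⟩ := Metric.isOpen_iff.1 hJ t₀ ht₀
  -- near `t₀` the solution is the one restarted from `t₀`
  have hTopen : IsOpen {t : ℝ | |t| * β < T} := isOpen_lt (by fun_prop) continuous_const
  have hev : ∀ᶠ t in 𝓝 t₀, Hs s (U t) ≤ ENNReal.ofReal (β * Real.exp (C * β * |t - t₀|)) := by
    have h1 : ∀ᶠ t in 𝓝 t₀, |t - t₀| * β < T := by
      have h2 : Filter.Tendsto (fun t => t - t₀) (𝓝 t₀) (𝓝 0) := tendsto_sub_nhds_zero_iff.2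
        Filter.tendsto_id
      exact h2.eventually (hTopen.mem_nhds (by simpa using hT))
    filter_upwards [h1, Metric.ball_mem_nhds t₀ hδ] with t h2 h3
    have hsubW : Set.uIcc 0 (t - t₀) ⊆ {t : ℝ | |t| * β < T} := fun τ hτ =>
      lt_of_le_of_lt (mul_le_mul_of_nonneg_right (abs_le_of_mem_uIcc hτ) hβ0) h2
    have hsubU : Set.uIcc 0 (t - t₀) ⊆ (fun τ => τ + t₀) ⁻¹' J := fun τ hτ => hball (by
      rw [Metric.mem_ball, Real.dist_eq, add_sub_cancel_right]
      exact lt_of_le_of_lt (abs_le_of_mem_uIcc hτ) (by rwa [Metric.mem_ball, Real.dist_eq] at h3))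
    have hβX : 0 ≤ β * Real.exp (|C| * β * |t - t₀|) := by positivity
    have heq := modeFlow_unique A hA hs (t := t - t₀)
      (m := |m| + β * Real.exp (|C| * β * |t - t₀|)) (by positivity)
      (((hU.shift t₀)).mono hsubU) (hW.mono hsubW)
      (fun τ hτ => (hm _ (hsubU hτ)).trans (ENNReal.ofReal_le_ofReal (by linarith [le_abs_self m])))
      (fun τ hτ => (hWb τ (hsubW hτ)).trans (ENNReal.ofReal_le_ofReal (by
        have h5 : β * Real.exp (C * β * |τ|) ≤ β * Real.exp (|C| * β * |t - t₀|) := by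
          have h6 := abs_le_of_mem_uIcc hτ
          have h7 := le_abs_self C
          gcongr
        linarith [abs_nonneg m])))
      (by simp [hW0])
    rw [sub_add_cancel] at heq
    rw [heq]
    exact hWb _ h2
  have hlim : Filter.Tendsto (fun t => β * Real.exp (C * β * |t - t₀|)) (𝓝 t₀) (𝓝 β) := by
    have : Continuous fun t => β * Real.exp (C * β * |t - t₀|) := by fun_prop
    have h2 := this.tendsto t₀
    simpa using h2
  have h := tendsto_nH_sub s hβ0
    (fun k => (hU.deriv t₀ ht₀ k (Set.mem_univ k)).continuousAt) hev hβe hlim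
  refine h.congr' ?_
  filter_upwards [hJ.mem_nhds ht₀] with t ht
  rw [Hs_eq_nH_sub s (hU.reg t ht) (hU.reg t₀ ht₀)]

/-- Local existence for the hyperbolic system. -/
lemma exists_flow_univ (A : Coefficients d n)
    (hA : ∀ (j : Fin d) (u : Fin n → ℝ), (A.at j u).IsHermitian) {s : ℝ}
    (hs : (d : ℝ) / 2 + 1 < s) (M : ℝ) :
    ∃ C T : ℝ, 0 < C ∧ 0 < T ∧ Real.exp (C * T) ≤ 2 ∧ ∀ (u : Func d n) (r : ℝ), Reg u → 0 ≤ r →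
      r ≤ M → Hs s u ≤ ENNReal.ofReal r →
      ∃ U, Flow A Set.univ s {t | |t| * r < T} U ∧ U 0 = u ∧
        ∀ t, |t| * r < T → Hs s (U t) ≤ ENNReal.ofReal (r * Real.exp (C * r * |t|)) := by
  obtain ⟨C, T, hC, hT, hexp, hex⟩ := exists_modeFlow_univ A hA hs M
  refine ⟨C, T, hC, hT, hexp, fun u r hu hr hrM hur => ?_⟩
  obtain ⟨U, hU, hU0, hUb⟩ := hex u r hu hr hrM hur
  have hIo : IsOpen {t : ℝ | |t| * r < T} := isOpen_lt (by fun_prop) continuous_const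
  have hI0 : (0 : ℝ) ∈ {t : ℝ | |t| * r < T} := by
    change |(0 : ℝ)| * r < T
    simpa using hT
  have hm : ∀ t ∈ {t : ℝ | |t| * r < T}, Hs s (U t) ≤ ENNReal.ofReal (r * 2) := by
    intro t ht
    refine (hUb t ht).trans (ENNReal.ofReal_le_ofReal ?_)
    gcongr
    refine le_trans (Real.exp_le_exp.2 ?_) hexp
    calc C * r * |t| = C * (|t| * r) := by ring
      _ ≤ C * T := by
        gcongr
        exact le_of_lt ht
  refine ⟨U, ⟨hU, hIo, ?_, hI0, fun t ht =>
    ne_top_of_le_ne_top ENNReal.ofReal_ne_top (hm t ht),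
    fun t ht => hU.tendsto_Hs_sub hA hs hIo hm ht⟩, hU0, hUb⟩
  refine Set.ordConnected_of_uIcc_subset_left (x := 0) fun t ht τ hτ => ?_
  exact lt_of_le_of_lt (mul_le_mul_of_nonneg_right (abs_le_of_mem_uIcc hτ) hr) ht

end Existence

/-! ### Maximal solutions with given data -/

section Data

variable {d n : ℕ}

lemma IsMaximalSolution.isMaxFlow {A : Coefficients d n} {S : Set (Fin d → ℤ)} {s : ℝ}
    {P : Func d n → Func d n} (hP : Multiplier P S)
    (hs : (d : ℝ) / 2 + 1 < s) {U₀ u : Func d n} (hU₀ : MemHs s U₀) (hu : Reg u)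
    (hu₀ : vc u = S.indicator (vc U₀)) {I J : Set ℝ} {U V : ℝ → Func d n}
    (hV : IsMaximalSolution P A s U₀ I V) (h : IsMaxFlow A S s u J U) : IsMaxFlow A S s u I V := by
  obtain ⟨rfl, heq⟩ := (uniqueMaximal_of_isMaxFlow hP hs hU₀ hu hu₀ h).2 I V hV
  refine ⟨h.flow.congr heq, (heq h.flow.zero_mem).trans h.init, fun J' U' hU' h0 => ?_⟩
  obtain ⟨h1, h2⟩ := h.max J' U' hU' h0
  exact ⟨h1, fun t ht => (h2 ht).trans (heq (h1 ht)).symm⟩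

lemma hasUniqueMaximalSolution_of_isMaxFlow {A : Coefficients d n} {S : Set (Fin d → ℤ)} {s : ℝ}
    {P : Func d n → Func d n} (hP : Multiplier P S)
    (hs : (d : ℝ) / 2 + 1 < s) {U₀ u : Func d n} (hU₀ : MemHs s U₀) (hu : Reg u)
    (hu₀ : vc u = S.indicator (vc U₀)) {J : Set ℝ} {U : ℝ → Func d n}
    (h : IsMaxFlow A S s u J U) : HasUniqueMaximalSolution P A s U₀ := by
  obtain ⟨h1, h2⟩ := uniqueMaximal_of_isMaxFlow hP hs hU₀ hu hu₀ h
  refine ⟨⟨J, U, h1⟩, fun I I' V V' hV hV' => ?_⟩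
  obtain ⟨rfl, h3⟩ := h2 I V hV
  obtain ⟨rfl, h4⟩ := h2 I' V' hV'
  exact ⟨rfl, fun t ht => (h3 ht).trans (h4 ht).symm⟩

/-- Every function of class `H^s` has a representative with absolutely convergent Fourier series. -/
lemma exists_reg_representative {s : ℝ} (hs : (d : ℝ) / 2 + 1 < s) {U₀ : Func d n}
    (hU₀ : MemHs s U₀) : ∃ u, Reg u ∧ vc u = vc U₀ := by
  obtain ⟨C, hC⟩ := n1_le_nH (d := d) hs
  exact ⟨_, reg_synth (hermitian_vc U₀) (ne_top_of_le_ne_top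
    (ENNReal.mul_ne_top ENNReal.coe_ne_top hU₀.Hs_ne_top) (hC (ev U₀)))⟩

lemma exists_isMaxFlow_univ (A : Coefficients d n)
    (hA : ∀ (j : Fin d) (u : Fin n → ℝ), (A.at j u).IsHermitian) {s : ℝ}
    (hs : (d : ℝ) / 2 + 1 < s) {U₀ : Func d n} (hU₀ : MemHs s U₀) :
    ∃ u J U, Reg u ∧ vc u = Set.univ.indicator (vc U₀) ∧ IsMaxFlow A Set.univ s u J U := by
  obtain ⟨u, hu, hu₀⟩ := exists_reg_representative hs hU₀
  obtain ⟨C, T, -, -, -, hex⟩ := exists_flow_univ A hA hs (hsNorm s U₀)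
  obtain ⟨U, hU, hU0, -⟩ := hex u _ hu (hsNorm_nonneg s U₀) le_rfl
    (by rw [← hU₀.Hs_eq]; unfold Hs ev; rw [hu₀])
  obtain ⟨J, V, hV⟩ := exists_isMaxFlow (uniqueFlow_univ A hA hs) ⟨_, U, hU, hU0⟩
  exact ⟨u, J, V, hu, by rw [Set.indicator_univ, hu₀], hV⟩

lemma vc_sharpFilter_eq_indicator (N : ℕ) (U₀ : Func d n) :
    vc (sharpFilter N U₀) = (box d N : Set (Fin d → ℤ)).indicator (vc U₀) :=
  funext fun k => isFilter_sharpFilter N U₀ k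

lemma exists_isMaxFlow_box (A : Coefficients d n)
    (hA : ∀ (j : Fin d) (u : Fin n → ℝ), (A.at j u).IsHermitian) {s : ℝ}
    (hs : (d : ℝ) / 2 + 1 < s) (N : ℕ) (U₀ : Func d n) :
    ∃ J V, IsMaxFlow A (box d N) s (sharpFilter N U₀) J V :=
  exists_galerkin_max A hA hs (reg_sharpFilter N U₀)
    fun k hk => by rw [vc_sharpFilter, boxCoeff_eq_zero hk]

/-- An `L²` error of order `N^{-s}` and bounds in `H^s` give errors of order `N^{r-s}` in `H^r`. -/
lemma hsNorm_sub_le_of_N2_le {s : ℝ} {U V : Func d n} (hU : Reg U) (hV : Reg V) {N : ℕ} (hN : 1 ≤ N)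
    {a b c : ℝ} (ha : 0 ≤ a) (hb : 0 ≤ b) (hc : 0 ≤ c)
    (h : N2 (fun k => ‖vc U k - vc V k‖ₑ) ≤ ENNReal.ofReal (a * (N : ℝ) ^ (-s)))
    (hbU : Hs s U ≤ ENNReal.ofReal b) (hcV : Hs s V ≤ ENNReal.ofReal c) {r : ℝ} (hr : 0 ≤ r)
    (hrs : r ≤ s) : hsNorm r (U - V) ≤ (a + b + c) * (N : ℝ) ^ (r - s) := by
  have hN0 : (0 : ℝ) < N := by exact_mod_cast hN
  refine hsNorm_le_of_Hs_le (by positivity) ?_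
  rw [Hs_eq_nH_sub r hU hV]
  refine (nH_interp hN0 hr hrs _).trans ?_
  rw [nH_zero_eq]
  have h2 : nH s (fun k => ‖vc U k - vc V k‖ₑ) ≤ ENNReal.ofReal (b + c) := by
    refine (nH_mono fun k => enorm_sub_le).trans ((nH_add_le s (ev U) (ev V)).trans ?_)
    rw [ENNReal.ofReal_add hb hc]
    exact add_le_add hbU hcV
  calc _ ≤ ENNReal.ofReal ((N : ℝ) ^ r) * ENNReal.ofReal (a * (N : ℝ) ^ (-s))
        + ENNReal.ofReal ((N : ℝ) ^ (r - s)) * ENNReal.ofReal (b + c) := by gcongr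
    _ = ENNReal.ofReal ((N : ℝ) ^ r * (a * (N : ℝ) ^ (-s)) + (N : ℝ) ^ (r - s) * (b + c)) := by
        rw [← ENNReal.ofReal_mul (by positivity), ← ENNReal.ofReal_mul (by positivity),
          ← ENNReal.ofReal_add (by positivity) (by positivity)]
    _ = _ := by
        congr 1
        rw [sub_eq_add_neg, Real.rpow_add hN0]
        ring

end Data

/-! ### Uniform times, convergence, and long-time existence -/

section Main

variable {d n : ℕ}

lemma exists_uniformTime (A : Coefficients d n)
    (hA : ∀ (j : Fin d) (u : Fin n → ℝ), (A.at j u).IsHermitian) {s : ℝ}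
    (hs : (d : ℝ) / 2 + 1 < s) (M : ℝ) :
    ∃ T : ℝ, IsUniformTime {id} A s M T ∧ IsUniformTime (Set.range sharpFilter) A s M T := by
  obtain ⟨C₁, T₁, hC₁, hT₁, hexp₁, hex⟩ := exists_flow_univ A hA hs M
  obtain ⟨C₂, T₂, hC₂, hT₂, hexp₂, hgal⟩ := exists_galerkin_bound A hA hs M
  have hexp : ∀ {C T' : ℝ}, 0 < C → Real.exp (C * T') ≤ 2 → ∀ {r t : ℝ}, 0 ≤ r → t * r ≤ T' →
      r * Real.exp (C * r * t) ≤ 2 * r := by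
    intro C T' hC h r t hr htr
    rw [mul_comm 2 r]
    gcongr
    refine le_trans (Real.exp_le_exp.2 ?_) h
    calc C * r * t = C * (t * r) := by ring
      _ ≤ C * T' := by gcongr
  -- the solution is only known to exist for `t * |U⁰| < T₁`, hence the factor `1 / 2`
  refine ⟨min (T₁ / 2) T₂, ⟨by positivity, C₁, hC₁, ?_⟩, ⟨by positivity, C₂, hC₂, ?_⟩⟩
  · rintro P rfl U₀ hU₀ hM
    obtain ⟨u, J, W, hu, hu₀, hW⟩ := exists_isMaxFlow_univ A hA hs hU₀
    refine ⟨hasUniqueMaximalSolution_of_isMaxFlow multiplier_id hs hU₀ hu hu₀ hW,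
      fun I U hU t ht htr => ?_⟩
    have hmax := hU.isMaxFlow multiplier_id hs hU₀ hu hu₀ hW
    have htr₁ : t * hsNorm s U₀ ≤ T₁ / 2 := htr.trans (min_le_left _ _)
    have hr := hsNorm_nonneg s U₀
    obtain ⟨V, hV, hV0, hVb⟩ := hex u _ hu hr hM
      (by rw [← hU₀.Hs_eq]; unfold Hs ev; rw [hu₀, Set.indicator_univ])
    obtain ⟨h1, h2⟩ := hmax.max _ V hV hV0
    have htmem : |t| * hsNorm s U₀ < T₁ := by
      rw [abs_of_nonneg ht]
      linarith
    refine ⟨h1 htmem, ?_, hexp hC₁ hexp₁ hr (htr₁.trans (by linarith))⟩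
    have h3 := hVb t htmem
    rw [h2 htmem, abs_of_nonneg ht] at h3
    exact hsNorm_le_of_Hs_le (by positivity) h3
  · rintro P ⟨N, rfl⟩ U₀ hU₀ hM
    obtain ⟨J, W, hW⟩ := exists_isMaxFlow_box A hA hs N U₀
    have hu₀ := vc_sharpFilter_eq_indicator N U₀
    refine ⟨hasUniqueMaximalSolution_of_isMaxFlow (multiplier_sharpFilter N) hs hU₀
      (reg_sharpFilter N U₀) hu₀ hW, fun I U hU t ht htr => ?_⟩
    have hmax := hU.isMaxFlow (multiplier_sharpFilter N) hs hU₀ (reg_sharpFilter N U₀) hu₀ hW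
    have htr₂ : t * hsNorm s U₀ ≤ T₂ := htr.trans (min_le_right _ _)
    have hr := hsNorm_nonneg s U₀
    obtain ⟨h1, h2⟩ := hgal N _ (hsNorm s U₀) I U hr hM
      (((vc_boxCoeff_initial (vc_sharpFilter N U₀)).2 s).trans hU₀.Hs_eq.le) hmax t
      (by rwa [abs_of_nonneg ht])
    rw [abs_of_nonneg ht] at h2
    exact ⟨h1, hsNorm_le_of_Hs_le (by positivity) h2, hexp hC₂ hexp₂ hr htr₂⟩

lemma exists_error_bound (A : Coefficients d n)
    (hA : ∀ (j : Fin d) (u : Fin n → ℝ), (A.at j u).IsHermitian) {s : ℝ}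
    (hs : (d : ℝ) / 2 + 1 < s) (M : ℝ) (T : ℝ) (hT : IsUniformTime {id} A s M T)
    (hTN : IsUniformTime (Set.range sharpFilter) A s M T) :
    ∃ C : ℝ, 0 < C ∧ ∀ U₀ : Func d n, MemHs s U₀ → hsNorm s U₀ ≤ M →
      ∀ (I : Set ℝ) (U : ℝ → Func d n), IsMaximalSolution id A s U₀ I U → ∀ N : ℕ, 1 ≤ N →
      ∀ (I_N : Set ℝ) (U_N : ℝ → Func d n), IsMaximalSolution (sharpFilter N) A s U₀ I_N U_N →
      ∀ t : ℝ, 0 ≤ t → t * hsNorm s U₀ ≤ T → ∀ r : ℝ, 0 ≤ r → r ≤ s →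
        hsNorm r (U t - U_N t) ≤ C * hsNorm s U₀ * (N : ℝ) ^ (r - s) := by
  obtain ⟨-, C₁, -, hb₁⟩ := hT
  obtain ⟨-, C₂, -, hb₂⟩ := hTN
  obtain ⟨K, hK, herr⟩ := exists_galerkin_error A hA hs (2 * M) (2 * T)
  refine ⟨2 * K + 4, by positivity, ?_⟩
  intro U₀ hU₀ hM I U hU N hN I_N U_N hUN t ht htT r hr hrs
  obtain ⟨hfU, h0U⟩ := hU.1.flow multiplier_id hs
  obtain ⟨hfN, h0N⟩ := hUN.1.flow (multiplier_sharpFilter N) hs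
  have hb := (hb₁ id rfl U₀ hU₀ hM).2 I U hU
  have hbN := (hb₂ _ ⟨N, rfl⟩ U₀ hU₀ hM).2 I_N U_N hUN
  have hr₀ := hsNorm_nonneg s U₀
  have hsub : ∀ τ ∈ Set.uIcc 0 t, 0 ≤ τ ∧ τ * hsNorm s U₀ ≤ T := by
    intro τ hτ
    rw [Set.uIcc_of_le ht] at hτ
    exact ⟨hτ.1, (mul_le_mul_of_nonneg_right hτ.2 hr₀).trans htT⟩
  have hbU : ∀ τ ∈ Set.uIcc 0 t, Hs s (U τ) ≤ ENNReal.ofReal (2 * hsNorm s U₀) := by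
    intro τ hτ
    obtain ⟨h1, h2, h3⟩ := hb τ (hsub τ hτ).1 (hsub τ hτ).2
    rw [(hfU.memHs h1).Hs_eq]
    exact ENNReal.ofReal_le_ofReal (h2.trans h3)
  have hbV : ∀ τ ∈ Set.uIcc 0 t, Hs s (U_N τ) ≤ ENNReal.ofReal (2 * hsNorm s U₀) := by
    intro τ hτ
    obtain ⟨h1, h2, h3⟩ := hbN τ (hsub τ hτ).1 (hsub τ hτ).2
    rw [(hfN.memHs h1).Hs_eq]
    exact ENNReal.ofReal_le_ofReal (h2.trans h3)
  have htI := (hb t ht htT).1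
  have htN := (hbN t ht htT).1
  have hN2 := herr (2 * hsNorm s U₀) N Set.univ U U_N t (by linarith) (by linarith) hN
    (Set.subset_univ _) (by rw [abs_of_nonneg ht]; linarith)
    (hfU.toModeFlow.mono (hfU.uIcc_subset htI)) (hfN.toModeFlow.mono (hfN.uIcc_subset htN))
    (fun k hk => by rw [h0N, h0U, Set.indicator_univ, Set.indicator_of_mem hk]) hbU hbV
  refine (hsNorm_sub_le_of_N2_le (hfU.reg t htI) (hfN.reg t htN) hN (by positivity)
    (by positivity) (by positivity) hN2 (hbU t Set.right_mem_uIcc) (hbV t Set.right_mem_uIcc)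
    hr hrs).trans (le_of_eq ?_)
  ring

lemma exists_longtime_error_bound (A : Coefficients d n)
    (hA : ∀ (j : Fin d) (u : Fin n → ℝ), (A.at j u).IsHermitian) {s : ℝ}
    (hs : (d : ℝ) / 2 + 1 < s) (L B : ℝ) :
    ∃ N₀ : ℕ, 1 ≤ N₀ ∧ ∃ C' : ℝ, 0 < C' ∧ ∀ U₀ : Func d n, MemHs s U₀ →
      ∀ (I : Set ℝ) (U : ℝ → Func d n), IsMaximalSolution id A s U₀ I U →
      ∀ K : Set ℝ, IsCompact K → K ⊆ I → Metric.diam (convexHull ℝ (insert 0 K)) ≤ L →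
      ∀ M' : ℝ, IsLUB ((fun t => hsNorm s (U t)) '' convexHull ℝ (insert 0 K)) M' → M' ≤ B →
      ∀ N : ℕ, N₀ ≤ N → ∀ (I_N : Set ℝ) (U_N : ℝ → Func d n),
        IsMaximalSolution (sharpFilter N) A s U₀ I_N U_N →
        K ⊆ I_N ∧ ∀ t ∈ K, ∀ r : ℝ, 0 ≤ r → r ≤ s →
          hsNorm r (U t - U_N t) ≤ C' * M' * (N : ℝ) ^ (r - s) := by
  obtain ⟨N₀, hN₀, K₀, hK₀, hmain⟩ := exists_approx A hA hs L B
  refine ⟨N₀, hN₀, 2 * K₀ + 1, by positivity, ?_⟩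
  intro U₀ hU₀ I U hU K hK hKI hL M' hM' hB N hN I_N U_N hUN
  obtain ⟨hfU, h0U⟩ := hU.1.flow multiplier_id hs
  obtain ⟨J, W, hW⟩ := exists_isMaxFlow_box A hA hs N U₀
  have hmax := hUN.isMaxFlow (multiplier_sharpFilter N) hs hU₀ (reg_sharpFilter N U₀)
    (vc_sharpFilter_eq_indicator N U₀) hW
  have h0 : vc (sharpFilter N U₀) = boxCoeff N (U 0) := by
    rw [vc_sharpFilter]
    ext1 k
    rw [boxCoeff, boxCoeff, h0U, Set.indicator_univ]
  have h0mem : (0 : ℝ) ∈ convexHull ℝ (insert 0 K) :=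
    subset_convexHull ℝ _ (Set.mem_insert _ _)
  have hM'0 : 0 ≤ M' := (hsNorm_nonneg s (U 0)).trans (hM'.1 ⟨0, h0mem, rfl⟩)
  have key : ∀ t ∈ K, t ∈ I_N ∧
      N2 (fun k => ‖vc (U t) k - vc (U_N t) k‖ₑ) ≤ ENNReal.ofReal (K₀ * M' * (N : ℝ) ^ (-s)) ∧
        Hs s (U_N t) ≤ ENNReal.ofReal (K₀ * M') ∧ Hs s (U t) ≤ ENNReal.ofReal M' := by
    intro t ht
    have htmem : t ∈ convexHull ℝ (insert 0 K) := subset_convexHull ℝ _ (Set.mem_insert_of_mem _ ht)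
    have hsub : Set.uIcc 0 t ⊆ convexHull ℝ (insert 0 K) := by
      rw [← segment_eq_uIcc]
      exact (convex_convexHull ℝ _).segment_subset h0mem htmem
    have hb : ∀ τ ∈ Set.uIcc 0 t, Hs s (U τ) ≤ ENNReal.ofReal M' := fun τ hτ => by
      rw [(hfU.memHs (hfU.uIcc_subset (hKI ht) hτ)).Hs_eq]
      exact ENNReal.ofReal_le_ofReal (hM'.1 ⟨τ, hsub hτ, rfl⟩)
    have htL : |t| ≤ L := by
      have h1 := Metric.dist_le_diam_of_mem
        (isBounded_convexHull.2 (hK.insert 0).isBounded) htmem h0mem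
      rw [Real.dist_eq, sub_zero] at h1
      exact h1.trans hL
    obtain ⟨h1, h2, h3⟩ := hmain U t M' (hfU.toModeFlow.mono (hfU.uIcc_subset (hKI ht))) hM'0 hB htL
      hb N hN _ I_N U_N h0 hmax
    exact ⟨h1, h2, h3, hb t Set.right_mem_uIcc⟩
  refine ⟨fun t ht => (key t ht).1, fun t ht r hr hrs => ?_⟩
  obtain ⟨h1, h2, h3, h4⟩ := key t ht
  refine (hsNorm_sub_le_of_N2_le (hfU.reg t (hKI ht)) (hmax.flow.reg t h1) (hN₀.trans hN)
    (by positivity) hM'0 (by positivity) h2 h4 h3 hr hrs).trans (le_of_eq ?_)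
  ring

end Main

end

end FourierGalerkin

theorem proposition2p3 (d n : ℕ) (A : FourierGalerkin.Coefficients d n)
    (hA : ∀ (j : Fin d) (u : Fin n → ℝ), (A.at j u).IsHermitian)
    (s : ℝ) (hs : (d : ℝ) / 2 + 1 < s) (M : ℝ) (hM : 0 < M) :
    -- there are time scales `T`, depending only on `A`, `s` and `M`, valid for the hyperbolic
    -- system and for all its semi-discretizations
    (∃ T : ℝ, FourierGalerkin.IsUniformTime {id} A s M T ∧
      FourierGalerkin.IsUniformTime (Set.range FourierGalerkin.sharpFilter) A s M T) ∧
    -- convergence on `[0, T / |U⁰|_{H^s}]`, for any such `T`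
    (∀ T : ℝ, FourierGalerkin.IsUniformTime {id} A s M T →
      FourierGalerkin.IsUniformTime (Set.range FourierGalerkin.sharpFilter) A s M T →
      ∃ C : ℝ, 0 < C ∧
        ∀ U₀ : FourierGalerkin.Func d n, FourierGalerkin.MemHs s U₀ →
          FourierGalerkin.hsNorm s U₀ ≤ M →
        ∀ (I : Set ℝ) (U : ℝ → FourierGalerkin.Func d n),
          FourierGalerkin.IsMaximalSolution id A s U₀ I U →
        ∀ N : ℕ, 1 ≤ N →
        ∀ (I_N : Set ℝ) (U_N : ℝ → FourierGalerkin.Func d n),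
          FourierGalerkin.IsMaximalSolution (FourierGalerkin.sharpFilter N) A s U₀ I_N U_N →
        ∀ t : ℝ, 0 ≤ t → t * FourierGalerkin.hsNorm s U₀ ≤ T →
        ∀ r : ℝ, 0 ≤ r → r ≤ s →
          FourierGalerkin.hsNorm r (U t - U_N t)
            ≤ C * FourierGalerkin.hsNorm s U₀ * (N : ℝ) ^ (r - s)) ∧
    -- existence and convergence on compact subsets of the maximal interval
    (∀ L B : ℝ, ∃ N₀ : ℕ, 1 ≤ N₀ ∧ ∃ C' : ℝ, 0 < C' ∧
      ∀ U₀ : FourierGalerkin.Func d n, FourierGalerkin.MemHs s U₀ →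
      ∀ (I : Set ℝ) (U : ℝ → FourierGalerkin.Func d n),
        FourierGalerkin.IsMaximalSolution id A s U₀ I U →
      ∀ K : Set ℝ, IsCompact K → K ⊆ I →
        Metric.diam (convexHull ℝ (insert 0 K)) ≤ L →
      ∀ M' : ℝ, IsLUB ((fun t => FourierGalerkin.hsNorm s (U t)) '' convexHull ℝ (insert 0 K)) M' →
        M' ≤ B →
      ∀ N : ℕ, N₀ ≤ N →
      ∀ (I_N : Set ℝ) (U_N : ℝ → FourierGalerkin.Func d n),
        FourierGalerkin.IsMaximalSolution (FourierGalerkin.sharpFilter N) A s U₀ I_N U_N →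
        K ⊆ I_N ∧
        ∀ t ∈ K, ∀ r : ℝ, 0 ≤ r → r ≤ s →
          FourierGalerkin.hsNorm r (U t - U_N t) ≤ C' * M' * (N : ℝ) ^ (r - s)) := by
  exact ⟨FourierGalerkin.exists_uniformTime A hA hs M,
    fun T hT hTN => FourierGalerkin.exists_error_bound A hA hs M T hT hTN,
    fun L B => FourierGalerkin.exists_longtime_error_bound A hA hs L B⟩
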